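/- Write $\mathbb{T}=\mathbb{R}/2\pi\mathbb{Z}$, $\mathcal{H}=L^2([0,\pi]\times\mathbb{T})$ with inner product $\langle\cdot,\cdot\rangle$ and norm $\|\cdot\|$, and $\Box u=u_{tt}-u_{ss}$, $u^+=\max\{u,0\}$, $u^-=\max\{-u,0\}$. For integers $m\ge 1$, $n\ge 0$ let $\phi_{(m,n)}=\frac{\sqrt2}{\pi}\sin(ms)\cos(nt)$ and $\psi_{(m,n)}=\frac{\sqrt2}{\pi}\sin(ms)\sin(nt)$; these are eigenfunctions of $\Box$ with Dirichlet conditions at $s=0,\pi$, with eigenvalue $m^2-n^2$. Let $\cdots<\lambda_{-1}<\lambda_0=0<\lambda_1<\cdots$ be the values $m^2-n^2$ in increasing order. Let $\mathcal{R}$ and $\mathcal{N}$ be the closed spans in $\mathcal{H}$ of the eigenfunctions with $m\ne n$ and with $m=n$ respectively, and let $\mathcal{H}^1$ be the set of $x\in\mathcal{R}\cap H^1([0,\pi]\times\mathbb{T})$ with zero trace at $s=0$ and $s=\pi$. **Weak solutions.** For $p:[0,\pi]\times\mathbb{T}\times\mathbb{R}\to\mathbb{R}$ and $P(s,t,u)=\int_0^u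 p(s,t,\tau)\,d\tau$, a weak solution of $$\Box u=au^+-bu^-+p(s,t,u)\ \text{ in } ]0,\pi[\times\mathbb{T},\qquad u(0,t)=u(\pi,t)=0,\qquad(1)$$ is a function $u=x+y$ for which $(x,y)\in\mathcal{H}^1\times\mathcal{N}$ is a critical point of $$\tfrac12\left(\|x_s\|^2-\|x_t\|^2-a\|(x+y)^+\|^2-b\|(x+y)^-\|^2\right)-\iint P(s,t,x+y)\,ds\,dt .$$ **The curve $\mathcal{C}_k$.** Let $\lambda_k\neq0$. Call $(\varepsilon_1,\varepsilon_2)$ admissible if $0<\varepsilon_1<\lambda_k-\lambda_{k-1}$ and $0<\varepsilon_2<\frac{1}{\lambda_k-p_k}-\max\{0,-\frac1{p_k}\}$, where $p_k=\lambda_{k-1}+\varepsilon_1$. Put $\mu=\max\{0,-\frac1{p_k}\}+\varepsilon_2$, $q_k=p_k+\frac1\mu$, $Q_k=\,]p_k,q_k[^2$. Let $L:\mathcal{H}\to\mathcal{H}$ be the bounded operator with $Le=(m^2-n^2-p_k)^{-1}e$ for $e=\phi_{(m,n)},\psi_{(m,n)}$. For $r>0$ let $$\check a(r)=\sup_{v\in\mathcal{H},\,v\ne0}\frac{\langle(L-\mu)v,v\rangle}{\|v^+\|^2+r\|v^-\|^2},$$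 and let $\mathcal{C}_k\subset Q_k$ be the curve of the points $\left(p_k+\frac1{\check a(r)+\mu},\,p_k+\frac1{r\check a(r)+\mu}\right)$, $r>0$. (The curves for different admissible pairs agree on the intersection of the squares.) Let $\check Q_k=\,]\lambda_{k-1},+\infty[^2$ if $\lambda_k>0$ and $\check Q_k=\,]\lambda_{k-1},0[^2$ if $\lambda_k<0$. A point of $\check Q_k$ is below $\mathcal{C}_k$ if, for some admissible $(\varepsilon_1,\varepsilon_2)$, it lies in the connected component of $Q_k\setminus\mathcal{C}_k$ that contains $]p_k,\lambda_k[^2$. **Theorem.** Let $\lambda_k\ne0$, let $(a,b)\in\check Q_k$ lie below $\mathcal{C}_k$, and let $p:[0,\pi]\times\mathbb{T}\times\mathbb{R}\to\mathbb{R}$ be continuous with $p(s,t,u)/u\to0$ as $|u|\to\infty$, uniformly in $(s,t)$. Assume that, with increasing and decreasing meant in the wide sense: - (H1) there is $\underline\varepsilon_0>0$ such that for each $(s,t)$ the map $u\mapsto au^+-bu^-+p(s,t,u)-(\lambda_{k-1}+\underline\varepsilon_0)u$ is increasing; - (H2) if $\lambda_k>0$, there is $\overline\varepsilon_0>0$ such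 that for each $(s,t)$ the map $u\mapsto p(s,t,u)-\frac1{\overline\varepsilon_0}u$ is decreasing; - (H3) if $\lambda_k<0$, there is $\overline\varepsilon_0>0$ such that for each $(s,t)$ the map $u\mapsto au^+-bu^-+p(s,t,u)+\overline\varepsilon_0u$ is decreasing. Then problem (1) has a weak solution. Moreover, there are admissible $(\varepsilon_1,\varepsilon_2)$ with $(a,b)\in Q_k$ such that for each $(s,t)$ the map $u\mapsto au^+-bu^-+p(s,t,u)-p_ku$ is strictly increasing and $u\mapsto au^+-bu^-+p(s,t,u)-q_ku$ is strictly decreasing; and for every such choice, with $$J(s,t,u)=\tfrac12(a-p_k)(u^+)^2+\tfrac12(b-p_k)(u^-)^2+P(s,t,u),\qquad J^*(s,t,v)=\sup_{u\in\mathbb{R}}\,[vu-J(s,t,u)],$$ the functional $$I(v)=\tfrac12\langle(L-\mu)v,v\rangle-\iint\left[J^*(s,t,v)-\tfrac\mu2v^2\right]ds\,dt$$ has an absolute maximum on $\mathcal{H}$, and for every maximum point $v_0$ of $I$ the function $u_0=Lv_0$ is a weak solution of (1). -/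

import Mathlib

open MeasureTheory Set

noncomputable section

namespace FucikWave

/-! ### The space `L²([0,π] × 𝕋)`, `𝕋 = ℝ/2πℤ`

Functions on the cylinder `[0,π] × 𝕋` are functions of `(s,t)` on the fundamental domain
`[0,π] × [0,2π]`; continuous objects on the cylinder are `2π`-periodic in `t`. -/

/-- Lebesgue measure on the cylinder. -/
def cyl : Measure (ℝ × ℝ) :=
  volume.restrict (Icc (0 : ℝ) Real.pi ×ˢ Icc (0 : ℝ) (2 * Real.pi))

/-- The Hilbert space `𝓗 = L²([0,π] × 𝕋)`. -/
abbrev HSpace : Type := Lp ℝ 2 cyl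

instance : IsFiniteMeasure cyl := by
  refine ⟨?_⟩
  rw [cyl, Measure.restrict_apply_univ]
  exact (isCompact_Icc.prod isCompact_Icc).measure_lt_top

lemma memLp_of_continuous {h : ℝ × ℝ → ℝ} (hh : Continuous h) : MemLp h 2 cyl := by
  have hK : IsCompact (Icc (0 : ℝ) Real.pi ×ˢ Icc (0 : ℝ) (2 * Real.pi)) :=
    isCompact_Icc.prod isCompact_Icc
  obtain ⟨C, hC⟩ := hK.exists_bound_of_continuousOn hh.continuousOn
  refine MemLp.of_bound hh.aestronglyMeasurable C ?_
  rw [cyl, ae_restrict_iff' hK.measurableSet]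
  exact Filter.Eventually.of_forall hC

lemma integrable_mul (u : HSpace) {h : ℝ × ℝ → ℝ} (hh : Continuous h) :
    Integrable (fun z => u z * h z) cyl :=
  (Lp.memLp u).integrable_mul (memLp_of_continuous hh)

/-! ### Eigenfunctions and eigenvalues of the wave operator -/

/-- `φ_{(m,n)}(s,t) = (√2/π) sin(ms) cos(nt)`. -/
def phi (m n : ℕ) : HSpace :=
  (memLp_of_continuous (h := fun z : ℝ × ℝ =>
    Real.sqrt 2 / Real.pi * (Real.sin (m * z.1) * Real.cos (n * z.2))) (by fun_prop)).toLp _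

/-- `ψ_{(m,n)}(s,t) = (√2/π) sin(ms) sin(nt)`. -/
def psi (m n : ℕ) : HSpace :=
  (memLp_of_continuous (h := fun z : ℝ × ℝ =>
    Real.sqrt 2 / Real.pi * (Real.sin (m * z.1) * Real.sin (n * z.2))) (by fun_prop)).toLp _

/-- The eigenvalues `m² - n²`, `m ≥ 1`, `n ≥ 0`. -/
def eigenvalues : Set ℤ := {l | ∃ m n : ℕ, 1 ≤ m ∧ l = (m : ℤ) ^ 2 - (n : ℤ) ^ 2}

open Classical in
/-- The eigenvalues in increasing order, `… < λ₋₁ < λ₀ = 0 < λ₁ < …`: for `n ≥ 0`, `λ_n` is the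
`n`-th element (counted from `0`) of the eigenvalues in `[0, ∞)`, and `-λ_{-n}` is the `n`-th
natural number `j` for which `-j` is an eigenvalue. -/
def lam : ℤ → ℝ
  | Int.ofNat n => (Nat.nth (fun j : ℕ => (j : ℤ) ∈ eigenvalues) n : ℝ)
  | Int.negSucc n => -(Nat.nth (fun j : ℕ => -(j : ℤ) ∈ eigenvalues) (n + 1) : ℝ)

/-- `𝓡`, the closed span of the `φ_{(m,n)}, ψ_{(m,n)}` with `m ≥ 1`, `n ≥ 0`, `m ≠ n`. -/
def RSpace : Submodule ℝ HSpace :=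
  (Submodule.span ℝ {w | ∃ m n : ℕ, 1 ≤ m ∧ m ≠ n ∧ (w = phi m n ∨ w = psi m n)}).topologicalClosure

/-- `𝓝`, the closed span of the `φ_{(l,l)}, ψ_{(l,l)}` with `l ≥ 1`. -/
def NSpace : Submodule ℝ HSpace :=
  (Submodule.span ℝ {w | ∃ l : ℕ, 1 ≤ l ∧ (w = phi l l ∨ w = psi l l)}).topologicalClosure

/-! ### The energy space `𝓗¹ × 𝓝` -/

/-- Test functions: smooth functions on the closed cylinder, with no boundary condition. -/
def IsTest (g : ℝ × ℝ → ℝ) : Prop :=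
  ContDiff ℝ (⊤ : ℕ∞) g ∧ ∀ s t : ℝ, g (s, t + 2 * Real.pi) = g (s, t)

lemma IsTest.continuous_fderiv_apply {g : ℝ × ℝ → ℝ} (hg : IsTest g) (e : ℝ × ℝ) :
    Continuous (fun z => fderiv ℝ g z e) :=
  (hg.1.continuous_fderiv (by simp)).clm_apply continuous_const

/-- `y` is the weak derivative of `x` in the direction `e`, and the boundary term vanishes: as the
test functions are arbitrary at `s = 0` and `s = π`, for `e = (1,0)` the identity says that `x` has
weak derivative `x_s = y` in the interior and that its trace on `s = 0`, `s = π` is zero. -/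
def HasWeakDeriv (e : ℝ × ℝ) (x y : HSpace) : Prop :=
  ∀ g : ℝ × ℝ → ℝ, IsTest g → ∫ z, x z * fderiv ℝ g z e ∂cyl = -∫ z, y z * g z ∂cyl

lemma integral_add_mul (x y : HSpace) {h : ℝ × ℝ → ℝ} (hh : Continuous h) :
    ∫ z, (x + y : HSpace) z * h z ∂cyl = ∫ z, x z * h z ∂cyl + ∫ z, y z * h z ∂cyl := by
  rw [← integral_add (integrable_mul x hh) (integrable_mul y hh)]
  refine integral_congr_ae ?_
  filter_upwards [Lp.coeFn_add x y] with z hz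
  rw [hz, Pi.add_apply, add_mul]

lemma integral_smul_mul (c : ℝ) (x : HSpace) (h : ℝ × ℝ → ℝ) :
    ∫ z, (c • x : HSpace) z * h z ∂cyl = c * ∫ z, x z * h z ∂cyl := by
  rw [← integral_const_mul]
  refine integral_congr_ae ?_
  filter_upwards [Lp.coeFn_smul c x] with z hz
  rw [hz, Pi.smul_apply, smul_eq_mul, mul_assoc]

lemma HasWeakDeriv.add {e : ℝ × ℝ} {x y x' y' : HSpace} (h : HasWeakDeriv e x y)
    (h' : HasWeakDeriv e x' y') : HasWeakDeriv e (x + x') (y + y') := by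
  intro g hg
  rw [integral_add_mul _ _ (hg.continuous_fderiv_apply e), integral_add_mul _ _ hg.1.continuous,
    h g hg, h' g hg]
  ring

lemma HasWeakDeriv.smul {e : ℝ × ℝ} {x y : HSpace} (c : ℝ) (h : HasWeakDeriv e x y) :
    HasWeakDeriv e (c • x) (c • y) := by
  intro g hg
  rw [integral_smul_mul, integral_smul_mul, h g hg]
  ring

lemma HasWeakDeriv.zero (e : ℝ × ℝ) : HasWeakDeriv e 0 0 := by
  simpa using HasWeakDeriv.smul 0
    (fun g _ => by
      have h0 : ∀ h : ℝ × ℝ → ℝ, ∫ z, (0 : HSpace) z * h z ∂cyl = 0 := fun h => by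
        simpa using integral_smul_mul 0 0 h
      rw [h0, h0, neg_zero] : HasWeakDeriv e 0 0)

/-- `𝓗¹`: the elements `x` of `𝓡` that belong to `H¹([0,π] × 𝕋)` and vanish at `s = 0` and `s = π`.
Such an `x` is stored as the triple `(x, x_s, x_t)` (the weak derivatives are determined by `x`),
so that the norm of the product is equivalent to the `H¹` norm. -/
def H1Space : Submodule ℝ (HSpace × HSpace × HSpace) where
  carrier := {X | X.1 ∈ RSpace ∧ HasWeakDeriv (1, 0) X.1 X.2.1 ∧ HasWeakDeriv (0, 1) X.1 X.2.2}
  add_mem' := fun hX hY => ⟨add_mem hX.1 hY.1, hX.2.1.add hY.2.1, hX.2.2.add hY.2.2⟩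
  zero_mem' := ⟨zero_mem _, HasWeakDeriv.zero _, HasWeakDeriv.zero _⟩
  smul_mem' := fun c _ hX => ⟨RSpace.smul_mem c hX.1, hX.2.1.smul c, hX.2.2.smul c⟩

/-! ### Weak solutions of `u_tt - u_ss = a u⁺ - b u⁻ + p(s,t,u)` -/

/-- `P(s,t,u) = ∫₀ᵘ p(s,t,τ) dτ`. -/
def primP (p : ℝ → ℝ → ℝ → ℝ) (s t u : ℝ) : ℝ := ∫ τ in (0 : ℝ)..u, p s t τ

/-- The energy `½(‖x_s‖² - ‖x_t‖² - a‖(x+y)⁺‖² - b‖(x+y)⁻‖²) - ∬ P(s,t,x+y)` on `𝓗¹ × 𝓝`. -/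
def energy (a b : ℝ) (p : ℝ → ℝ → ℝ → ℝ) (w : H1Space × NSpace) : ℝ :=
  let x : HSpace := w.1.1.1
  let xs : HSpace := w.1.1.2.1
  let xt : HSpace := w.1.1.2.2
  let u : HSpace := x + w.2.1
  1 / 2 * (‖xs‖ ^ 2 - ‖xt‖ ^ 2 - a * ‖Lp.posPart u‖ ^ 2 - b * ‖Lp.negPart u‖ ^ 2)
    - ∫ z, primP p z.1 z.2 (u z) ∂cyl

/-- `u = x + y` is a weak solution: `(x, y)` is a critical point of the energy. -/
def IsWeakSolution (a b : ℝ) (p : ℝ → ℝ → ℝ → ℝ) (u : HSpace) : Prop :=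
  ∃ w : H1Space × NSpace, u = w.1.1.1 + w.2.1 ∧
    HasFDerivAt (energy a b p) (0 : (H1Space × NSpace) →L[ℝ] ℝ) w

/-! ### The curve `𝓒_k` -/

/-- The inverse of `□ - d`, for `d` not an eigenvalue. The coefficient of `v` along an eigenfunction
`e` is `⟨e, v⟩/‖e‖²` (`φ_{(m,0)}` is not a unit vector, and `ψ_{(m,0)} = 0`). -/
def opL (d : ℝ) (v : HSpace) : HSpace :=
  ∑' i : ℕ+ × ℕ,
    ((inner ℝ (phi i.1 i.2) v / ‖phi i.1 i.2‖ ^ 2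
        / (((i.1 : ℕ) : ℝ) ^ 2 - (i.2 : ℝ) ^ 2 - d)) • phi i.1 i.2
      + (inner ℝ (psi i.1 i.2) v / ‖psi i.1 i.2‖ ^ 2
        / (((i.1 : ℕ) : ℝ) ^ 2 - (i.2 : ℝ) ^ 2 - d)) • psi i.1 i.2)

/-- `p_k = λ_{k-1} + ε₁`. -/
def pk (k : ℤ) (ε₁ : ℝ) : ℝ := lam (k - 1) + ε₁

/-- `μ = max{0, -1/(λ_{k-1} + ε₁)} + ε₂`. -/
def mu (k : ℤ) (ε₁ ε₂ : ℝ) : ℝ := max 0 (-1 / pk k ε₁) + ε₂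

/-- `q_k = λ_{k-1} + ε₁ + 1/μ`. -/
def qk (k : ℤ) (ε₁ ε₂ : ℝ) : ℝ := pk k ε₁ + 1 / mu k ε₁ ε₂

/-- The allowed range of the parameters `ε₁`, `ε₂`. -/
def Admissible (k : ℤ) (ε₁ ε₂ : ℝ) : Prop :=
  0 < ε₁ ∧ ε₁ < lam k - lam (k - 1) ∧
    0 < ε₂ ∧ ε₂ < 1 / (lam k - lam (k - 1) - ε₁) - max 0 (-1 / pk k ε₁)

/-- The square `Q_k = ]p_k, q_k[²`. -/
def Qk (k : ℤ) (ε₁ ε₂ : ℝ) : Set (ℝ × ℝ) :=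
  Ioo (pk k ε₁) (qk k ε₁ ε₂) ×ˢ Ioo (pk k ε₁) (qk k ε₁ ε₂)

/-- `Q̌_k = ]λ_{k-1}, ∞[²` if `λ_k > 0`, and `]λ_{k-1}, 0[²` otherwise. -/
def Qcheck (k : ℤ) : Set (ℝ × ℝ) :=
  {x | lam (k - 1) < x.1 ∧ lam (k - 1) < x.2 ∧ (lam k < 0 → x.1 < 0 ∧ x.2 < 0)}

/-- `F(v) = ⟨(L - μ)v, v⟩`. -/
def funF (k : ℤ) (ε₁ ε₂ : ℝ) (v : HSpace) : ℝ :=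
  inner ℝ (opL (pk k ε₁) v - mu k ε₁ ε₂ • v) v

/-- `G_r(v) = ‖v⁺‖² + r‖v⁻‖²`. -/
def funG (r : ℝ) (v : HSpace) : ℝ := ‖Lp.posPart v‖ ^ 2 + r * ‖Lp.negPart v‖ ^ 2

/-- `ǎ(r) = sup_{v ≠ 0} F(v)/G_r(v)`. -/
def acheck (k : ℤ) (ε₁ ε₂ r : ℝ) : ℝ :=
  ⨆ v : {v : HSpace // v ≠ 0}, funF k ε₁ ε₂ v.1 / funG r v.1

/-- The curve `𝓒_k` inside the square `Q_k(ε₁, ε₂)`. -/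
def Ck (k : ℤ) (ε₁ ε₂ : ℝ) : Set (ℝ × ℝ) :=
  (fun r : ℝ => (pk k ε₁ + 1 / (acheck k ε₁ ε₂ r + mu k ε₁ ε₂),
    pk k ε₁ + 1 / (r * acheck k ε₁ ε₂ r + mu k ε₁ ε₂))) '' Ioi 0

/-- `x` lies below `𝓒_k`: for some admissible `ε₁, ε₂`, the point `x` lies in `Q_k` and its
component in `Q_k ∖ 𝓒_k` is the one that contains `]p_k, λ_k[²`. (The curves for different
`ε₁, ε₂` agree where both are defined.) -/
def BelowCk (k : ℤ) (x : ℝ × ℝ) : Prop :=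
  ∃ ε₁ ε₂ : ℝ, Admissible k ε₁ ε₂ ∧
    Ioo (pk k ε₁) (lam k) ×ˢ Ioo (pk k ε₁) (lam k) ⊆
      connectedComponentIn (Qk k ε₁ ε₂ \ Ck k ε₁ ε₂) x

/-! ### The nonlinearity -/

/-- `p(s,t,u)/u → 0` as `|u| → ∞`, uniformly in `(s,t)`. -/
def SmallAtInfinity (p : ℝ → ℝ → ℝ → ℝ) : Prop :=
  ∀ ε > 0, ∃ M > 0, ∀ s ∈ Icc (0 : ℝ) Real.pi, ∀ t u : ℝ, M < |u| → |p s t u / u| < ε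

/-- The right-hand side `a u⁺ - b u⁻ + p(s,t,u)`. -/
def rhs (a b : ℝ) (p : ℝ → ℝ → ℝ → ℝ) (s t u : ℝ) : ℝ :=
  a * max u 0 - b * max (-u) 0 + p s t u

def H1 (k : ℤ) (a b : ℝ) (p : ℝ → ℝ → ℝ → ℝ) : Prop :=
  ∃ ε > 0, ∀ s ∈ Icc (0 : ℝ) Real.pi, ∀ t : ℝ,
    Monotone fun u => rhs a b p s t u - (lam (k - 1) + ε) * u

def H2 (k : ℤ) (p : ℝ → ℝ → ℝ → ℝ) : Prop :=
  0 < lam k → ∃ ε > 0, ∀ s ∈ Icc (0 : ℝ) Real.pi, ∀ t : ℝ,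
    Antitone fun u => p s t u - (1 / ε) * u

def H3 (k : ℤ) (a b : ℝ) (p : ℝ → ℝ → ℝ → ℝ) : Prop :=
  lam k < 0 → ∃ ε > 0, ∀ s ∈ Icc (0 : ℝ) Real.pi, ∀ t : ℝ,
    Antitone fun u => rhs a b p s t u + ε * u

/-! ### The dual functional -/

/-- The choice of `ε₁, ε₂` for the dual problem: admissible, with `(a,b) ∈ Q_k`, and such that
`u ↦ a u⁺ - b u⁻ + p - p_k u` is strictly increasing and `u ↦ a u⁺ - b u⁻ + p - q_k u` strictly
decreasing. -/
def Suitable (k : ℤ) (a b : ℝ) (p : ℝ → ℝ → ℝ → ℝ) (ε₁ ε₂ : ℝ) : Prop :=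
  Admissible k ε₁ ε₂ ∧ (a, b) ∈ Qk k ε₁ ε₂ ∧
    ∀ s ∈ Icc (0 : ℝ) Real.pi, ∀ t : ℝ,
      StrictMono (fun u => rhs a b p s t u - pk k ε₁ * u) ∧
      StrictAnti (fun u => rhs a b p s t u - qk k ε₁ ε₂ * u)

/-- `J = H + P` with `H(u) = ½(a - p_k)(u⁺)² + ½(b - p_k)(u⁻)²`. -/
def funJ (d a b : ℝ) (p : ℝ → ℝ → ℝ → ℝ) (s t u : ℝ) : ℝ :=
  1 / 2 * (a - d) * (max u 0) ^ 2 + 1 / 2 * (b - d) * (max (-u) 0) ^ 2 + primP p s t u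

/-- The Fenchel–Legendre transform `J*(s,t,·)` of `J(s,t,·)`. -/
def funJstar (d a b : ℝ) (p : ℝ → ℝ → ℝ → ℝ) (s t v : ℝ) : ℝ :=
  ⨆ u : ℝ, (v * u - funJ d a b p s t u)

/-- The dual functional `I(v) = ½⟨(L - μ)v, v⟩ - ∬ [J*(s,t,v) - (μ/2) v²]`. -/
def dualI (k : ℤ) (ε₁ ε₂ a b : ℝ) (p : ℝ → ℝ → ℝ → ℝ) (v : HSpace) : ℝ :=
  1 / 2 * funF k ε₁ ε₂ v
    - ∫ z, (funJstar (pk k ε₁) a b p z.1 z.2 (v z) - mu k ε₁ ε₂ / 2 * (v z) ^ 2) ∂cyl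

end FucikWave

end

namespace FucikWave

/-! ### Diagonal operators on a Hilbert space and maximizing sequences -/

section Hilbert

variable {ι H : Type*} [NormedAddCommGroup H] [InnerProductSpace ℝ H]

/-! The method is Clarke duality. Putting `v = □u - p_k u`, so that `u = Lv`, turns the equation
into `v = J'(·, Lv)`, which is formally the critical point equation of `½⟨Lv, v⟩ - ∬ J*(v)`; this is
the functional `I` after the `μ`-terms cancel. The energy is strongly indefinite and `□` has an
infinite-dimensional kernel, but `I` can be maximized.

Compactness. Outside finitely many eigenvectors the quadratic form of `L` lies below any `κ > max{0,
-1/p_k}`: the kernel of `□` contributes `-1/p_k`, and the remaining eigenvalues of `L` accumulate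
only at `0` (`finite_coef_gt`). The slopes of `J'` are at most `q_k - p_k = 1/μ`, so `J* - μv²/2` is
convex (`DualIntegrand.conj_mid`). Since `μ` exceeds the threshold by `ε₂`, `I` is uniformly concave
up to finitely many directions, and bounded maximizing sequences converge strongly along a
subsequence (`exists_tendsto_of_maximizing`).

Coercivity. For `x ∈ Q_k` let `A`, `B` be `1/(xᵢ - p_k) - μ`. Below the curve `A > ǎ(B/A)`, that is,
`F(v) ≤ θ (A‖v⁺‖² + B‖v⁻‖²)` with `θ < 1`. As `J*` is asymptotically `½((v⁺)²/(a - p_k) + (v⁻)²/(b -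
p_k))`, this makes `I → -∞` at infinity (`dualFun_coercive`). The square that witnesses "below" need
not be the one used for the dual problem. `Admissible.curveFun_pos_change` moves between them: a
point of the curve carries a nontrivial solution of `□u = αu⁺ - βu⁻`, an equation that does not
involve the parameters, and the coercivity in the other square excludes such solutions.

Return to the equation. Equality in the Fenchel–Young inequality gives `v₀ = J'(·, Lv₀)` at a
maximum (`dualFun_euler`). Since `m + n ≤ |m² - n²|` for `m ≠ n`, the range part of `Lv₀` is in `H¹`
(`InGap.exists_energy_splitting`), and the critical point equation of the energy follows. -/

/-- A pairwise orthogonal family of vectors of norm at most one. -/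
structure SubOrthonormal (e : ι → H) : Prop where
  orth : Pairwise fun i j => inner ℝ (e i) (e j) = 0
  norm_le : ∀ i, ‖e i‖ ≤ 1

variable {e : ι → H}

lemma SubOrthonormal.inner_sum_right (he : SubOrthonormal e) (s : Finset ι) (a : ι → ℝ) {i : ι}
    (hi : i ∈ s) : inner ℝ (e i) (∑ j ∈ s, a j • e j) = a i * ‖e i‖ ^ 2 := by
  rw [inner_sum, Finset.sum_eq_single_of_mem i hi]
  · rw [real_inner_smul_right, real_inner_self_eq_norm_sq]
  · intro j _ hj
    rw [real_inner_smul_right, he.orth hj.symm, mul_zero]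

lemma SubOrthonormal.norm_sum_sq (he : SubOrthonormal e) (s : Finset ι) (a : ι → ℝ) :
    ‖∑ i ∈ s, a i • e i‖ ^ 2 = ∑ i ∈ s, a i ^ 2 * ‖e i‖ ^ 2 := by
  rw [← real_inner_self_eq_norm_sq, sum_inner]
  refine Finset.sum_congr rfl fun i hi => ?_
  rw [real_inner_smul_left, he.inner_sum_right s a hi]
  ring

lemma SubOrthonormal.norm_sum_sq_le (he : SubOrthonormal e) (s : Finset ι) (a : ι → ℝ) :
    ‖∑ i ∈ s, a i • e i‖ ^ 2 ≤ ∑ i ∈ s, a i ^ 2 := by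
  rw [he.norm_sum_sq]
  refine Finset.sum_le_sum fun i _ => ?_
  have h1 : ‖e i‖ ^ 2 ≤ 1 := pow_le_one₀ (norm_nonneg _) (he.norm_le i)
  nlinarith [sq_nonneg (a i)]

lemma SubOrthonormal.summable [CompleteSpace H] (he : SubOrthonormal e) {a : ι → ℝ}
    (ha : Summable fun i => a i ^ 2) : Summable fun i => a i • e i := by
  rw [summable_iff_vanishing_norm] at ha ⊢
  intro ε hε
  obtain ⟨s, hs⟩ := ha (ε ^ 2) (by positivity)
  refine ⟨s, fun t ht => ?_⟩
  have h1 := hs t ht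
  rw [Real.norm_of_nonneg (Finset.sum_nonneg fun i _ => sq_nonneg _)] at h1
  exact lt_of_pow_lt_pow_left₀ 2 hε.le ((he.norm_sum_sq_le t a).trans_lt h1)

/-- Bessel's inequality needs only norms at most one: expanding `‖v - ∑⟨eᵢ, v⟩eᵢ‖² ≥ 0`, the last
square is at most `∑⟨eᵢ, v⟩²`. Zero vectors such as `ψ_{(m,0)}` may therefore stay in the index set.
-/
lemma SubOrthonormal.sum_inner_sq_le (he : SubOrthonormal e) (s : Finset ι) (v : H) :
    ∑ i ∈ s, inner ℝ (e i) v ^ 2 ≤ ‖v‖ ^ 2 := by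
  have h0 : 0 ≤ ‖v - ∑ i ∈ s, inner ℝ (e i) v • e i‖ ^ 2 := sq_nonneg _
  have h1 := he.norm_sum_sq_le s fun i => inner ℝ (e i) v
  have h2 : inner ℝ v (∑ i ∈ s, inner ℝ (e i) v • e i) = ∑ i ∈ s, inner ℝ (e i) v ^ 2 := by
    rw [inner_sum]
    refine Finset.sum_congr rfl fun i _ => ?_
    rw [real_inner_smul_right, real_inner_comm]
    ring
  rw [norm_sub_sq_real, h2] at h0
  linarith

lemma SubOrthonormal.summable_inner_sq (he : SubOrthonormal e) (v : H) :
    Summable fun i => inner ℝ (e i) v ^ 2 :=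
  summable_of_sum_le (fun _ => sq_nonneg _) fun s => he.sum_inner_sq_le s v

lemma SubOrthonormal.tsum_inner_sq_le (he : SubOrthonormal e) (v : H) :
    ∑' i, inner ℝ (e i) v ^ 2 ≤ ‖v‖ ^ 2 :=
  (he.summable_inner_sq v).tsum_le_of_sum_le fun s => he.sum_inner_sq_le s v

lemma SubOrthonormal.summable_mul_inner_sq (he : SubOrthonormal e) {c : ι → ℝ} {C : ℝ}
    (hc : ∀ i, |c i| ≤ C) (v : H) : Summable fun i => (c i * inner ℝ (e i) v) ^ 2 := by
  refine Summable.of_nonneg_of_le (fun _ => sq_nonneg _) (fun i => ?_)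
    ((he.summable_inner_sq v).mul_left (C ^ 2))
  rw [mul_pow]
  refine mul_le_mul_of_nonneg_right ?_ (sq_nonneg _)
  rw [← sq_abs]
  exact pow_le_pow_left₀ (abs_nonneg _) (hc i) 2

variable [CompleteSpace H]

/-- The operator `v ↦ ∑ cᵢ ⟨eᵢ, v⟩ eᵢ`. -/
noncomputable def diagOp (e : ι → H) (c : ι → ℝ) (v : H) : H := ∑' i, (c i * inner ℝ (e i) v) • e i

variable {c : ι → ℝ} {C : ℝ}

lemma SubOrthonormal.hasSum_diagOp (he : SubOrthonormal e) (hc : ∀ i, |c i| ≤ C) (v : H) :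
    HasSum (fun i => (c i * inner ℝ (e i) v) • e i) (diagOp e c v) :=
  (he.summable (he.summable_mul_inner_sq hc v)).hasSum

lemma SubOrthonormal.norm_diagOp_le (he : SubOrthonormal e) (hc : ∀ i, |c i| ≤ C) (hC : 0 ≤ C)
    (v : H) : ‖diagOp e c v‖ ≤ C * ‖v‖ := by
  refine le_of_tendsto (he.hasSum_diagOp hc v).norm (Filter.Eventually.of_forall fun s => ?_)
  refine le_of_sq_le_sq ?_ (by positivity)
  refine (he.norm_sum_sq_le s _).trans ?_
  rw [mul_pow]
  refine le_trans ?_ (mul_le_mul_of_nonneg_left (he.sum_inner_sq_le s v) (sq_nonneg C))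
  rw [Finset.mul_sum]
  refine Finset.sum_le_sum fun i _ => ?_
  rw [mul_pow]
  refine mul_le_mul_of_nonneg_right ?_ (sq_nonneg _)
  rw [← sq_abs]
  exact pow_le_pow_left₀ (abs_nonneg _) (hc i) 2

/-- `diagOp` as a bounded operator. -/
noncomputable def SubOrthonormal.diagCLM (he : SubOrthonormal e) (hc : ∀ i, |c i| ≤ C)
    (hC : 0 ≤ C) : H →L[ℝ] H :=
  LinearMap.mkContinuous
    { toFun := diagOp e c
      map_add' := fun v w => by
        refine (he.hasSum_diagOp hc (v + w)).unique ?_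
        convert (he.hasSum_diagOp hc v).add (he.hasSum_diagOp hc w) using 2 with i
        rw [← add_smul, inner_add_right, mul_add]
      map_smul' := fun r v => by
        refine (he.hasSum_diagOp hc (r • v)).unique ?_
        convert (he.hasSum_diagOp hc v).const_smul r using 2 with i
        · rw [smul_smul, real_inner_smul_right]
          congr 1
          ring
        · rfl } C (he.norm_diagOp_le hc hC)

@[simp] lemma SubOrthonormal.diagCLM_apply (he : SubOrthonormal e) (hc : ∀ i, |c i| ≤ C)
    (hC : 0 ≤ C) (v : H) : he.diagCLM hc hC v = diagOp e c v := rfl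

lemma SubOrthonormal.hasSum_inner_diagOp (he : SubOrthonormal e) (hc : ∀ i, |c i| ≤ C) (v w : H) :
    HasSum (fun i => c i * inner ℝ (e i) v * inner ℝ (e i) w) (inner ℝ (diagOp e c v) w) := by
  have h := (he.hasSum_diagOp hc v).mapL (innerSL ℝ w)
  simp only [innerSL_apply_apply, real_inner_smul_right] at h
  simpa only [real_inner_comm w] using h

lemma SubOrthonormal.diagOp_symm (he : SubOrthonormal e) (hc : ∀ i, |c i| ≤ C) (v w : H) :
    inner ℝ (diagOp e c v) w = inner ℝ v (diagOp e c w) := by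
  rw [real_inner_comm _ v]
  refine (he.hasSum_inner_diagOp hc v w).unique ?_
  convert he.hasSum_inner_diagOp hc w v using 2 with i
  ring

lemma SubOrthonormal.inner_diagOp (he : SubOrthonormal e) (h01 : ∀ i, e i = 0 ∨ ‖e i‖ = 1)
    (hc : ∀ i, |c i| ≤ C) (v : H) (j : ι) :
    inner ℝ (e j) (diagOp e c v) = c j * inner ℝ (e j) v := by
  rw [real_inner_comm]
  refine (he.hasSum_inner_diagOp hc v (e j)).unique ?_
  have : c j * inner ℝ (e j) v = c j * inner ℝ (e j) v * inner ℝ (e j) (e j) := by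
    rcases h01 j with h | h
    · simp [h]
    · rw [real_inner_self_eq_norm_sq, h]; ring
  rw [this]
  refine hasSum_single j fun i hi => ?_
  rw [he.orth hi, mul_zero]

/-- A diagonal operator whose coefficients are at most `κ` off a finite set. -/
lemma SubOrthonormal.inner_diagOp_self_le (he : SubOrthonormal e) (hc : ∀ i, |c i| ≤ C)
    {κ : ℝ} (hκ : 0 ≤ κ) (S : Finset ι) (hS : ∀ i, i ∉ S → c i ≤ κ) (v : H) :
    inner ℝ (diagOp e c v) v ≤ κ * ‖v‖ ^ 2 + C * ∑ i ∈ S, inner ℝ (e i) v ^ 2 := by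
  classical
  have h1 := he.hasSum_inner_diagOp hc v v
  have h2 : HasSum (fun i => if i ∈ S then inner ℝ (e i) v ^ 2 else 0)
      (∑ i ∈ S, inner ℝ (e i) v ^ 2) := by
    rw [← Finset.sum_congr rfl fun i hi => if_pos hi]
    exact hasSum_sum_of_ne_finset_zero fun i hi => if_neg hi
  have h3 := (((he.summable_inner_sq v).hasSum).mul_left κ).add (h2.mul_left C)
  refine (hasSum_le (fun i => ?_) h1 h3).trans ?_
  · by_cases hi : i ∈ S
    · rw [if_pos hi]
      have := (le_abs_self _).trans (hc i)
      nlinarith [sq_nonneg (inner ℝ (e i) v), mul_nonneg hκ (sq_nonneg (inner ℝ (e i) v))]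
    · rw [if_neg hi]
      nlinarith [sq_nonneg (inner ℝ (e i) v), hS i hi]
  · have := mul_le_mul_of_nonneg_left (he.tsum_inner_sq_le v) hκ
    linarith

/-- Elements of the closed span of a subfamily are fixed by the corresponding projection. -/
lemma SubOrthonormal.diagOp_eq_self_of_mem (he : SubOrthonormal e)
    (h01 : ∀ i, e i = 0 ∨ ‖e i‖ = 1) (hc : ∀ i, |c i| ≤ C) (hC : 0 ≤ C) {s : Set H}
    (hs : ∀ w ∈ s, ∃ i, c i = 1 ∧ ∃ r : ℝ, w = r • e i) {v : H}
    (hv : v ∈ (Submodule.span ℝ s).topologicalClosure) : diagOp e c v = v := by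
  -- The fixed vectors form a closed subspace, so only the generators have to be checked.
  have hcl : (Submodule.span ℝ s).topologicalClosure ≤
      LinearMap.ker (he.diagCLM hc hC - ContinuousLinearMap.id ℝ H).toLinearMap := by
    refine Submodule.topologicalClosure_minimal _ ?_
      (ContinuousLinearMap.isClosed_ker (he.diagCLM hc hC - ContinuousLinearMap.id ℝ H))
    refine Submodule.span_le.2 fun w hw => ?_
    obtain ⟨i, hi, r, rfl⟩ := hs w hw
    have : diagOp e c (e i) = e i := by
      refine (he.hasSum_diagOp hc (e i)).unique ?_
      have h := hasSum_single (f := fun j => (c j * inner ℝ (e j) (e i)) • e j) i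
        fun j hj => by rw [he.orth hj, mul_zero, zero_smul]
      convert h using 1
      rcases h01 i with h | h
      · simp [h]
      · rw [real_inner_self_eq_norm_sq, h, hi]; simp
    simp [this]
  have := hcl hv
  simp only [LinearMap.mem_ker] at this
  exact sub_eq_zero.1 this

/-- A bounded maximizing sequence of a functional that is uniformly concave up to finitely many
directions has a strongly convergent subsequence, so that the supremum is attained. -/
lemma exists_tendsto_of_maximizing {Ψ : H → ℝ} (hΨ : Continuous Ψ) {M c C R : ℝ} (hc : 0 < c)
    (hC : 0 ≤ C) (e : ι → H) (S : Finset ι) (hM : ∀ v, Ψ v ≤ M)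
    (hmid : ∀ v w : H, (Ψ v + Ψ w) / 2 + c * ‖v - w‖ ^ 2 - C * ∑ i ∈ S, inner ℝ (e i) (v - w) ^ 2
      ≤ Ψ ((1 / 2 : ℝ) • (v + w)))
    (v : ℕ → H) (hv : ∀ n, ‖v n‖ ≤ R) (hlim : Filter.Tendsto (fun n => Ψ (v n)) Filter.atTop (nhds M)) :
    ∃ v₀ : H, Ψ v₀ = M ∧ ∃ φ : ℕ → ℕ, StrictMono φ ∧
      Filter.Tendsto (v ∘ φ) Filter.atTop (nhds v₀) := by
  -- The finitely many bad coordinates of the sequence lie in a compact box, so they converge along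
  -- a subsequence.
  let T : ℕ → (S → ℝ) := fun n i => inner ℝ (e i) (v n)
  have hT : ∀ n, T n ∈ Set.pi Set.univ fun i : S => Set.Icc (-(‖e i‖ * R)) (‖e i‖ * R) := by
    intro n i _
    refine abs_le.1 ?_
    exact (abs_real_inner_le_norm _ _).trans (mul_le_mul_of_nonneg_left (hv n) (norm_nonneg _))
  obtain ⟨T₀, -, φ, hφ, hTφ⟩ :=
    (isCompact_univ_pi fun i : S => isCompact_Icc (a := -(‖e i‖ * R)) (b := ‖e i‖ * R)).tendsto_subseq hT
  have hcau : CauchySeq (v ∘ φ) := by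
    rw [Metric.cauchySeq_iff]
    intro ε hε
    have hc1 : CauchySeq (T ∘ φ) := hTφ.cauchySeq
    -- With each squared bad coordinate of the difference at most `cε²/(4K)`, their sum times `C` is
    -- at most `cε²/4`. The two values near `M` lose another `cε²/4` on average, so the midpoint
    -- inequality bounds `c‖v - w‖²` by less than `cε²`.
    set K : ℝ := C * S.card + 1 with hK
    have hKpos : 0 < K := by positivity
    have hδ : 0 < c * ε ^ 2 / (4 * K) := by positivity
    obtain ⟨N1, hN1⟩ := Metric.cauchySeq_iff.1 hc1 (Real.sqrt (c * ε ^ 2 / (4 * K)))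
      (Real.sqrt_pos.2 hδ)
    have h2 := (hlim.comp hφ.tendsto_atTop).eventually
      (lt_mem_nhds (show M - c * ε ^ 2 / 4 < M by nlinarith [mul_pos hc (pow_pos hε 2)]))
    obtain ⟨N2, hN2⟩ := Filter.eventually_atTop.1 h2
    refine ⟨max N1 N2, fun m hm n hn => ?_⟩
    have hd := hN1 m (le_trans (le_max_left _ _) hm) n (le_trans (le_max_left _ _) hn)
    have hm2 := hN2 m (le_trans (le_max_right _ _) hm)
    have hn2 := hN2 n (le_trans (le_max_right _ _) hn)
    have hsum : ∑ i ∈ S, inner ℝ (e i) (v (φ m) - v (φ n)) ^ 2 ≤ S.card * (c * ε ^ 2 / (4 * K)) := by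
      rw [← nsmul_eq_mul]
      refine Finset.sum_le_card_nsmul S _ _ fun i hi => ?_
      have h3 := (dist_le_pi_dist (T (φ m)) (T (φ n)) ⟨i, hi⟩).trans hd.le
      rw [Real.dist_eq] at h3
      have h4 : T (φ m) ⟨i, hi⟩ - T (φ n) ⟨i, hi⟩ = inner ℝ (e i) (v (φ m) - v (φ n)) := by
        rw [inner_sub_right]
      rw [h4] at h3
      rw [← sq_abs, ← Real.sq_sqrt hδ.le]
      exact pow_le_pow_left₀ (abs_nonneg _) h3 2
    have h5 := (hmid (v (φ m)) (v (φ n))).trans (hM _)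
    have h6 : C * (S.card * (c * ε ^ 2 / (4 * K))) ≤ c * ε ^ 2 / 4 := by
      have : C * (S.card * (c * ε ^ 2 / (4 * K))) = (C * S.card / K) * (c * ε ^ 2 / 4) := by
        field_simp
      rw [this]
      refine mul_le_of_le_one_left (by positivity) ?_
      rw [div_le_one hKpos]
      linarith
    have h7 := mul_le_mul_of_nonneg_left hsum hC
    simp only [Function.comp_apply] at hm2 hn2
    have h8 : c * ‖v (φ m) - v (φ n)‖ ^ 2 < c * ε ^ 2 := by
      nlinarith [mul_pos hc (pow_pos hε 2)]
    rw [dist_eq_norm]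
    exact lt_of_pow_lt_pow_left₀ 2 hε.le (lt_of_mul_lt_mul_left h8 hc.le)
  obtain ⟨v₀, hv₀⟩ := cauchySeq_tendsto_of_complete hcau
  refine ⟨v₀, ?_, φ, hφ, hv₀⟩
  exact tendsto_nhds_unique ((hΨ.tendsto v₀).comp hv₀) (hlim.comp hφ.tendsto_atTop)

end Hilbert

/-! ### Trigonometric functions on the cylinder -/

/-- `sin` for `true` and `cos` for `false`. -/
noncomputable def trig (σ : Bool) (x : ℝ) : ℝ := bif σ then Real.sin x else Real.cos x

@[fun_prop] lemma continuous_trig (σ : Bool) : Continuous (trig σ) := by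
  cases σ
  · exact Real.continuous_cos
  · exact Real.continuous_sin

lemma integral_cyl_mul {f g : ℝ → ℝ} :
    ∫ z, f z.1 * g z.2 ∂cyl =
      (∫ s in (0 : ℝ)..Real.pi, f s) * ∫ t in (0 : ℝ)..(2 * Real.pi), g t := by
  rw [cyl, Measure.volume_eq_prod, ← Measure.prod_restrict, integral_prod_mul,
    integral_Icc_eq_integral_Ioc, integral_Icc_eq_integral_Ioc,
    intervalIntegral.integral_of_le Real.pi_pos.le,
    intervalIntegral.integral_of_le Real.two_pi_pos.le]

lemma integral_cos_int_mul {k : ℤ} (hk : k ≠ 0) : ∫ s in (0 : ℝ)..Real.pi, Real.cos (k * s) = 0 := by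
  rw [intervalIntegral.integral_comp_mul_left _ (by exact_mod_cast hk), integral_cos,
    Real.sin_int_mul_pi]
  simp

lemma integral_cos_int_mul_two_pi {k : ℤ} (hk : k ≠ 0) :
    ∫ s in (0 : ℝ)..(2 * Real.pi), Real.cos (k * s) = 0 := by
  rw [intervalIntegral.integral_comp_mul_left _ (by exact_mod_cast hk), integral_cos]
  have : (k : ℝ) * (2 * Real.pi) = ((2 * k : ℤ) : ℝ) * Real.pi := by push_cast; ring
  rw [this, Real.sin_int_mul_pi]
  simp

lemma integral_sin_int_mul_two_pi (k : ℤ) :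
    ∫ s in (0 : ℝ)..(2 * Real.pi), Real.sin (k * s) = 0 := by
  rcases eq_or_ne k 0 with rfl | hk
  · simp
  rw [intervalIntegral.integral_comp_mul_left _ (by exact_mod_cast hk), integral_sin]
  rw [Real.cos_int_mul_two_pi]
  simp

/-- The sign in `trig σ x * trig σ y = (cos (x - y) ± cos (x + y)) / 2`. -/
def trigSign (σ : Bool) : ℝ := bif σ then -1 else 1

lemma trig_mul_trig (σ : Bool) (x y : ℝ) :
    trig σ x * trig σ y = 1 / 2 * Real.cos (x - y) + trigSign σ / 2 * Real.cos (x + y) := by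
  cases σ
  · simp only [trig, trigSign, cond_false, Real.cos_sub, Real.cos_add]; ring
  · simp only [trig, trigSign, cond_true, Real.cos_sub, Real.cos_add]; ring

/-- The condition `m ≥ 1` makes the frequency `m + m'` nonzero. Sines and cosines then behave alike
on `[0, π]`, so the `s`-derivatives inherit the orthogonality and normalization of the
eigenfunctions. -/
lemma integral_trig_mul_trig_pi (σ : Bool) {m m' : ℕ} (hm : 1 ≤ m) :
    ∫ s in (0 : ℝ)..Real.pi, trig σ (m * s) * trig σ (m' * s) =
      if m = m' then Real.pi / 2 else 0 := by
  have h1 : ∀ s : ℝ, trig σ (m * s) * trig σ (m' * s) =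
      1 / 2 * Real.cos (((m : ℤ) - m' : ℤ) * s) +
        trigSign σ / 2 * Real.cos (((m : ℤ) + m' : ℤ) * s) := by
    intro s
    rw [trig_mul_trig]
    push_cast
    ring_nf
  simp_rw [h1]
  rw [intervalIntegral.integral_add ((by fun_prop : Continuous _).intervalIntegrable _ _)
    ((by fun_prop : Continuous _).intervalIntegrable _ _), intervalIntegral.integral_const_mul,
    intervalIntegral.integral_const_mul, integral_cos_int_mul (k := m + m') (by omega)]
  split_ifs with h
  · subst h
    simp
    ring
  · rw [integral_cos_int_mul (by omega)]
    simp

lemma integral_trig_mul_trig_two_pi_same (τ : Bool) {n : ℕ} (hn : 1 ≤ n) :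
    ∫ s in (0 : ℝ)..(2 * Real.pi), trig τ (n * s) * trig τ (n * s) = Real.pi := by
  have h1 : ∀ s : ℝ, trig τ (n * s) * trig τ (n * s) =
      1 / 2 + trigSign τ / 2 * Real.cos ((2 * n : ℤ) * s) := by
    intro s
    rw [trig_mul_trig, sub_self, Real.cos_zero]
    push_cast
    ring_nf
  simp_rw [h1]
  rw [intervalIntegral.integral_add ((by fun_prop : Continuous _).intervalIntegrable _ _)
    ((by fun_prop : Continuous _).intervalIntegrable _ _),
    intervalIntegral.integral_const_mul, integral_cos_int_mul_two_pi (k := 2 * n) (by omega)]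
  simp
  ring

lemma integral_trig_mul_trig_two_pi (τ τ' : Bool) {n n' : ℕ} (h : (n, τ) ≠ (n', τ')) :
    ∫ s in (0 : ℝ)..(2 * Real.pi), trig τ (n * s) * trig τ' (n' * s) = 0 := by
  rcases eq_or_ne τ τ' with rfl | hτ
  · have hn : n ≠ n' := fun h' => h (by rw [h'])
    have h1 : ∀ s : ℝ, trig τ (n * s) * trig τ (n' * s) =
        1 / 2 * Real.cos (((n : ℤ) - n' : ℤ) * s) +
          trigSign τ / 2 * Real.cos (((n : ℤ) + n' : ℤ) * s) := by
      intro s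
      rw [trig_mul_trig]
      push_cast
      ring_nf
    simp_rw [h1]
    rw [intervalIntegral.integral_add ((by fun_prop : Continuous _).intervalIntegrable _ _)
      ((by fun_prop : Continuous _).intervalIntegrable _ _), intervalIntegral.integral_const_mul,
      intervalIntegral.integral_const_mul, integral_cos_int_mul_two_pi (k := n + n') (by omega),
      integral_cos_int_mul_two_pi (k := n - n') (by omega)]
    simp
  · have key : ∀ a b : ℕ,
        ∫ s in (0 : ℝ)..(2 * Real.pi), Real.sin (a * s) * Real.cos (b * s) = 0 := by
      intro a b
      have h1 : ∀ s : ℝ, Real.sin (a * s) * Real.cos (b * s) =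
          1 / 2 * Real.sin (((a : ℤ) - b : ℤ) * s) + 1 / 2 * Real.sin (((a : ℤ) + b : ℤ) * s) := by
        intro s
        push_cast
        rw [sub_mul, add_mul, Real.sin_sub, Real.sin_add]
        ring
      simp_rw [h1]
      rw [intervalIntegral.integral_add ((by fun_prop : Continuous _).intervalIntegrable _ _)
        ((by fun_prop : Continuous _).intervalIntegrable _ _), intervalIntegral.integral_const_mul,
        intervalIntegral.integral_const_mul, integral_sin_int_mul_two_pi,
        integral_sin_int_mul_two_pi]
      simp
    cases τ <;> cases τ' <;> simp only [ne_eq, not_true_eq_false, trig, cond_true, cond_false] at hτ ⊢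
    · simp_rw [mul_comm (Real.cos _)]
      exact key _ _
    · exact key _ _

/-- The function `(√2/π) trig_σ(ms) trig_τ(nt)`. -/
noncomputable def waveFun (m n : ℕ) (σ τ : Bool) (z : ℝ × ℝ) : ℝ :=
  Real.sqrt 2 / Real.pi * (trig σ (m * z.1) * trig τ (n * z.2))

lemma continuous_waveFun (m n : ℕ) (σ τ : Bool) : Continuous (waveFun m n σ τ) := by
  unfold waveFun
  fun_prop

/-- `waveFun` as an element of `𝓗`. -/
noncomputable def wave (m n : ℕ) (σ τ : Bool) : HSpace :=
  (memLp_of_continuous (continuous_waveFun m n σ τ)).toLp _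

lemma phi_eq_wave (m n : ℕ) : phi m n = wave m n true false := rfl

lemma inner_eq_integral (u v : HSpace) : inner ℝ u v = ∫ z, v z * u z ∂cyl := by
  rw [L2.inner_def]
  rfl

lemma inner_toLp_left {h : ℝ × ℝ → ℝ} (hh : Continuous h) (u : HSpace) :
    inner ℝ ((memLp_of_continuous hh).toLp h : HSpace) u = ∫ z, u z * h z ∂cyl := by
  rw [inner_eq_integral]
  refine integral_congr_ae ?_
  filter_upwards [(memLp_of_continuous hh).coeFn_toLp] with z hz
  rw [hz]

lemma inner_wave_left (m n : ℕ) (σ τ : Bool) (u : HSpace) :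
    inner ℝ (wave m n σ τ) u = ∫ z, u z * waveFun m n σ τ z ∂cyl :=
  inner_toLp_left (continuous_waveFun m n σ τ) u

lemma inner_wave_wave (m n m' n' : ℕ) (σ τ τ' : Bool) :
    inner ℝ (wave m n σ τ) (wave m' n' σ τ') = (Real.sqrt 2 / Real.pi) ^ 2 *
      ((∫ s in (0 : ℝ)..Real.pi, trig σ (m * s) * trig σ (m' * s)) *
        ∫ t in (0 : ℝ)..(2 * Real.pi), trig τ (n * t) * trig τ' (n' * t)) := by
  rw [inner_wave_left, ← integral_cyl_mul (f := fun s => trig σ (m * s) * trig σ (m' * s))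
    (g := fun t => trig τ (n * t) * trig τ' (n' * t)), ← integral_const_mul]
  refine integral_congr_ae ?_
  filter_upwards [(memLp_of_continuous (continuous_waveFun m' n' σ τ')).coeFn_toLp] with z hz
  rw [wave, hz, waveFun, waveFun]
  ring

lemma inner_wave_eq_zero {m n m' n' : ℕ} (hm : 1 ≤ m) (σ : Bool) {τ τ' : Bool}
    (h : (m, n, τ) ≠ (m', n', τ')) : inner ℝ (wave m n σ τ) (wave m' n' σ τ') = 0 := by
  rw [inner_wave_wave]
  by_cases hm' : m = m'
  · rw [integral_trig_mul_trig_two_pi τ τ' (fun h' => h (by rw [hm', h']))]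
    ring
  · rw [integral_trig_mul_trig_pi σ hm, if_neg hm']
    ring

lemma norm_wave_space (m n : ℕ) (hm : 1 ≤ m) (σ σ' τ : Bool) :
    ‖wave m n σ τ‖ = ‖wave m n σ' τ‖ := by
  refine (sq_eq_sq₀ (norm_nonneg _) (norm_nonneg _)).1 ?_
  rw [← real_inner_self_eq_norm_sq, ← real_inner_self_eq_norm_sq, inner_wave_wave, inner_wave_wave,
    integral_trig_mul_trig_pi σ hm, integral_trig_mul_trig_pi σ' hm]

lemma norm_wave_time (m n : ℕ) (hn : 1 ≤ n) (σ τ τ' : Bool) :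
    ‖wave m n σ τ‖ = ‖wave m n σ τ'‖ := by
  refine (sq_eq_sq₀ (norm_nonneg _) (norm_nonneg _)).1 ?_
  rw [← real_inner_self_eq_norm_sq, ← real_inner_self_eq_norm_sq, inner_wave_wave, inner_wave_wave,
    integral_trig_mul_trig_two_pi_same τ hn, integral_trig_mul_trig_two_pi_same τ' hn]

lemma wave_zero_sin (m : ℕ) (σ : Bool) : wave m 0 σ true = 0 := by
  rw [← norm_eq_zero, ← sq_eq_zero_iff, ← real_inner_self_eq_norm_sq, inner_wave_wave]
  simp [trig]

lemma phi_ne_zero {m : ℕ} (hm : 1 ≤ m) (n : ℕ) : phi m n ≠ 0 := by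
  rw [phi_eq_wave, ← norm_ne_zero_iff, ← pow_ne_zero_iff two_ne_zero, ← real_inner_self_eq_norm_sq,
    inner_wave_wave, integral_trig_mul_trig_pi true hm, if_pos rfl]
  have : ∫ t in (0 : ℝ)..(2 * Real.pi), trig false (n * t) * trig false (n * t) ≠ 0 := by
    rcases Nat.eq_zero_or_pos n with rfl | hn
    · simp [trig, Real.pi_ne_zero]
    · rw [integral_trig_mul_trig_two_pi_same false hn]
      exact Real.pi_ne_zero
  have := Real.pi_ne_zero
  positivity

/-! ### The normalised eigenfunctions and their derivatives -/

/-- Indices `((m, n), τ)`: `τ = false` for `φ_{(m,n)}` and `τ = true` for `ψ_{(m,n)}`. -/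
abbrev Idx : Type := (ℕ+ × ℕ) × Bool

/-- The eigenvalue `m² - n²`. -/
def eig (i : Idx) : ℝ := ((i.1.1 : ℕ) : ℝ) ^ 2 - (i.1.2 : ℝ) ^ 2

/-- The eigenfunction with index `i`. -/
noncomputable def rawVec (i : Idx) : HSpace := wave i.1.1 i.1.2 true i.2

/-- The normalised eigenfunctions (zero in the place of `ψ_{(m,0)} = 0`). -/
noncomputable def eigVec (i : Idx) : HSpace := ‖rawVec i‖⁻¹ • rawVec i

/-- `m⁻¹` times the `s`-derivatives of the `eigVec`. -/
noncomputable def sVec (i : Idx) : HSpace := ‖rawVec i‖⁻¹ • wave i.1.1 i.1.2 false i.2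

/-- `n⁻¹` times the `t`-derivatives of the `eigVec`. -/
noncomputable def tVec (i : Idx) : HSpace :=
  (‖rawVec i‖⁻¹ * -trigSign i.2) • wave i.1.1 i.1.2 true (!i.2)

lemma one_le_idx (i : Idx) : 1 ≤ (i.1.1 : ℕ) := i.1.1.pos

lemma idx_ne {i j : Idx} (h : i ≠ j) :
    ((i.1.1 : ℕ), i.1.2, i.2) ≠ ((j.1.1 : ℕ), j.1.2, j.2) := by
  intro h'
  simp only [Prod.mk.injEq] at h'
  exact h (Prod.ext (Prod.ext (PNat.eq h'.1) h'.2.1) h'.2.2)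

lemma eigVec_eq_zero_or (i : Idx) : eigVec i = 0 ∨ ‖eigVec i‖ = 1 := by
  rcases eq_or_ne (rawVec i) 0 with h | h
  · left
    rw [eigVec, h, smul_zero]
  · right
    rw [eigVec, norm_smul, norm_inv, norm_norm, inv_mul_cancel₀ (norm_ne_zero_iff.2 h)]

lemma subOrthonormal_eigVec : SubOrthonormal eigVec where
  orth i j hij := by
    change inner ℝ (eigVec i) (eigVec j) = 0
    rw [eigVec, eigVec, real_inner_smul_left, real_inner_smul_right, rawVec, rawVec,
      inner_wave_eq_zero (one_le_idx i) true (idx_ne hij)]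
    ring
  norm_le i := by
    rcases eigVec_eq_zero_or i with h | h
    · rw [h, norm_zero]; exact zero_le_one
    · exact h.le

lemma subOrthonormal_sVec : SubOrthonormal sVec where
  orth i j hij := by
    change inner ℝ (sVec i) (sVec j) = 0
    rw [sVec, sVec, real_inner_smul_left, real_inner_smul_right,
      inner_wave_eq_zero (one_le_idx i) false (idx_ne hij)]
    ring
  norm_le i := by
    rw [sVec, norm_smul, norm_wave_space _ _ (one_le_idx i) false true, ← norm_smul]
    exact subOrthonormal_eigVec.norm_le i

lemma subOrthonormal_tVec : SubOrthonormal tVec where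
  orth i j hij := by
    change inner ℝ (tVec i) (tVec j) = 0
    rw [tVec, tVec, real_inner_smul_left, real_inner_smul_right,
      inner_wave_eq_zero (one_le_idx i) true]
    · ring
    · intro h
      simp only [Prod.mk.injEq] at h
      refine idx_ne hij ?_
      rw [h.1, h.2.1, Bool.not_inj h.2.2]
  norm_le i := by
    have hs : |trigSign i.2| = 1 := by cases i.2 <;> simp [trigSign]
    rw [tVec, norm_smul, norm_mul, norm_neg, Real.norm_eq_abs (trigSign _), hs, mul_one]
    rcases Nat.eq_zero_or_pos i.1.2 with hn | hn
    · rcases hτ : i.2 with - | -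
      · rw [hn, Bool.not_false, wave_zero_sin, norm_zero, mul_zero]
        exact zero_le_one
      -- Here the eigenfunction is `ψ_{(m,0)} = 0`, and the normalizing factor is `0⁻¹ = 0`.
      · rw [rawVec, hn, hτ, wave_zero_sin, norm_zero, inv_zero, norm_zero, zero_mul]
        exact zero_le_one
    · rw [norm_wave_time _ _ hn true (!i.2) i.2, ← norm_smul]
      exact subOrthonormal_eigVec.norm_le i

/-- The coefficients of `opL d`. -/
noncomputable def coef (d : ℝ) (i : Idx) : ℝ := 1 / (eig i - d)

/-- The two factors `‖rawVec i‖⁻¹` combine to the division by the squared norm, also when that norm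
is zero. Bounded coefficients make the sum over all indices converge, so it may be grouped into
pairs `φ, ψ`. -/
lemma opL_eq_diagOp {d C : ℝ} (hc : ∀ i, |coef d i| ≤ C) (v : HSpace) :
    opL d v = diagOp eigVec (coef d) v := by
  have h := subOrthonormal_eigVec.hasSum_diagOp hc v
  have h2 := HasSum.prod_fiberwise h fun b => hasSum_fintype _
  rw [← h2.tsum_eq, opL]
  refine tsum_congr fun i => ?_
  rw [Fintype.sum_bool, add_comm]
  have key : ∀ τ : Bool, (coef d (i, τ) * inner ℝ (eigVec (i, τ)) v) • eigVec (i, τ) =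
      (inner ℝ (rawVec (i, τ)) v / ‖rawVec (i, τ)‖ ^ 2
        / (((i.1 : ℕ) : ℝ) ^ 2 - (i.2 : ℝ) ^ 2 - d)) • rawVec (i, τ) := by
    intro τ
    rw [eigVec, real_inner_smul_left, smul_smul, coef, eig]
    congr 1
    ring
  rw [key, key]
  rfl

/-! ### The eigenvalues in increasing order -/

/-- Differences of consecutive squares give all the odd numbers. Infinitude keeps `Nat.nth` away
from its default value, so that every `lam k` is an eigenvalue. -/
lemma infinite_nonneg_eigenvalues : {j : ℕ | (j : ℤ) ∈ eigenvalues}.Infinite := by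
  refine Set.infinite_of_injective_forall_mem (f := fun n : ℕ => 2 * n + 1) (fun a b h => ?_)
    fun n => ⟨n + 1, n, by omega, ?_⟩
  · simpa using h
  · push_cast
    ring

lemma infinite_nonpos_eigenvalues : {j : ℕ | -(j : ℤ) ∈ eigenvalues}.Infinite := by
  refine Set.infinite_of_injective_forall_mem (f := fun n : ℕ => 2 * n + 3) (fun a b h => ?_)
    fun n => ⟨n + 1, n + 2, by omega, ?_⟩
  · simpa using h
  · push_cast
    ring

lemma zero_mem_eigenvalues : (0 : ℤ) ∈ eigenvalues := ⟨1, 1, le_rfl, by norm_num⟩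

open Classical in
lemma lam_natCast (n : ℕ) : lam n = (Nat.nth (fun j : ℕ => (j : ℤ) ∈ eigenvalues) n : ℝ) := by
  change lam (Int.ofNat n) = _
  rw [lam]

open Classical in
lemma lam_neg_natCast (n : ℕ) :
    lam (-(n : ℤ)) = -(Nat.nth (fun j : ℕ => -(j : ℤ) ∈ eigenvalues) n : ℝ) := by
  cases n with
  | zero =>
    change lam (Int.ofNat 0) = _
    rw [lam, Nat.nth_zero_of_zero (by simpa using zero_mem_eigenvalues),
      Nat.nth_zero_of_zero (by simpa using zero_mem_eigenvalues)]
    simp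
  | succ n =>
    change lam (Int.negSucc n) = _
    rw [lam]

lemma exists_int_eq_eig (i : Idx) : ∃ l ∈ eigenvalues, eig i = (l : ℝ) :=
  ⟨_, ⟨i.1.1, i.1.2, one_le_idx i, rfl⟩, by rw [eig]; push_cast; ring⟩

lemma exists_eig_eq_int {l : ℤ} (hl : l ∈ eigenvalues) :
    ∃ i, eig i = l ∧ ‖eigVec i‖ = 1 := by
  obtain ⟨m, n, hm, rfl⟩ := hl
  refine ⟨((⟨m, hm⟩, n), false), by rw [eig]; push_cast; rfl, ?_⟩
  refine (eigVec_eq_zero_or _).resolve_left ?_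
  rw [eigVec]
  exact smul_ne_zero (inv_ne_zero (norm_ne_zero_iff.2 (phi_ne_zero hm n))) (phi_ne_zero hm n)

lemma exists_eig_eq_lam (k : ℤ) : ∃ i, eig i = lam k ∧ ‖eigVec i‖ = 1 := by
  classical
  rcases k.eq_nat_or_neg with ⟨n, rfl | rfl⟩
  · obtain ⟨i, hi⟩ := exists_eig_eq_int (Nat.nth_mem_of_infinite infinite_nonneg_eigenvalues n)
    exact ⟨i, by rw [hi.1, lam_natCast]; push_cast; rfl, hi.2⟩
  · obtain ⟨i, hi⟩ := exists_eig_eq_int (Nat.nth_mem_of_infinite infinite_nonpos_eigenvalues n)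
    exact ⟨i, by rw [hi.1, lam_neg_natCast]; push_cast; rfl, hi.2⟩

/-- There are no eigenvalues strictly between `λ_{k-1}` and `λ_k`. -/
lemma eig_le_or_le (k : ℤ) (i : Idx) : eig i ≤ lam (k - 1) ∨ lam k ≤ eig i := by
  classical
  obtain ⟨l, hl, hil⟩ := exists_int_eq_eig i
  rw [hil]
  rcases lt_or_ge 0 k with hk | hk
  · obtain ⟨n, rfl⟩ : ∃ n : ℕ, k = n + 1 := ⟨(k - 1).toNat, by omega⟩
    have e1 : ((n : ℤ) + 1 - 1) = (n : ℤ) := by ring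
    have e2 : ((n : ℤ) + 1) = ((n + 1 : ℕ) : ℤ) := by push_cast; rfl
    rw [e1, e2, lam_natCast, lam_natCast]
    rcases lt_or_ge l 0 with h0 | h0
    · left
      exact (show (l : ℝ) ≤ 0 by exact_mod_cast h0.le).trans (Nat.cast_nonneg _)
    · lift l to ℕ using h0
      by_contra! h
      have h2 : l < Nat.nth (fun j : ℕ => (j : ℤ) ∈ eigenvalues) (n + 1) := by exact_mod_cast h.2
      have h1 : Nat.nth (fun j : ℕ => (j : ℤ) ∈ eigenvalues) n < l := by exact_mod_cast h.1
      exact absurd (Nat.le_nth_of_lt_nth_succ h2 hl) h1.not_ge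
  · obtain ⟨n, rfl⟩ : ∃ n : ℕ, k = -(n : ℤ) := ⟨(-k).toNat, by omega⟩
    have e1 : -(n : ℤ) - 1 = -((n + 1 : ℕ) : ℤ) := by push_cast; ring
    rw [e1, lam_neg_natCast, lam_neg_natCast]
    rcases lt_or_ge 0 l with h0 | h0
    · right
      exact (neg_nonpos.2 (Nat.cast_nonneg _)).trans (by exact_mod_cast h0.le)
    · obtain ⟨j, rfl⟩ : ∃ j : ℕ, l = -(j : ℤ) := ⟨(-l).toNat, by omega⟩
      push_cast
      by_contra! h
      have h2 : j < Nat.nth (fun j : ℕ => -(j : ℤ) ∈ eigenvalues) (n + 1) := by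
        exact_mod_cast neg_lt_neg_iff.1 h.1
      have h1 : Nat.nth (fun j : ℕ => -(j : ℤ) ∈ eigenvalues) n < j := by
        exact_mod_cast neg_lt_neg_iff.1 h.2
      exact absurd (Nat.le_nth_of_lt_nth_succ h2 hl) h1.not_ge

/-- The eigenvalue `0`, taken at `m = n = 1`, cannot lie inside a gap. -/
lemma nonneg_lam_or_lam_nonpos (k : ℤ) : 0 ≤ lam (k - 1) ∨ lam k ≤ 0 := by
  have h := eig_le_or_le k ((1, 1), false)
  have h0 : eig ((1, 1), false) = 0 := by simp [eig]
  rwa [h0] at h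

/-- `d` lies in the gap between `λ_{k-1}` and `λ_k`. -/
def InGap (k : ℤ) (d : ℝ) : Prop := lam (k - 1) < d ∧ d < lam k

variable {k : ℤ} {d : ℝ}

/-- The distance of `d` to the spectrum is at least this. -/
noncomputable def gapDist (k : ℤ) (d : ℝ) : ℝ := min (d - lam (k - 1)) (lam k - d)

lemma InGap.gapDist_pos (hd : InGap k d) : 0 < gapDist k d :=
  lt_min (sub_pos.2 hd.1) (sub_pos.2 hd.2)

lemma gapDist_le (k : ℤ) (d : ℝ) (i : Idx) : gapDist k d ≤ |eig i - d| := by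
  rcases eig_le_or_le k i with h | h
  · rw [abs_sub_comm]
    exact (min_le_left _ _).trans ((by linarith : _ ≤ d - eig i).trans (le_abs_self _))
  · exact (min_le_right _ _).trans ((by linarith : _ ≤ eig i - d).trans (le_abs_self _))

lemma InGap.eig_sub_ne (hd : InGap k d) (i : Idx) : eig i - d ≠ 0 :=
  abs_pos.1 (hd.gapDist_pos.trans_le (gapDist_le k d i))

lemma InGap.abs_coef_le (hd : InGap k d) (i : Idx) : |coef d i| ≤ 1 / gapDist k d := by
  rw [coef, abs_div, abs_one]
  exact one_div_le_one_div_of_le hd.gapDist_pos (gapDist_le k d i)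

lemma InGap.coef_le (hd : InGap k d) (i : Idx) : coef d i ≤ 1 / (lam k - d) := by
  rcases eig_le_or_le k i with h | h
  · exact (one_div_neg.2 (by linarith [hd.1])).le.trans (one_div_pos.2 (by linarith [hd.2])).le
  · exact one_div_le_one_div_of_le (by linarith [hd.2]) (by linarith)

/-- Factor `m² - n² = (m + n)(m - n)` with `|m - n| ≥ 1`. This is the source both of the finite
multiplicity of the nonzero eigenvalues and of the gain of one derivative in `L`. -/
lemma idx_add_le_abs_eig {i : Idx} (h : (i.1.1 : ℕ) ≠ i.1.2) :
    ((i.1.1 : ℕ) : ℝ) + i.1.2 ≤ |eig i| := by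
  have h1 : eig i = (((i.1.1 : ℕ) : ℝ) + i.1.2) * (((i.1.1 : ℕ) : ℝ) - i.1.2) := by
    rw [eig]; ring
  have h2 : (1 : ℝ) ≤ |((i.1.1 : ℕ) : ℝ) - i.1.2| := by
    have : (1 : ℤ) ≤ |((i.1.1 : ℕ) : ℤ) - i.1.2| := Int.one_le_abs (by omega)
    exact_mod_cast this
  rw [h1, abs_mul, abs_of_nonneg (a := ((i.1.1 : ℕ) : ℝ) + i.1.2) (by positivity)]
  exact le_mul_of_one_le_right (by positivity) h2

/-- A coefficient above `κ > 0` forces `0 < eig i - d < 1/κ`, which bounds `m + n` off the diagonal.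
On the diagonal every coefficient is `-1/d`, and this infinite family is excluded by `-1/d < κ`. -/
lemma finite_coef_gt {κ : ℝ} (hκ : 0 < κ) (hκd : -1 / d < κ) : {i | κ < coef d i}.Finite := by
  obtain ⟨M, hM⟩ := exists_nat_gt (|d| + 1 / κ)
  have hfin := (((Set.finite_Iic M).preimage PNat.coe_injective.injOn).prod
    (Set.finite_Iic M)).prod (Set.finite_univ (α := Bool))
  refine hfin.subset fun i hi => ?_
  have hi' : κ < 1 / (eig i - d) := hi
  have hpos : 0 < eig i - d := by
    by_contra! h
    exact absurd (hκ.trans hi') (not_lt.2 (one_div_nonpos.2 h))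
  have hne : (i.1.1 : ℕ) ≠ i.1.2 := by
    intro h
    rw [eig, h, sub_self, zero_sub, one_div_neg_eq_neg_one_div, ← neg_div] at hi'
    exact lt_asymm hκd hi'
  have h1 : eig i - d < 1 / κ := by
    rw [lt_div_iff₀ hpos] at hi'
    rw [lt_div_iff₀ hκ]
    linarith
  have h2 := idx_add_le_abs_eig hne
  have h3 : |eig i| ≤ |d| + |eig i - d| := by
    have := abs_add_le d (eig i - d)
    rwa [add_sub_cancel] at this
  rw [abs_of_pos hpos] at h3
  have h4 : ((i.1.1 : ℕ) : ℝ) + i.1.2 < M := by linarith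
  have h5 : (i.1.1 : ℕ) + i.1.2 < M := by exact_mod_cast h4
  simp only [Set.mem_prod, Set.mem_preimage, Set.mem_Iic, Set.mem_univ, and_true]
  omega

/-! ### The operator `L` -/

lemma InGap.opL_eq (hd : InGap k d) (v : HSpace) : opL d v = diagOp eigVec (coef d) v :=
  opL_eq_diagOp hd.abs_coef_le v

/-- `opL` as a bounded operator. -/
noncomputable def InGap.clm (hd : InGap k d) : HSpace →L[ℝ] HSpace :=
  subOrthonormal_eigVec.diagCLM hd.abs_coef_le (one_div_nonneg.2 hd.gapDist_pos.le)

lemma InGap.clm_apply (hd : InGap k d) (v : HSpace) : hd.clm v = opL d v := (hd.opL_eq v).symm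

lemma InGap.clm_symm (hd : InGap k d) (v w : HSpace) :
    inner ℝ (hd.clm v) w = inner ℝ v (hd.clm w) :=
  subOrthonormal_eigVec.diagOp_symm hd.abs_coef_le v w

lemma InGap.inner_eigVec_clm (hd : InGap k d) (v : HSpace) (i : Idx) :
    inner ℝ (eigVec i) (hd.clm v) = coef d i * inner ℝ (eigVec i) v :=
  subOrthonormal_eigVec.inner_diagOp eigVec_eq_zero_or hd.abs_coef_le v i

lemma InGap.hasSum_clm (hd : InGap k d) (v : HSpace) :
    HasSum (fun i => (coef d i * inner ℝ (eigVec i) v) • eigVec i) (hd.clm v) :=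
  subOrthonormal_eigVec.hasSum_diagOp hd.abs_coef_le v

/-- The quadratic form of `L` up to finitely many directions. -/
lemma InGap.exists_finset_inner_clm_le (hd : InGap k d) {κ : ℝ} (hκ : max 0 (-1 / d) < κ) :
    ∃ (S : Finset Idx) (C : ℝ), 0 ≤ C ∧ ∀ v : HSpace, inner ℝ (hd.clm v) v ≤
      κ * ‖v‖ ^ 2 + C * ∑ i ∈ S, inner ℝ (eigVec i) v ^ 2 := by
  have hfin := finite_coef_gt ((le_max_left _ _).trans_lt hκ) ((le_max_right _ _).trans_lt hκ)
  refine ⟨hfin.toFinset, 1 / gapDist k d, one_div_nonneg.2 hd.gapDist_pos.le, fun v => ?_⟩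
  refine subOrthonormal_eigVec.inner_diagOp_self_le hd.abs_coef_le
    ((le_max_left _ _).trans hκ.le) _ (fun i hi => ?_) v
  simpa using hi

lemma InGap.inner_clm_le (hd : InGap k d) (v : HSpace) :
    inner ℝ (hd.clm v) v ≤ 1 / (lam k - d) * ‖v‖ ^ 2 := by
  have h := subOrthonormal_eigVec.inner_diagOp_self_le hd.abs_coef_le
    (one_div_pos.2 (sub_pos.2 hd.2)).le ∅ (fun i _ => hd.coef_le i) v
  rw [Finset.sum_empty, mul_zero, add_zero] at h
  exact h

lemma InGap.exists_inner_clm_eq (hd : InGap k d) :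
    ∃ v : HSpace, ‖v‖ = 1 ∧ inner ℝ (hd.clm v) v = 1 / (lam k - d) := by
  obtain ⟨i, hi, hn⟩ := exists_eig_eq_lam k
  refine ⟨eigVec i, hn, ?_⟩
  rw [hd.clm_symm, hd.inner_eigVec_clm, real_inner_self_eq_norm_sq, hn, coef, hi]
  ring

/-- `L` at two different points of the gap. -/
lemma InGap.clm_change (hd : InGap k d) {d' : ℝ} (hd' : InGap k d') (v : HSpace) :
    hd'.clm (v + (d - d') • hd.clm v) = hd.clm v := by
  refine (hd'.hasSum_clm _).unique ?_
  convert hd.hasSum_clm v using 2 with i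
  rw [inner_add_right, real_inner_smul_right, hd.inner_eigVec_clm, coef, coef]
  congr 1
  have h1 := hd.eig_sub_ne i
  have h2 := hd'.eig_sub_ne i
  field_simp
  ring

/-! ### Integral functionals on `𝓗` -/

lemma aestronglyMeasurable_comp {F : (ℝ × ℝ) × ℝ → ℝ} (hF : Continuous F) (u : HSpace) :
    AEStronglyMeasurable (fun z => F (z, u z)) cyl :=
  hF.comp_aestronglyMeasurable (aestronglyMeasurable_id.prodMk (Lp.aestronglyMeasurable u))

lemma integrable_sq (u : HSpace) : Integrable (fun z => u z ^ 2) cyl :=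
  (Lp.memLp u).integrable_sq

lemma norm_sq_eq_integral (u : HSpace) : ‖u‖ ^ 2 = ∫ z, u z ^ 2 ∂cyl := by
  rw [← real_inner_self_eq_norm_sq, inner_eq_integral]
  simp_rw [sq]

lemma integrable_mul_lp (u v : HSpace) : Integrable (fun z => u z * v z) cyl :=
  (Lp.memLp u).integrable_mul (Lp.memLp v)

/-- `x ↦ α x⁺ - β x⁻`. -/
def jump (α β x : ℝ) : ℝ := α * max x 0 - β * max (-x) 0

/-- `x ↦ α (x⁺)² + β (x⁻)²`. -/
def jumpSq (α β x : ℝ) : ℝ := α * max x 0 ^ 2 + β * max (-x) 0 ^ 2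

@[fun_prop] lemma continuous_jump (α β : ℝ) : Continuous (jump α β) := by
  unfold jump; fun_prop

@[fun_prop] lemma continuous_jumpSq (α β : ℝ) : Continuous (jumpSq α β) := by
  unfold jumpSq; fun_prop

lemma jump_of_nonneg (α β : ℝ) {x : ℝ} (hx : 0 ≤ x) : jump α β x = α * x := by
  rw [jump, max_eq_left hx, max_eq_right (by linarith)]; ring

lemma jump_of_nonpos (α β : ℝ) {x : ℝ} (hx : x ≤ 0) : jump α β x = β * x := by
  rw [jump, max_eq_right hx, max_eq_left (by linarith)]; ring

lemma jumpSq_of_nonneg (α β : ℝ) {x : ℝ} (hx : 0 ≤ x) : jumpSq α β x = α * x ^ 2 := by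
  rw [jumpSq, max_eq_left hx, max_eq_right (by linarith)]; ring

lemma jumpSq_of_nonpos (α β : ℝ) {x : ℝ} (hx : x ≤ 0) : jumpSq α β x = β * x ^ 2 := by
  rw [jumpSq, max_eq_right hx, max_eq_left (by linarith)]; ring

lemma jumpSq_self (α x : ℝ) : jumpSq α α x = α * x ^ 2 := by
  rcases le_total 0 x with h | h
  · rw [jumpSq_of_nonneg _ _ h]
  · rw [jumpSq_of_nonpos _ _ h]

lemma jumpSq_mono {α β α' β' : ℝ} (hα : α ≤ α') (hβ : β ≤ β') (x : ℝ) :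
    jumpSq α β x ≤ jumpSq α' β' x :=
  add_le_add (mul_le_mul_of_nonneg_right hα (sq_nonneg _))
    (mul_le_mul_of_nonneg_right hβ (sq_nonneg _))

lemma abs_jumpSq_le (α β x : ℝ) : |jumpSq α β x| ≤ (|α| + |β|) * x ^ 2 := by
  have hα := abs_nonneg α
  have hβ := abs_nonneg β
  have hx := sq_nonneg x
  rcases le_total 0 x with h | h
  · rw [jumpSq_of_nonneg _ _ h, abs_mul, abs_of_nonneg hx]
    nlinarith
  · rw [jumpSq_of_nonpos _ _ h, abs_mul, abs_of_nonneg hx]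
    nlinarith

lemma integral_jump (α β u : ℝ) : ∫ τ in (0 : ℝ)..u, jump α β τ = 1 / 2 * jumpSq α β u := by
  rcases le_total 0 u with h | h
  · rw [intervalIntegral.integral_congr (g := fun τ => α * τ)
      (fun τ hτ => jump_of_nonneg α β (by rw [uIcc_of_le h] at hτ; exact hτ.1)),
      intervalIntegral.integral_const_mul, integral_id, jumpSq_of_nonneg _ _ h]
    ring
  · rw [intervalIntegral.integral_congr (g := fun τ => β * τ)
      (fun τ hτ => jump_of_nonpos α β (by rw [uIcc_of_ge h] at hτ; exact hτ.2)),
      intervalIntegral.integral_const_mul, integral_id, jumpSq_of_nonpos _ _ h]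
    ring

lemma jump_lipschitz (α β x y : ℝ) : |jump α β x - jump α β y| ≤ (|α| + |β|) * |x - y| := by
  have h1 : |max x 0 - max y 0| ≤ |x - y| := abs_max_sub_max_le_abs x y 0
  have h2 : |max (-x) 0 - max (-y) 0| ≤ |x - y| := by
    refine (abs_max_sub_max_le_abs (-x) (-y) 0).trans_eq ?_
    rw [← abs_neg]
    congr 1
    ring
  have h3 : jump α β x - jump α β y =
      α * (max x 0 - max y 0) - β * (max (-x) 0 - max (-y) 0) := by
    rw [jump, jump]; ring
  rw [h3, add_mul]
  refine (abs_sub _ _).trans (add_le_add ?_ ?_)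
  · rw [abs_mul]; exact mul_le_mul_of_nonneg_left h1 (abs_nonneg _)
  · rw [abs_mul]; exact mul_le_mul_of_nonneg_left h2 (abs_nonneg _)

lemma convex_jumpSq {α β : ℝ} (hα : 0 ≤ α) (hβ : 0 ≤ β) (x y : ℝ) :
    jumpSq α β ((x + y) / 2) ≤ (jumpSq α β x + jumpSq α β y) / 2 := by
  have key : ∀ x y : ℝ, max ((x + y) / 2) 0 ^ 2 ≤ (max x 0 ^ 2 + max y 0 ^ 2) / 2 := by
    intro x y
    have h1 : max ((x + y) / 2) 0 ≤ (max x 0 + max y 0) / 2 :=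
      max_le (by linarith [le_max_left x 0, le_max_left y 0])
        (by linarith [le_max_right x 0, le_max_right y 0])
    have h2 := pow_le_pow_left₀ (le_max_right ((x + y) / 2) 0) h1 2
    nlinarith [sq_nonneg (max x 0 - max y 0)]
  have h1 := mul_le_mul_of_nonneg_left (key x y) hα
  have h2 := mul_le_mul_of_nonneg_left (key (-x) (-y)) hβ
  rw [show (-x + -y) / 2 = -((x + y) / 2) by ring] at h2
  rw [jumpSq, jumpSq, jumpSq]
  linarith

lemma integrable_jumpSq (α β : ℝ) (u : HSpace) : Integrable (fun z => jumpSq α β (u z)) cyl := by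
  refine ((integrable_sq u).const_mul (|α| + |β|)).mono'
    ((continuous_jumpSq α β).comp_aestronglyMeasurable (Lp.aestronglyMeasurable u)) ?_
  exact Filter.Eventually.of_forall fun z => abs_jumpSq_le α β (u z)

lemma norm_posPart_sq (u : HSpace) : ‖Lp.posPart u‖ ^ 2 = ∫ z, max (u z) 0 ^ 2 ∂cyl := by
  rw [norm_sq_eq_integral]
  refine integral_congr_ae ?_
  filter_upwards [Lp.coeFn_posPart u] with z hz
  rw [hz]

lemma norm_negPart_sq (u : HSpace) : ‖Lp.negPart u‖ ^ 2 = ∫ z, max (-u z) 0 ^ 2 ∂cyl := by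
  rw [norm_sq_eq_integral]
  refine integral_congr_ae ?_
  filter_upwards [Lp.coeFn_negPart_eq_max u] with z hz
  rw [hz]

/-- `v ↦ α ‖v⁺‖² + β ‖v⁻‖²`. -/
noncomputable def jumpForm (α β : ℝ) (v : HSpace) : ℝ := α * ‖Lp.posPart v‖ ^ 2 + β * ‖Lp.negPart v‖ ^ 2

lemma jumpForm_eq_integral (α β : ℝ) (v : HSpace) :
    jumpForm α β v = ∫ z, jumpSq α β (v z) ∂cyl := by
  have h1 : Integrable (fun z => max (v z) 0 ^ 2) cyl := by
    simpa [jumpSq] using integrable_jumpSq 1 0 v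
  have h2 : Integrable (fun z => max (-v z) 0 ^ 2) cyl := by
    simpa [jumpSq] using integrable_jumpSq 0 1 v
  rw [jumpForm, norm_posPart_sq, norm_negPart_sq, ← integral_const_mul, ← integral_const_mul,
    ← integral_add (h1.const_mul α) (h2.const_mul β)]
  rfl

lemma jumpForm_self (α : ℝ) (v : HSpace) : jumpForm α α v = α * ‖v‖ ^ 2 := by
  rw [jumpForm_eq_integral, norm_sq_eq_integral, ← integral_const_mul]
  simp_rw [jumpSq_self]

lemma jumpForm_mono {α β α' β' : ℝ} (hα : α ≤ α') (hβ : β ≤ β') (v : HSpace) :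
    jumpForm α β v ≤ jumpForm α' β' v :=
  add_le_add (mul_le_mul_of_nonneg_right hα (sq_nonneg _))
    (mul_le_mul_of_nonneg_right hβ (sq_nonneg _))

lemma le_jumpForm (α β : ℝ) (v : HSpace) : min α β * ‖v‖ ^ 2 ≤ jumpForm α β v := by
  rw [← jumpForm_self]
  exact jumpForm_mono (min_le_left _ _) (min_le_right _ _) v

lemma coeFn_half_smul_add (v w : HSpace) :
    ((1 / 2 : ℝ) • (v + w) : HSpace) =ᵐ[cyl] fun z => (v z + w z) / 2 := by
  filter_upwards [Lp.coeFn_smul (1 / 2 : ℝ) (v + w), Lp.coeFn_add v w] with z h1 h2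
  rw [h1, Pi.smul_apply, h2, Pi.add_apply, smul_eq_mul]
  ring

lemma convex_jumpForm {α β : ℝ} (hα : 0 ≤ α) (hβ : 0 ≤ β) (v w : HSpace) :
    jumpForm α β ((1 / 2 : ℝ) • (v + w)) ≤ (jumpForm α β v + jumpForm α β w) / 2 := by
  rw [jumpForm_eq_integral, jumpForm_eq_integral, jumpForm_eq_integral,
    ← integral_add (integrable_jumpSq _ _ v) (integrable_jumpSq _ _ w), ← integral_div]
  refine integral_mono_ae (integrable_jumpSq _ _ _)
    (((integrable_jumpSq _ _ v).add (integrable_jumpSq _ _ w)).div_const 2) ?_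
  filter_upwards [coeFn_half_smul_add v w] with z hz
  simp only [hz]
  exact convex_jumpSq hα hβ _ _

/-- A jointly continuous function, Lipschitz in the last variable. -/
structure LipIntegrand (f : ℝ × ℝ → ℝ → ℝ) (K : ℝ) : Prop where
  cont : Continuous fun x : (ℝ × ℝ) × ℝ => f x.1 x.2
  lip : ∀ z u w, |f z u - f z w| ≤ K * |u - w|

variable {f : ℝ × ℝ → ℝ → ℝ} {K : ℝ}

lemma LipIntegrand.cont_right (hf : LipIntegrand f K) (z : ℝ × ℝ) : Continuous (f z) :=
  hf.cont.comp (by fun_prop : Continuous fun u : ℝ => (z, u))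

lemma LipIntegrand.K_nonneg (hf : LipIntegrand f K) : 0 ≤ K := by
  have := (abs_nonneg _).trans (hf.lip 0 1 0)
  simpa using this

lemma LipIntegrand.memLp (hf : LipIntegrand f K) (u : HSpace) :
    MemLp (fun z => f z (u z)) 2 cyl := by
  have h0 : MemLp (fun z => f z 0) 2 cyl :=
    memLp_of_continuous (hf.cont.comp (by fun_prop : Continuous fun z : ℝ × ℝ => (z, (0 : ℝ))))
  have h1 : MemLp (fun z => f z (u z) - f z 0) 2 cyl := by
    refine (Lp.memLp u).of_le_mul (c := K)
      ((aestronglyMeasurable_comp hf.cont u).sub h0.aestronglyMeasurable) ?_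
    exact Filter.Eventually.of_forall fun z => by simpa using hf.lip z (u z) 0
  convert h1.add h0 using 1
  ext z
  simp

/-- The superposition operator `u ↦ f(·, u)`. -/
noncomputable def LipIntegrand.nem (hf : LipIntegrand f K) (u : HSpace) : HSpace :=
  (hf.memLp u).toLp _

lemma LipIntegrand.coeFn_nem (hf : LipIntegrand f K) (u : HSpace) :
    hf.nem u =ᵐ[cyl] fun z => f z (u z) := (hf.memLp u).coeFn_toLp

/-- The primitive of `f z`. -/
noncomputable def prim (f : ℝ × ℝ → ℝ → ℝ) (z : ℝ × ℝ) (u : ℝ) : ℝ := ∫ τ in (0 : ℝ)..u, f z τ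

lemma LipIntegrand.hasDerivAt_prim (hf : LipIntegrand f K) (z : ℝ × ℝ) (u : ℝ) :
    HasDerivAt (prim f z) (f z u) u :=
  intervalIntegral.integral_hasDerivAt_right ((hf.cont_right z).intervalIntegrable _ _)
    (hf.cont_right z).aestronglyMeasurable.stronglyMeasurableAtFilter (hf.cont_right z).continuousAt

lemma LipIntegrand.continuous_prim (hf : LipIntegrand f K) :
    Continuous fun x : (ℝ × ℝ) × ℝ => prim f x.1 x.2 :=
  intervalIntegral.continuous_parametric_intervalIntegral_of_continuous
    (f := fun x : (ℝ × ℝ) × ℝ => f x.1)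
    (hf.cont.comp (by fun_prop : Continuous fun y : ((ℝ × ℝ) × ℝ) × ℝ => (y.1.1, y.2)))
    continuous_snd

/-- Mean value inequality for `x ↦ prim f z x - f z u * x`, whose derivative is at most `K|h|`
between `u` and `u + h`. A remainder quadratic in `h` integrates to `O(‖h‖²)`, which gives Fréchet
differentiability on `L²`. -/
lemma LipIntegrand.abs_prim_sub_le (hf : LipIntegrand f K) (z : ℝ × ℝ) (u h : ℝ) :
    |prim f z (u + h) - prim f z u - f z u * h| ≤ K * h ^ 2 := by
  have hd : ∀ x ∈ uIcc u (u + h), HasDerivWithinAt (fun x => prim f z x - f z u * x)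
      (f z x - f z u) (uIcc u (u + h)) x := fun x _ => by
    have := (hf.hasDerivAt_prim z x).sub ((hasDerivAt_id x).const_mul (f z u))
    rw [mul_one] at this
    exact this.hasDerivWithinAt
  have hb : ∀ x ∈ uIcc u (u + h), ‖f z x - f z u‖ ≤ K * |h| := fun x hx => by
    refine (hf.lip z x u).trans (mul_le_mul_of_nonneg_left ?_ hf.K_nonneg)
    have := abs_sub_left_of_mem_uIcc hx
    simpa using this
  have := (convex_uIcc u (u + h)).norm_image_sub_le_of_norm_hasDerivWithin_le hd hb
    left_mem_uIcc right_mem_uIcc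
  rw [Real.norm_eq_abs, add_sub_cancel_left, Real.norm_eq_abs, mul_assoc, ← sq, sq_abs] at this
  convert this using 2
  ring

lemma prim_zero (f : ℝ × ℝ → ℝ → ℝ) (z : ℝ × ℝ) : prim f z 0 = 0 :=
  intervalIntegral.integral_same

lemma LipIntegrand.integrable_prim (hf : LipIntegrand f K) (u : HSpace) :
    Integrable (fun z => prim f z (u z)) cyl := by
  have h0 : Integrable (fun z => u z * f z 0) cyl :=
    integrable_mul u (hf.cont.comp (by fun_prop : Continuous fun z : ℝ × ℝ => (z, (0 : ℝ))))
  have h1 : Integrable (fun z => prim f z (u z) - u z * f z 0) cyl := by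
    refine ((integrable_sq u).const_mul K).mono'
      ((aestronglyMeasurable_comp hf.continuous_prim u).sub h0.aestronglyMeasurable) ?_
    refine Filter.Eventually.of_forall fun z => ?_
    have := hf.abs_prim_sub_le z 0 (u z)
    rwa [zero_add, prim_zero, sub_zero, mul_comm (f z 0)] at this
  exact (h1.add h0).congr (Filter.Eventually.of_forall fun z => by simp)

/-- The functional `u ↦ ∫ F(z, u)`, `F` the primitive of a Lipschitz integrand, is differentiable. -/
lemma LipIntegrand.hasFDerivAt (hf : LipIntegrand f K) (u : HSpace) :
    HasFDerivAt (fun u : HSpace => ∫ z, prim f z (u z) ∂cyl) (innerSL ℝ (hf.nem u)) u := by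
  rw [hasFDerivAt_iff_isLittleO_nhds_zero]
  refine Asymptotics.IsBigO.trans_isLittleO (g := fun h : HSpace => ‖h‖ ^ 2) ?_
    (Asymptotics.isLittleO_norm_pow_id one_lt_two)
  refine Asymptotics.IsBigO.of_bound K (Filter.Eventually.of_forall fun h => ?_)
  have h1 : Integrable (fun z => hf.nem u z * h z) cyl := integrable_mul_lp _ _
  have e1 : innerSL ℝ (hf.nem u) h = ∫ z, hf.nem u z * h z ∂cyl := by
    rw [innerSL_apply_apply, inner_eq_integral]
    simp_rw [mul_comm]
  have h2 : Integrable (fun z => prim f z ((u + h : HSpace) z) - prim f z (u z)) cyl :=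
    (hf.integrable_prim _).sub (hf.integrable_prim _)
  rw [e1, ← integral_sub (hf.integrable_prim _) (hf.integrable_prim _), ← integral_sub h2 h1,
    norm_pow, norm_norm, norm_sq_eq_integral, ← integral_const_mul]
  refine norm_integral_le_of_norm_le ((integrable_sq h).const_mul K) ?_
  filter_upwards [Lp.coeFn_add u h, hf.coeFn_nem u] with z hz1 hz2
  rw [hz1, hz2, Real.norm_eq_abs, Pi.add_apply]
  exact hf.abs_prim_sub_le z (u z) (h z)

lemma lipIntegrand_jump (α β : ℝ) : LipIntegrand (fun _ => jump α β) (|α| + |β|) where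
  cont := (continuous_jump α β).comp continuous_snd
  lip _ u w := jump_lipschitz α β u w

lemma hasFDerivAt_jumpForm (α β : ℝ) (v : HSpace) :
    HasFDerivAt (jumpForm α β) ((2 : ℝ) • innerSL ℝ ((lipIntegrand_jump α β).nem v)) v := by
  have h : jumpForm α β =
      (2 : ℝ) • fun u : HSpace => ∫ z, prim (fun _ => jump α β) z (u z) ∂cyl := by
    funext w
    rw [jumpForm_eq_integral, Pi.smul_apply, smul_eq_mul, ← integral_const_mul]
    refine integral_congr_ae (Filter.Eventually.of_forall fun z => ?_)
    simp only [prim, integral_jump]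
    ring
  rw [h]
  exact ((lipIntegrand_jump α β).hasFDerivAt v).const_smul (2 : ℝ)

lemma continuous_jumpForm (α β : ℝ) : Continuous (jumpForm α β) :=
  continuous_iff_continuousAt.2 fun v => (hasFDerivAt_jumpForm α β v).continuousAt

/-! ### The quadratic form `F` and the function `ǎ` -/

variable {k : ℤ} {d ε₁ ε₂ : ℝ}

lemma InGap.inner_clm_mid (hd : InGap k d) (v w : HSpace) :
    inner ℝ (hd.clm ((1 / 2 : ℝ) • (v + w))) ((1 / 2 : ℝ) • (v + w)) =
      (inner ℝ (hd.clm v) v + inner ℝ (hd.clm w) w) / 2 - inner ℝ (hd.clm (v - w)) (v - w) / 4 := by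
  have h : inner ℝ (hd.clm w) v = inner ℝ (hd.clm v) w := by
    rw [hd.clm_symm, real_inner_comm]
  simp only [map_smul, map_add, map_sub, inner_add_left, inner_add_right, inner_sub_left,
    inner_sub_right, real_inner_smul_left, real_inner_smul_right, h]
  ring

lemma Admissible.inGap (h : Admissible k ε₁ ε₂) : InGap k (pk k ε₁) :=
  ⟨by rw [pk]; linarith [h.1], by rw [pk]; linarith [h.2.1]⟩

lemma Admissible.max_lt_mu (h : Admissible k ε₁ ε₂) : max 0 (-1 / pk k ε₁) < mu k ε₁ ε₂ := by
  rw [mu]; linarith [h.2.2.1]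

lemma Admissible.mu_pos (h : Admissible k ε₁ ε₂) : 0 < mu k ε₁ ε₂ :=
  (le_max_left _ _).trans_lt h.max_lt_mu

lemma Admissible.mu_lt (h : Admissible k ε₁ ε₂) : mu k ε₁ ε₂ < 1 / (lam k - pk k ε₁) := by
  have := h.2.2.2
  rw [mu, pk, ← sub_sub]
  rw [pk] at this
  linarith

lemma Admissible.funF_eq (h : Admissible k ε₁ ε₂) (v : HSpace) :
    funF k ε₁ ε₂ v = inner ℝ (h.inGap.clm v) v - mu k ε₁ ε₂ * ‖v‖ ^ 2 := by
  rw [funF, inner_sub_left, real_inner_smul_left, real_inner_self_eq_norm_sq, h.inGap.clm_apply]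

lemma Admissible.continuous_funF (h : Admissible k ε₁ ε₂) : Continuous (funF k ε₁ ε₂) := by
  have : funF k ε₁ ε₂ = fun v => inner ℝ (h.inGap.clm v) v - mu k ε₁ ε₂ * ‖v‖ ^ 2 :=
    funext h.funF_eq
  rw [this]
  fun_prop

lemma Admissible.funF_smul (h : Admissible k ε₁ ε₂) (c : ℝ) (v : HSpace) :
    funF k ε₁ ε₂ (c • v) = c ^ 2 * funF k ε₁ ε₂ v := by
  rw [h.funF_eq, h.funF_eq, map_smul, real_inner_smul_left, real_inner_smul_right, norm_smul,
    mul_pow, Real.norm_eq_abs, sq_abs]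
  ring

/-- Parallelogram identity for a quadratic form: its concavity defect at midpoints is its value on
the difference. -/
lemma Admissible.funF_mid (h : Admissible k ε₁ ε₂) (v w : HSpace) :
    funF k ε₁ ε₂ ((1 / 2 : ℝ) • (v + w)) =
      (funF k ε₁ ε₂ v + funF k ε₁ ε₂ w) / 2 - funF k ε₁ ε₂ (v - w) / 4 := by
  have h1 : ‖(1 / 2 : ℝ) • (v + w)‖ ^ 2 = (‖v‖ ^ 2 + ‖w‖ ^ 2) / 2 - ‖v - w‖ ^ 2 / 4 := by
    rw [norm_smul, mul_pow, Real.norm_eq_abs, sq_abs, norm_add_sq_real, norm_sub_sq_real]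
    ring
  rw [h.funF_eq, h.funF_eq, h.funF_eq, h.funF_eq, h.inGap.inner_clm_mid, h1]
  ring

/-- The margin `ε₂` of `μ` above `max{0, -1/p_k}` is split in two: half of it leaves only finitely
many exceptional directions, the other half remains as the negative coefficient. -/
lemma Admissible.exists_funF_le (h : Admissible k ε₁ ε₂) :
    ∃ (S : Finset Idx) (C : ℝ), 0 ≤ C ∧ ∀ v : HSpace, funF k ε₁ ε₂ v ≤
      -(ε₂ / 2) * ‖v‖ ^ 2 + C * ∑ i ∈ S, inner ℝ (eigVec i) v ^ 2 := by
  have hκ : max 0 (-1 / pk k ε₁) < mu k ε₁ ε₂ - ε₂ / 2 := by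
    rw [mu]; linarith [h.2.2.1]
  obtain ⟨S, C, hC, hS⟩ := h.inGap.exists_finset_inner_clm_le hκ
  refine ⟨S, C, hC, fun v => ?_⟩
  rw [h.funF_eq]
  linarith [hS v]

/-- The largest value `1/(λ_k - p_k) - μ` of `F` on the unit sphere. -/
noncomputable def topF (k : ℤ) (ε₁ ε₂ : ℝ) : ℝ := 1 / (lam k - pk k ε₁) - mu k ε₁ ε₂

lemma Admissible.topF_pos (h : Admissible k ε₁ ε₂) : 0 < topF k ε₁ ε₂ := sub_pos.2 h.mu_lt

lemma Admissible.funF_le (h : Admissible k ε₁ ε₂) (v : HSpace) :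
    funF k ε₁ ε₂ v ≤ topF k ε₁ ε₂ * ‖v‖ ^ 2 := by
  rw [h.funF_eq, topF, sub_mul]
  linarith [h.inGap.inner_clm_le v]

lemma funG_eq_jumpForm (r : ℝ) (v : HSpace) : funG r v = jumpForm 1 r v := by
  rw [funG, jumpForm, one_mul]

lemma jumpForm_smul {c : ℝ} (hc : 0 ≤ c) (α β : ℝ) (v : HSpace) :
    jumpForm α β (c • v) = c ^ 2 * jumpForm α β v := by
  rw [jumpForm_eq_integral, jumpForm_eq_integral, ← integral_const_mul]
  refine integral_congr_ae ?_
  filter_upwards [Lp.coeFn_smul c v] with z hz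
  rw [hz, Pi.smul_apply, smul_eq_mul]
  rcases le_total 0 (v z) with h | h
  · rw [jumpSq_of_nonneg _ _ h, jumpSq_of_nonneg _ _ (mul_nonneg hc h)]; ring
  · rw [jumpSq_of_nonpos _ _ h, jumpSq_of_nonpos _ _ (mul_nonpos_of_nonneg_of_nonpos hc h)]; ring

lemma smul_jumpForm (c α β : ℝ) (v : HSpace) : c * jumpForm α β v = jumpForm (c * α) (c * β) v := by
  rw [jumpForm, jumpForm]; ring

lemma jumpForm_pos {α β : ℝ} (hα : 0 < α) (hβ : 0 < β) {v : HSpace} (hv : v ≠ 0) :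
    0 < jumpForm α β v :=
  (mul_pos (lt_min hα hβ) (pow_pos (norm_pos_iff.2 hv) 2)).trans_le (le_jumpForm α β v)

lemma jumpForm_zero (α β : ℝ) : jumpForm α β 0 = 0 := by
  have := jumpForm_smul le_rfl α β (0 : HSpace)
  simpa using this

lemma Admissible.bddAbove (h : Admissible k ε₁ ε₂) {r : ℝ} (hr : 0 < r) :
    BddAbove (range fun v : {v : HSpace // v ≠ 0} => funF k ε₁ ε₂ v.1 / funG r v.1) := by
  refine ⟨topF k ε₁ ε₂ / min 1 r, ?_⟩
  rintro _ ⟨⟨v, hv⟩, rfl⟩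
  have hmin : 0 < min 1 r := lt_min one_pos hr
  simp only [funG_eq_jumpForm]
  rw [div_le_iff₀ (jumpForm_pos one_pos hr hv), div_mul_eq_mul_div, le_div_iff₀ hmin]
  calc funF k ε₁ ε₂ v * min 1 r ≤ topF k ε₁ ε₂ * ‖v‖ ^ 2 * min 1 r :=
        mul_le_mul_of_nonneg_right (h.funF_le v) hmin.le
    _ = topF k ε₁ ε₂ * (min 1 r * ‖v‖ ^ 2) := by ring
    _ ≤ _ := mul_le_mul_of_nonneg_left (le_jumpForm 1 r v) h.topF_pos.le

lemma Admissible.funF_le_acheck (h : Admissible k ε₁ ε₂) {r : ℝ} (hr : 0 < r) (v : HSpace) :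
    funF k ε₁ ε₂ v ≤ acheck k ε₁ ε₂ r * jumpForm 1 r v := by
  rcases eq_or_ne v 0 with rfl | hv
  · rw [jumpForm_zero, h.funF_eq]
    simp
  · have : funF k ε₁ ε₂ v / funG r v ≤ acheck k ε₁ ε₂ r := le_ciSup (h.bddAbove hr) ⟨v, hv⟩
    rwa [funG_eq_jumpForm, div_le_iff₀ (jumpForm_pos one_pos hr hv)] at this

lemma Admissible.exists_funF_eq (h : Admissible k ε₁ ε₂) :
    ∃ v : HSpace, ‖v‖ = 1 ∧ funF k ε₁ ε₂ v = topF k ε₁ ε₂ := by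
  obtain ⟨v, hv, hv'⟩ := h.inGap.exists_inner_clm_eq
  refine ⟨v, hv, ?_⟩
  rw [h.funF_eq, hv', hv, topF]
  ring

lemma Admissible.nonempty (h : Admissible k ε₁ ε₂) : Nonempty {v : HSpace // v ≠ 0} := by
  obtain ⟨v, hv, -⟩ := h.exists_funF_eq
  exact ⟨v, fun h0 => by simp [h0] at hv⟩

lemma Admissible.acheck_le (h : Admissible k ε₁ ε₂) {r x : ℝ} (hr : 0 < r)
    (hx : ∀ v : HSpace, funF k ε₁ ε₂ v ≤ x * jumpForm 1 r v) : acheck k ε₁ ε₂ r ≤ x := by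
  have := h.nonempty
  refine ciSup_le fun v => ?_
  rw [funG_eq_jumpForm, div_le_iff₀ (jumpForm_pos one_pos hr v.2)]
  exact hx v.1

lemma Admissible.acheck_pos (h : Admissible k ε₁ ε₂) {r : ℝ} (hr : 0 < r) :
    0 < acheck k ε₁ ε₂ r := by
  obtain ⟨v, hv, hF⟩ := h.exists_funF_eq
  have h0 : v ≠ 0 := fun h0 => by simp [h0] at hv
  have h1 := h.funF_le_acheck hr v
  rw [hF] at h1
  exact pos_of_mul_pos_left (h.topF_pos.trans_le h1) (jumpForm_pos one_pos hr h0).le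

lemma Admissible.acheck_anti (h : Admissible k ε₁ ε₂) {r r' : ℝ} (hr : 0 < r) (hrr : r ≤ r') :
    acheck k ε₁ ε₂ r' ≤ acheck k ε₁ ε₂ r :=
  h.acheck_le (hr.trans_le hrr) fun v => (h.funF_le_acheck hr v).trans
    (mul_le_mul_of_nonneg_left (jumpForm_mono le_rfl hrr v) (h.acheck_pos hr).le)

/-- Compare denominators: `G_{r'} ≤ (r'/r) G_r`, since `r'/r ≥ 1` and `(r'/r) r = r'`. -/
lemma Admissible.acheck_scale (h : Admissible k ε₁ ε₂) {r r' : ℝ} (hr : 0 < r) (hrr : r ≤ r') :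
    acheck k ε₁ ε₂ r ≤ r' / r * acheck k ε₁ ε₂ r' := by
  have hr' := hr.trans_le hrr
  refine h.acheck_le hr fun v => (h.funF_le_acheck hr' v).trans ?_
  rw [mul_comm (r' / r), mul_assoc, smul_jumpForm (r' / r)]
  refine mul_le_mul_of_nonneg_left (jumpForm_mono ?_ ?_ v) (h.acheck_pos hr').le
  · rw [mul_one, one_le_div hr]; exact hrr
  · rw [div_mul_cancel₀ _ hr.ne']

/-- Monotonicity and the scaling bound squeeze `ǎ(x)` between `ǎ(r)` times `min{1, r/x}` and `ǎ(r)`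
times `max{1, r/x}`. -/
lemma Admissible.continuousAt_acheck (h : Admissible k ε₁ ε₂) {r : ℝ} (hr : 0 < r) :
    ContinuousAt (acheck k ε₁ ε₂) r := by
  have hdiv : Filter.Tendsto (fun x => r / x) (nhds r) (nhds 1) := by
    have : ContinuousAt (fun x => r / x) r := continuousAt_const.div continuousAt_id hr.ne'
    simpa [ContinuousAt, div_self hr.ne'] using this
  have hlo : Filter.Tendsto (fun x => min 1 (r / x) * acheck k ε₁ ε₂ r) (nhds r)
      (nhds (acheck k ε₁ ε₂ r)) := by
    simpa using ((tendsto_const_nhds (x := (1 : ℝ))).min hdiv).mul_const (acheck k ε₁ ε₂ r)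
  have hhi : Filter.Tendsto (fun x => max 1 (r / x) * acheck k ε₁ ε₂ r) (nhds r)
      (nhds (acheck k ε₁ ε₂ r)) := by
    simpa using ((tendsto_const_nhds (x := (1 : ℝ))).max hdiv).mul_const (acheck k ε₁ ε₂ r)
  have ha := (h.acheck_pos hr).le
  refine tendsto_of_tendsto_of_tendsto_of_le_of_le' hlo hhi ?_ ?_
  · filter_upwards [lt_mem_nhds hr] with x hx
    rcases le_total r x with hrx | hrx
    · have h1 := h.acheck_scale hr hrx
      rw [min_eq_right ((div_le_one hx).2 hrx), div_mul_eq_mul_div, div_le_iff₀ hx]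
      rw [div_mul_eq_mul_div, le_div_iff₀ hr] at h1
      linarith
    · exact (mul_le_of_le_one_left ha (min_le_left _ _)).trans (h.acheck_anti hx hrx)
  · filter_upwards [lt_mem_nhds hr] with x hx
    rcases le_total r x with hrx | hrx
    · exact (h.acheck_anti hr hrx).trans (le_mul_of_one_le_left ha (le_max_left _ _))
    · exact (h.acheck_scale hx hrx).trans (mul_le_mul_of_nonneg_right (le_max_right _ _) ha)

/-- The supremum defining `ǎ(r)` is attained, at a solution of the Euler equation. -/
lemma Admissible.exists_euler (h : Admissible k ε₁ ε₂) {r : ℝ} (hr : 0 < r) :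
    ∃ v : HSpace, v ≠ 0 ∧ (h.inGap.clm v : HSpace) =ᵐ[cyl] fun z =>
      jump (acheck k ε₁ ε₂ r + mu k ε₁ ε₂) (r * acheck k ε₁ ε₂ r + mu k ε₁ ε₂) (v z) := by
  set a := acheck k ε₁ ε₂ r with ha
  have hapos : 0 < a := h.acheck_pos hr
  -- The quotient problem becomes the maximization of `F - ǎ(r) G_r`, whose supremum on the unit
  -- sphere is `0`; here `-a G_r` is concave and `F` is concave up to finitely many directions.
  let Ψ : HSpace → ℝ := fun v => funF k ε₁ ε₂ v - a * jumpForm 1 r v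
  have hΨc : Continuous Ψ := h.continuous_funF.sub ((continuous_jumpForm 1 r).const_mul a)
  have hΨ0 : ∀ v, Ψ v ≤ 0 := fun v => sub_nonpos.2 (h.funF_le_acheck hr v)
  obtain ⟨S, C, hC, hS⟩ := h.exists_funF_le
  have hmid : ∀ v w : HSpace, (Ψ v + Ψ w) / 2 + ε₂ / 8 * ‖v - w‖ ^ 2
      - C / 4 * ∑ i ∈ S, inner ℝ (eigVec i) (v - w) ^ 2 ≤ Ψ ((1 / 2 : ℝ) • (v + w)) := by
    intro v w
    have h1 := h.funF_mid v w
    have h2 := mul_le_mul_of_nonneg_left (convex_jumpForm zero_le_one hr.le v w) hapos.le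
    have h3 := hS (v - w)
    simp only [Ψ]
    rw [h1]
    linarith
  -- Near-maximizers of the quotient are normalized by homogeneity; the factor `max 1 r` bounds
  -- `G_r` on the unit sphere.
  have hseq : ∀ n : ℕ, ∃ v : HSpace, ‖v‖ = 1 ∧ -(max 1 r * (1 / ((n : ℝ) + 1))) ≤ Ψ v := by
    intro n
    have hn : (0 : ℝ) < 1 / ((n : ℝ) + 1) := by positivity
    have := h.nonempty
    obtain ⟨⟨v, hv⟩, hlt⟩ := exists_lt_of_lt_ciSup (show a - 1 / ((n : ℝ) + 1) < ⨆
      v : {v : HSpace // v ≠ 0}, funF k ε₁ ε₂ v.1 / funG r v.1 from sub_lt_self a hn)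
    simp only [funG_eq_jumpForm] at hlt
    rw [lt_div_iff₀ (jumpForm_pos one_pos hr hv)] at hlt
    have hc : 0 ≤ ‖v‖⁻¹ := inv_nonneg.2 (norm_nonneg v)
    have h1 : ‖(‖v‖⁻¹ • v : HSpace)‖ = 1 := by
      rw [norm_smul, norm_inv, norm_norm, inv_mul_cancel₀ (norm_ne_zero_iff.2 hv)]
    refine ⟨‖v‖⁻¹ • v, h1, ?_⟩
    have h2 : jumpForm 1 r (‖v‖⁻¹ • v) ≤ max 1 r := by
      have := jumpForm_mono (le_max_left 1 r) (le_max_right 1 r) (‖v‖⁻¹ • v)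
      rwa [jumpForm_self, h1, one_pow, mul_one] at this
    have h3 := mul_le_mul_of_nonneg_left hlt.le (sq_nonneg ‖v‖⁻¹)
    have h4 := mul_le_mul_of_nonneg_right h2 hn.le
    simp only [Ψ]
    rw [h.funF_smul]
    rw [jumpForm_smul hc] at h4 ⊢
    linarith
  choose v hv1 hv2 using hseq
  have hlim : Filter.Tendsto (fun n => Ψ (v n)) Filter.atTop (nhds 0) := by
    refine tendsto_of_tendsto_of_tendsto_of_le_of_le ?_ tendsto_const_nhds hv2 fun n => hΨ0 _
    simpa using (tendsto_one_div_add_atTop_nhds_zero_nat.const_mul (max 1 r)).neg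
  obtain ⟨v₀, hv₀, φ, -, hφ⟩ := exists_tendsto_of_maximizing hΨc
    (by linarith [h.2.2.1] : 0 < ε₂ / 8) (by linarith : 0 ≤ C / 4) eigVec S hΨ0 hmid v
    (fun n => (hv1 n).le) hlim
  -- Strong convergence is what keeps the limit away from the trivial maximizer `0`.
  have hnorm : ‖v₀‖ = 1 := by
    refine tendsto_nhds_unique hφ.norm ?_
    simp only [Function.comp_apply, hv1]
    exact tendsto_const_nhds
  refine ⟨v₀, fun h0 => by simp [h0] at hnorm, ?_⟩
  set α := a + mu k ε₁ ε₂
  set β := r * a + mu k ε₁ ε₂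
  have hΨ : Ψ = fun v => inner ℝ (h.inGap.clm v) v - jumpForm α β v := by
    funext v
    simp only [Ψ]
    rw [h.funF_eq, jumpForm, jumpForm, ← jumpForm_self (mu k ε₁ ε₂), jumpForm]
    simp only [α, β]
    ring
  have hmax : IsLocalMax Ψ v₀ := Filter.Eventually.of_forall fun v => by
    rw [hv₀]; exact hΨ0 v
  have hder : HasFDerivAt Ψ ((2 : ℝ) • innerSL ℝ (h.inGap.clm v₀) -
      (2 : ℝ) • innerSL ℝ ((lipIntegrand_jump α β).nem v₀)) v₀ := by
    rw [hΨ]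
    refine HasFDerivAt.sub ?_ (hasFDerivAt_jumpForm α β v₀)
    have := (h.inGap.clm.hasFDerivAt (x := v₀)).inner ℝ (hasFDerivAt_id v₀)
    refine this.congr_fderiv ?_
    ext w
    have hs : inner ℝ (h.inGap.clm w) v₀ = inner ℝ (h.inGap.clm v₀) w := by
      rw [h.inGap.clm_symm, real_inner_comm]
    simp [hs, two_mul]
  have h0 := hmax.hasFDerivAt_eq_zero hder
  have h1 : h.inGap.clm v₀ = (lipIntegrand_jump α β).nem v₀ := by
    refine ext_inner_right ℝ fun w => ?_
    have := congrArg (fun T : HSpace →L[ℝ] ℝ => T w) h0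
    simp only [sub_apply, smul_apply, innerSL_apply_apply,
      smul_eq_mul, zero_apply] at this
    linarith
  rw [h1]
  exact (lipIntegrand_jump α β).coeFn_nem v₀

/-! ### The region below the curve -/

/-- `1/(x - p_k) - μ`. -/
noncomputable def coordA (k : ℤ) (ε₁ ε₂ x : ℝ) : ℝ := 1 / (x - pk k ε₁) - mu k ε₁ ε₂

/-- This function on `Q_k` vanishes exactly on the curve and is positive below it. -/
noncomputable def curveFun (k : ℤ) (ε₁ ε₂ : ℝ) (x : ℝ × ℝ) : ℝ :=
  coordA k ε₁ ε₂ x.1 - acheck k ε₁ ε₂ (coordA k ε₁ ε₂ x.2 / coordA k ε₁ ε₂ x.1)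

lemma Admissible.coordA_pos (h : Admissible k ε₁ ε₂) {x : ℝ}
    (hx : x ∈ Ioo (pk k ε₁) (qk k ε₁ ε₂)) : 0 < coordA k ε₁ ε₂ x := by
  have h1 : 0 < x - pk k ε₁ := sub_pos.2 hx.1
  have h2 : x - pk k ε₁ < 1 / mu k ε₁ ε₂ := by
    have := hx.2
    rw [qk] at this
    linarith
  rw [coordA, sub_pos, lt_div_iff₀ h1, mul_comm]
  rwa [lt_div_iff₀ h.mu_pos] at h2

lemma Admissible.continuousOn_curveFun (h : Admissible k ε₁ ε₂) :
    ContinuousOn (curveFun k ε₁ ε₂) (Qk k ε₁ ε₂) := by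
  intro x hx
  refine ContinuousAt.continuousWithinAt ?_
  have hA : ∀ y ∈ Ioo (pk k ε₁) (qk k ε₁ ε₂), ContinuousAt (coordA k ε₁ ε₂) y := fun y hy =>
    (continuousAt_const.div (continuousAt_id.sub continuousAt_const)
      (sub_pos.2 hy.1).ne').sub continuousAt_const
  have h1 : ContinuousAt (fun x : ℝ × ℝ => coordA k ε₁ ε₂ x.1) x :=
    (hA x.1 hx.1).comp continuousAt_fst
  have h2 : ContinuousAt (fun x : ℝ × ℝ => coordA k ε₁ ε₂ x.2) x :=
    (hA x.2 hx.2).comp continuousAt_snd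
  refine h1.sub (ContinuousAt.comp (g := acheck k ε₁ ε₂)
    (h.continuousAt_acheck (div_pos (h.coordA_pos hx.2) (h.coordA_pos hx.1)))
    (h2.div h1 (h.coordA_pos hx.1).ne'))

/-- The parametrization is inverted by `r = B/A`, where `A`, `B` are the values of `coordA` at the
two coordinates of `x`. -/
lemma Admissible.mem_Ck (h : Admissible k ε₁ ε₂) {x : ℝ × ℝ} (hx : x ∈ Qk k ε₁ ε₂)
    (h0 : curveFun k ε₁ ε₂ x = 0) : x ∈ Ck k ε₁ ε₂ := by
  have hA := h.coordA_pos hx.1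
  refine ⟨coordA k ε₁ ε₂ x.2 / coordA k ε₁ ε₂ x.1, div_pos (h.coordA_pos hx.2) hA, ?_⟩
  have h1 : acheck k ε₁ ε₂ (coordA k ε₁ ε₂ x.2 / coordA k ε₁ ε₂ x.1) = coordA k ε₁ ε₂ x.1 := by
    rw [curveFun] at h0
    linarith
  simp only [h1, div_mul_cancel₀ _ hA.ne']
  simp [coordA]

/-- Below `λ_k` both values of `coordA` exceed `topF`, the top of `F` on the unit sphere; hence
`ǎ(B/A) ≤ topF · A / min{A, B} < A`. -/
lemma Admissible.curveFun_pos_of_lt_lam (h : Admissible k ε₁ ε₂) {x : ℝ × ℝ}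
    (hx : x ∈ Ioo (pk k ε₁) (lam k) ×ˢ Ioo (pk k ε₁) (lam k)) : 0 < curveFun k ε₁ ε₂ x := by
  have hQ : ∀ y ∈ Ioo (pk k ε₁) (lam k), topF k ε₁ ε₂ < coordA k ε₁ ε₂ y := fun y hy =>
    sub_lt_sub_right (one_div_lt_one_div_of_lt (sub_pos.2 hy.1) (by linarith [hy.2])) _
  have hA := hQ _ hx.1
  have hB := hQ _ hx.2
  have hA0 := h.topF_pos.trans hA
  have hB0 := h.topF_pos.trans hB
  set A := coordA k ε₁ ε₂ x.1
  set B := coordA k ε₁ ε₂ x.2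
  have hmin : topF k ε₁ ε₂ < min A B := lt_min hA hB
  have hm0 : 0 < min A B := lt_min hA0 hB0
  have h1 : acheck k ε₁ ε₂ (B / A) ≤ topF k ε₁ ε₂ / min A B * A := by
    refine h.acheck_le (div_pos hB0 hA0) fun v => (h.funF_le v).trans ?_
    rw [mul_assoc, smul_jumpForm, mul_one, mul_div_cancel₀ _ hA0.ne', div_mul_eq_mul_div,
      le_div_iff₀ hm0, mul_assoc, mul_comm (‖v‖ ^ 2)]
    exact mul_le_mul_of_nonneg_left (le_jumpForm A B v) h.topF_pos.le
  have h2 : topF k ε₁ ε₂ / min A B * A < A :=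
    mul_lt_of_lt_one_left hA0 ((div_lt_one hm0).2 hmin)
  rw [curveFun]
  exact sub_pos.2 (h1.trans_lt h2)

/-- On the component of `x`, `curveFun` is continuous and has no zero, since its zeros lie on the
curve; it is positive at a point of `]p_k, λ_k[²`, hence also at `x`. -/
lemma BelowCk.exists_curveFun_pos {x : ℝ × ℝ} (hx : BelowCk k x) :
    ∃ ε₁ ε₂ : ℝ, Admissible k ε₁ ε₂ ∧ x ∈ Qk k ε₁ ε₂ ∧ 0 < curveFun k ε₁ ε₂ x := by
  obtain ⟨ε₁, ε₂, h, hsub⟩ := hx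
  obtain ⟨y, hy⟩ : (Ioo (pk k ε₁) (lam k) ×ˢ Ioo (pk k ε₁) (lam k)).Nonempty :=
    (nonempty_Ioo.2 h.inGap.2).prod (nonempty_Ioo.2 h.inGap.2)
  have hyc := hsub hy
  -- `connectedComponentIn F x` is empty when `x ∉ F`, so a point in it places `x` in `F`.
  have hxF : x ∈ Qk k ε₁ ε₂ \ Ck k ε₁ ε₂ := connectedComponentIn_nonempty_iff.1 ⟨y, hyc⟩
  refine ⟨ε₁, ε₂, h, hxF.1, ?_⟩
  by_contra! hle
  have hss := connectedComponentIn_subset (Qk k ε₁ ε₂ \ Ck k ε₁ ε₂) x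
  obtain ⟨w, hw, hw0⟩ := (isPreconnected_connectedComponentIn (F := Qk k ε₁ ε₂ \ Ck k ε₁ ε₂)
    (x := x)).intermediate_value (mem_connectedComponentIn hxF) hyc
    (h.continuousOn_curveFun.mono (hss.trans sdiff_subset))
    ⟨hle, (h.curveFun_pos_of_lt_lam hy).le⟩
  exact (hss hw).2 (h.mem_Ck (hss hw).1 hw0)

/-- The coercivity below the curve. -/
lemma Admissible.exists_funF_le_jumpForm (h : Admissible k ε₁ ε₂) {x : ℝ × ℝ}
    (hx : x ∈ Qk k ε₁ ε₂) (h0 : 0 < curveFun k ε₁ ε₂ x) : ∃ θ : ℝ, 0 < θ ∧ θ < 1 ∧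
      ∀ v, funF k ε₁ ε₂ v ≤
        θ * jumpForm (coordA k ε₁ ε₂ x.1) (coordA k ε₁ ε₂ x.2) v := by
  have hA := h.coordA_pos hx.1
  have hr := div_pos (h.coordA_pos hx.2) hA
  rw [curveFun, sub_pos] at h0
  -- The constant is `θ = ǎ(B/A)/A`, and `θ < 1` is the positivity of `curveFun`.
  refine ⟨_, div_pos (h.acheck_pos hr) hA, (div_lt_one hA).2 h0, fun v => ?_⟩
  refine (h.funF_le_acheck hr v).trans_eq ?_
  rw [smul_jumpForm, smul_jumpForm]
  congr 1 <;> field_simp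

/-- Being below the curve does not depend on the choice of the parameters. -/
lemma Admissible.curveFun_pos_change (h : Admissible k ε₁ ε₂) {δ₁ δ₂ : ℝ}
    (h' : Admissible k δ₁ δ₂) {x : ℝ × ℝ} (hx : x ∈ Qk k ε₁ ε₂) (hx' : x ∈ Qk k δ₁ δ₂)
    (h0 : 0 < curveFun k ε₁ ε₂ x) : 0 < curveFun k δ₁ δ₂ x := by
  by_contra! hle
  set d := pk k δ₁ with hd
  set e := pk k ε₁ with he
  set m := max d e with hm
  have hml : m < lam k := max_lt h'.inGap.2 h.inGap.2
  have hm1 : m < x.1 := max_lt hx'.1.1 hx.1.1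
  have hm2 : m < x.2 := max_lt hx'.2.1 hx.2.1
  have hdm : d ≤ m := le_max_left _ _
  have hem : e ≤ m := le_max_right _ _
  -- The segment from the diagonal point `(m, m)` to `x`. Past its start both coordinates exceed
  -- both values of `p_k`, and close to the start they are below `λ_k`, where `curveFun` is
  -- positive.
  let γ : ℝ → ℝ × ℝ := fun t => (m + t * (x.1 - m), m + t * (x.2 - m))
  have hγc : Continuous γ := by fun_prop
  obtain ⟨t₀, ht0, ht1, hta, htb⟩ : ∃ t₀ : ℝ, 0 < t₀ ∧ t₀ < 1 ∧ m + t₀ * (x.1 - m) < lam k ∧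
      m + t₀ * (x.2 - m) < lam k := by
    have hc : Filter.Tendsto γ (nhdsWithin 0 (Ioi 0)) (nhds (γ 0)) :=
      (hγc.tendsto 0).mono_left nhdsWithin_le_nhds
    have hγ0 : γ 0 ∈ Iio (lam k) ×ˢ Iio (lam k) := by simp [γ, hml]
    have h1 := hc.eventually ((isOpen_Iio.prod isOpen_Iio).mem_nhds hγ0)
    have h2 : ∀ᶠ t : ℝ in nhdsWithin 0 (Ioi 0), t ∈ Ioo (0 : ℝ) 1 :=
      Ioo_mem_nhdsGT one_pos
    obtain ⟨t, ht⟩ := (h1.and h2).exists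
    exact ⟨t, ht.2.1, ht.2.2, ht.1.1, ht.1.2⟩
  have hγm : ∀ t ∈ Icc t₀ 1, m < (γ t).1 ∧ m < (γ t).2 ∧ (γ t).1 ≤ x.1 ∧ (γ t).2 ≤ x.2 := by
    intro t ht
    have htp : 0 < t := ht0.trans_le ht.1
    simp only [γ]
    refine ⟨?_, ?_, ?_, ?_⟩ <;>
      nlinarith [mul_pos htp (sub_pos.2 hm1), mul_pos htp (sub_pos.2 hm2),
        mul_nonneg (sub_nonneg.2 ht.2) (sub_pos.2 hm1).le,
        mul_nonneg (sub_nonneg.2 ht.2) (sub_pos.2 hm2).le]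
  have hγQ : MapsTo γ (Icc t₀ 1) (Qk k δ₁ δ₂) := fun t ht => by
    obtain ⟨g1, g2, g3, g4⟩ := hγm t ht
    exact ⟨⟨hdm.trans_lt g1, g3.trans_lt hx'.1.2⟩, ⟨hdm.trans_lt g2, g4.trans_lt hx'.2.2⟩⟩
  have hcont : ContinuousOn (fun t => curveFun k δ₁ δ₂ (γ t)) (Icc t₀ 1) :=
    h'.continuousOn_curveFun.comp hγc.continuousOn hγQ
  have hstart : 0 < curveFun k δ₁ δ₂ (γ t₀) := by
    obtain ⟨g1, g2, -, -⟩ := hγm t₀ (left_mem_Icc.2 ht1.le)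
    exact h'.curveFun_pos_of_lt_lam ⟨⟨hdm.trans_lt g1, hta⟩, ⟨hdm.trans_lt g2, htb⟩⟩
  have hend : γ 1 = x := by simp [γ]
  obtain ⟨t, ht, hzero⟩ := intermediate_value_Icc' ht1.le hcont
    (show (0 : ℝ) ∈ Icc (curveFun k δ₁ δ₂ (γ 1)) (curveFun k δ₁ δ₂ (γ t₀)) from
      ⟨by rw [hend]; exact hle, hstart.le⟩)
  obtain ⟨g1, g2, g3, g4⟩ := hγm t ht
  have hQt := hγQ ht
  have hA := h'.coordA_pos hQt.1
  have hr := div_pos (h'.coordA_pos hQt.2) hA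
  -- At a zero of `curveFun` the maximizer `v` yields `u = Lv` with `v = (a - d)u⁺ - (b - d)u⁻`,
  -- where `(a, b) = γ t`: a nontrivial solution of `□u = au⁺ - bu⁻`.
  obtain ⟨v, hv, heuler⟩ := h'.exists_euler hr
  have hach : acheck k δ₁ δ₂ (coordA k δ₁ δ₂ (γ t).2 / coordA k δ₁ δ₂ (γ t).1) =
      coordA k δ₁ δ₂ (γ t).1 := by
    simp only [curveFun] at hzero
    linarith
  rw [hach, div_mul_cancel₀ _ hA.ne'] at heuler
  set a := (γ t).1 with ha_def
  set b := (γ t).2 with hb_def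
  have hα : coordA k δ₁ δ₂ a + mu k δ₁ δ₂ = 1 / (a - d) := by rw [coordA]; ring
  have hβ : coordA k δ₁ δ₂ b + mu k δ₁ δ₂ = 1 / (b - d) := by rw [coordA]; ring
  rw [hα, hβ] at heuler
  set u : HSpace := h'.inGap.clm v with hu
  -- The function `(□ - e)u`: the same `u` seen from the other parameters.
  set w : HSpace := v + (d - e) • u with hw
  have hLw : h.inGap.clm w = u := h'.inGap.clm_change h.inGap v
  have hw0 : w ≠ 0 := by
    intro hw0
    rw [hw0, map_zero] at hLw
    rw [← hLw, smul_zero, add_zero] at hw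
    exact hv (hw ▸ hw0)
  have had : 0 < a - d := by linarith
  have hbd : 0 < b - d := by linarith
  have hae : 0 < a - e := by linarith
  have hbe : 0 < b - e := by linarith
  have hxa : 0 < x.1 - e := by linarith
  have hxb : 0 < x.2 - e := by linarith
  -- Pointwise `w = (a - e)u⁺ - (b - e)u⁻`. Since `a ≤ x.1` and `b ≤ x.2`, the ratios `(a - e)/(x.1
  -- - e)` and `(b - e)/(x.2 - e)` are at most `1`.
  have hlow : jumpForm (1 / (x.1 - e)) (1 / (x.2 - e)) w ≤ inner ℝ u w := by
    rw [jumpForm_eq_integral, inner_eq_integral]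
    refine integral_mono_ae (integrable_jumpSq _ _ _) (integrable_mul_lp _ _) ?_
    filter_upwards [heuler, Lp.coeFn_add v ((d - e) • u), Lp.coeFn_smul (d - e) u]
      with z h1 h2 h3
    have hwz : w z = v z + (d - e) * u z := by
      rw [hw, h2, Pi.add_apply, h3, Pi.smul_apply, smul_eq_mul]
    change jumpSq _ _ (w z) ≤ w z * u z
    rcases le_total 0 (v z) with hs | hs
    · rw [jump_of_nonneg _ _ hs] at h1
      have e1 : w z = (a - e) * (v z / (a - d)) := by
        rw [hwz, h1]; field_simp; ring
      rw [e1, h1, jumpSq_of_nonneg _ _ (by positivity)]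
      have : 1 / (x.1 - e) * ((a - e) * (v z / (a - d))) ^ 2 =
          ((a - e) / (x.1 - e)) * ((a - e) * (v z / (a - d)) * (1 / (a - d) * v z)) := by
        field_simp
      rw [this]
      refine mul_le_of_le_one_left (by positivity) ((div_le_one hxa).2 (by linarith))
    · rw [jump_of_nonpos _ _ hs] at h1
      have e1 : w z = (b - e) * (v z / (b - d)) := by
        rw [hwz, h1]; field_simp; ring
      have hs' : v z / (b - d) ≤ 0 := div_nonpos_of_nonpos_of_nonneg hs hbd.le
      rw [e1, h1, jumpSq_of_nonpos _ _ (mul_nonpos_of_nonneg_of_nonpos hbe.le hs')]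
      have : 1 / (x.2 - e) * ((b - e) * (v z / (b - d))) ^ 2 =
          ((b - e) / (x.2 - e)) * ((b - e) * (v z / (b - d)) * (1 / (b - d) * v z)) := by
        field_simp
      rw [this]
      refine mul_le_of_le_one_left ?_ ((div_le_one hxb).2 (by linarith))
      rw [show (b - e) * (v z / (b - d)) * (1 / (b - d) * v z) =
        (b - e) * (v z / (b - d)) ^ 2 by field_simp]
      positivity
  -- By the last bound `F(w)` is at least the positive form that coercivity at `x` multiplies by `θ
  -- < 1`, which is absurd for `w ≠ 0`.
  obtain ⟨θ, hθ0, hθ1, hθ⟩ := h.exists_funF_le_jumpForm hx h0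
  have h1 := hθ w
  have h2 := jumpForm_pos (h.coordA_pos hx.1) (h.coordA_pos hx.2) hw0
  have h3 : jumpForm (coordA k ε₁ ε₂ x.1) (coordA k ε₁ ε₂ x.2) w =
      jumpForm (1 / (x.1 - e)) (1 / (x.2 - e)) w - mu k ε₁ ε₂ * ‖w‖ ^ 2 := by
    rw [← jumpForm_self, jumpForm, jumpForm, jumpForm, coordA, coordA]
    ring
  rw [h.funF_eq, hLw] at h1
  nlinarith [mul_pos (sub_pos.2 hθ1) h2]

/-! ### The Fenchel–Legendre transform of the primitive -/

lemma mul_sub_le_sub_of_monotone {g G : ℝ → ℝ} (hG : ∀ x, HasDerivAt G (g x) x) (hg : Monotone g)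
    (x y : ℝ) : g x * (y - x) ≤ G y - G x := by
  have hc : Continuous G := continuous_iff_continuousAt.2 fun x => (hG x).continuousAt
  rcases lt_trichotomy x y with h | rfl | h
  · obtain ⟨c, hc1, hc2⟩ := exists_hasDerivAt_eq_slope G g h hc.continuousOn fun x _ => hG x
    rw [eq_div_iff (by linarith)] at hc2
    nlinarith [hg hc1.1.le]
  · simp
  · obtain ⟨c, hc1, hc2⟩ := exists_hasDerivAt_eq_slope G g h hc.continuousOn fun x _ => hG x
    rw [eq_div_iff (by linarith)] at hc2
    nlinarith [hg hc1.2.le]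

/-- The hypotheses on `j = J'` under which the dual problem is studied. -/
structure DualIntegrand (j : ℝ × ℝ → ℝ → ℝ) (μ α β : ℝ) : Prop where
  cont : Continuous fun x : (ℝ × ℝ) × ℝ => j x.1 x.2
  mono : ∀ z, Monotone (j z)
  anti : ∀ z, Antitone fun u => j z u - u / μ
  mu_pos : 0 < μ
  alpha_pos : 0 < α
  beta_pos : 0 < β
  asymp : ∀ ε > 0, ∃ C, 0 ≤ C ∧ ∀ z u, |prim j z u - 1 / 2 * jumpSq α β u| ≤ ε * u ^ 2 + C

/-- The conjugate of the primitive of `j z`. -/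
noncomputable def conj (j : ℝ × ℝ → ℝ → ℝ) (z : ℝ × ℝ) (v : ℝ) : ℝ := ⨆ u : ℝ, (v * u - prim j z u)

variable {j : ℝ × ℝ → ℝ → ℝ} {μ α β : ℝ}

namespace DualIntegrand

lemma lip (hj : DualIntegrand j μ α β) : LipIntegrand j (1 / μ) where
  cont := hj.cont
  lip z := by
    have key : ∀ u w : ℝ, u ≤ w → |j z u - j z w| ≤ 1 / μ * |u - w| := fun u w h => by
      have h1 := hj.mono z h
      have h2 := hj.anti z h
      simp only at h2
      rw [abs_of_nonpos (by linarith), abs_of_nonpos (by linarith)]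
      have : 1 / μ * -(u - w) = w / μ - u / μ := by ring
      linarith
    intro u w
    rcases le_total u w with h | h
    · exact key u w h
    · rw [abs_sub_comm, abs_sub_comm u]
      exact key w u h

lemma hasDerivAt (hj : DualIntegrand j μ α β) (z : ℝ × ℝ) (u : ℝ) :
    HasDerivAt (prim j z) (j z u) u := hj.lip.hasDerivAt_prim z u

lemma continuous_prim_right (hj : DualIntegrand j μ α β) (z : ℝ × ℝ) : Continuous (prim j z) :=
  continuous_iff_continuousAt.2 fun u => (hj.hasDerivAt z u).continuousAt

lemma exists_lower (hj : DualIntegrand j μ α β) :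
    ∃ m C : ℝ, 0 < m ∧ 0 ≤ C ∧ ∀ z u, m * u ^ 2 - C ≤ prim j z u := by
  have hm : 0 < min α β := lt_min hj.alpha_pos hj.beta_pos
  obtain ⟨C, hC, h⟩ := hj.asymp (min α β / 4) (by positivity)
  refine ⟨min α β / 4, C, by positivity, hC, fun z u => ?_⟩
  have h1 := (abs_le.1 (h z u)).1
  have h2 := jumpSq_mono (min_le_left α β) (min_le_right α β) u
  rw [jumpSq_self] at h2
  linarith

lemma exists_le (hj : DualIntegrand j μ α β) :
    ∃ D C : ℝ, 0 ≤ D ∧ 0 ≤ C ∧ ∀ z v u, v * u - prim j z u ≤ D * v ^ 2 + C := by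
  obtain ⟨m, C, hm, hC, h⟩ := hj.exists_lower
  refine ⟨1 / (4 * m), C, by positivity, hC, fun z v u => ?_⟩
  have h1 := h z u
  -- Young's inequality `vu ≤ mu² + v²/(4m)`.
  have h2 : 0 ≤ (v - 2 * m * u) ^ 2 / (4 * m) := by positivity
  have h3 : (v - 2 * m * u) ^ 2 / (4 * m) = 1 / (4 * m) * v ^ 2 - v * u + m * u ^ 2 := by
    field_simp
    ring
  linarith

lemma bddAbove (hj : DualIntegrand j μ α β) (z : ℝ × ℝ) (v : ℝ) :
    BddAbove (range fun u : ℝ => v * u - prim j z u) := by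
  obtain ⟨D, C, -, -, h⟩ := hj.exists_le
  exact ⟨D * v ^ 2 + C, by rintro _ ⟨u, rfl⟩; exact h z v u⟩

lemma le_conj (hj : DualIntegrand j μ α β) (z : ℝ × ℝ) (v u : ℝ) :
    v * u - prim j z u ≤ conj j z v := le_ciSup (hj.bddAbove z v) u

lemma conj_nonneg (hj : DualIntegrand j μ α β) (z : ℝ × ℝ) (v : ℝ) : 0 ≤ conj j z v := by
  simpa [prim_zero] using hj.le_conj z v 0

lemma exists_conj_le (hj : DualIntegrand j μ α β) :
    ∃ D C : ℝ, 0 ≤ D ∧ 0 ≤ C ∧ ∀ z v, conj j z v ≤ D * v ^ 2 + C := by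
  obtain ⟨D, C, hD, hC, h⟩ := hj.exists_le
  exact ⟨D, C, hD, hC, fun z v => ciSup_le fun u => h z v u⟩

/-- Slopes of `J'` at most `1/μ` make `J*` strongly convex with constant `μ`. The suprema at `v` and
`w` are tested at `u + h` and `u - h`; the cost is at most `h²/μ` and the gain is `h(v - w)`, which
is best for `h = μ(v - w)/2`. -/
lemma conj_mid (hj : DualIntegrand j μ α β) (z : ℝ × ℝ) (v w : ℝ) :
    conj j z ((v + w) / 2) ≤ (conj j z v + conj j z w) / 2 - μ / 8 * (v - w) ^ 2 := by
  have hμ := hj.mu_pos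
  refine ciSup_le fun u => ?_
  set h := μ * (v - w) / 2 with hh
  have hG : ∀ x, HasDerivAt (fun x => x ^ 2 / (2 * μ) - prim j z x) (x / μ - j z x) x := fun x => by
    have := ((hasDerivAt_pow 2 x).div_const (2 * μ)).sub (hj.hasDerivAt z x)
    refine this.congr_deriv ?_
    simp only [Nat.cast_ofNat, Nat.add_one_sub_one, pow_one]
    field_simp
  have hg : Monotone fun x => x / μ - j z x := fun x y hxy => by
    have := hj.anti z hxy
    simp only at this ⊢
    linarith
  have h1 := mul_sub_le_sub_of_monotone hG hg u (u + h)
  have h2 := mul_sub_le_sub_of_monotone hG hg u (u - h)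
  have h3 := hj.le_conj z v (u + h)
  have h4 := hj.le_conj z w (u - h)
  have e1 : (u + h) ^ 2 / (2 * μ) + (u - h) ^ 2 / (2 * μ) - 2 * (u ^ 2 / (2 * μ)) = h ^ 2 / μ := by
    field_simp; ring
  have e2 : h ^ 2 / μ = μ / 4 * (v - w) ^ 2 := by
    rw [hh]; field_simp; ring
  have e3 : v * (u + h) + w * (u - h) = (v + w) * u + μ / 2 * (v - w) ^ 2 := by
    rw [hh]; ring
  linarith

lemma conj_convex (hj : DualIntegrand j μ α β) (z : ℝ × ℝ) (v w : ℝ) {s t : ℝ} (hs : 0 ≤ s)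
    (ht : 0 ≤ t) (hst : s + t = 1) :
    conj j z (s * v + t * w) ≤ s * conj j z v + t * conj j z w := by
  refine ciSup_le fun u => ?_
  have h1 := mul_le_mul_of_nonneg_left (hj.le_conj z v u) hs
  have h2 := mul_le_mul_of_nonneg_left (hj.le_conj z w u) ht
  have h3 : prim j z u = s * prim j z u + t * prim j z u := by rw [← add_mul, hst, one_mul]
  linarith

/-- `J ≤ ½ jumpSq (α + ε) (β + ε) + C`, and conjugation reverses the inequality. The supremum is
tested at the maximizer for that quadratic, `v/(α + ε)` or `v/(β + ε)` according to the sign of `v`.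
-/
lemma exists_le_conj (hj : DualIntegrand j μ α β) {ε : ℝ} (hε : 0 < ε) :
    ∃ C, 0 ≤ C ∧ ∀ z v, 1 / 2 * jumpSq (1 / (α + ε)) (1 / (β + ε)) v - C ≤ conj j z v := by
  obtain ⟨C, hC, h⟩ := hj.asymp (ε / 2) (by positivity)
  refine ⟨C, hC, fun z v => ?_⟩
  have hα : 0 < α + ε := add_pos hj.alpha_pos hε
  have hβ : 0 < β + ε := add_pos hj.beta_pos hε
  rcases le_total 0 v with hv | hv
  · have h0 : 0 ≤ v / (α + ε) := by positivity
    have h1 := hj.le_conj z v (v / (α + ε))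
    have h2 := (abs_le.1 (h z (v / (α + ε)))).2
    rw [jumpSq_of_nonneg _ _ h0] at h2
    rw [jumpSq_of_nonneg _ _ hv]
    have e : v * (v / (α + ε)) - 1 / 2 * (α * (v / (α + ε)) ^ 2) - ε / 2 * (v / (α + ε)) ^ 2 =
        1 / 2 * (1 / (α + ε) * v ^ 2) := by field_simp; ring
    linarith
  · have h0 : v / (β + ε) ≤ 0 := div_nonpos_of_nonpos_of_nonneg hv hβ.le
    have h1 := hj.le_conj z v (v / (β + ε))
    have h2 := (abs_le.1 (h z (v / (β + ε)))).2
    rw [jumpSq_of_nonpos _ _ h0] at h2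
    rw [jumpSq_of_nonpos _ _ hv]
    have e : v * (v / (β + ε)) - 1 / 2 * (β * (v / (β + ε)) ^ 2) - ε / 2 * (v / (β + ε)) ^ 2 =
        1 / 2 * (1 / (β + ε) * v ^ 2) := by field_simp; ring
    linarith

lemma conj_apply (hj : DualIntegrand j μ α β) (z : ℝ × ℝ) (u : ℝ) :
    conj j z (j z u) = j z u * u - prim j z u := by
  refine le_antisymm (ciSup_le fun x => ?_) (hj.le_conj z _ u)
  have := mul_sub_le_sub_of_monotone (hj.hasDerivAt z) (hj.mono z) u x
  linarith

/-- Equality in Fenchel–Young makes `u` a maximum of the differentiable function `x ↦ vx - J(x)`.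
Differentiability of `J*` plays no role. -/
lemma eq_of_conj_eq (hj : DualIntegrand j μ α β) {z : ℝ × ℝ} {u v : ℝ}
    (h : conj j z v = v * u - prim j z u) : v = j z u := by
  have hmax : IsLocalMax (fun x => v * x - prim j z x) u := Filter.Eventually.of_forall fun x => by
    simp only [← h]
    exact hj.le_conj z v x
  have := hmax.hasDerivAt_eq_zero (((hasDerivAt_id u).const_mul v).sub (hj.hasDerivAt z u))
  linarith

/-- By continuity in `u` the supremum may be taken over the rationals, hence over countably many
continuous functions of `(s, t, v)`. -/
lemma measurable_conj (hj : DualIntegrand j μ α β) :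
    Measurable fun x : (ℝ × ℝ) × ℝ => conj j x.1 x.2 := by
  have h : (fun x : (ℝ × ℝ) × ℝ => conj j x.1 x.2) =
      fun x => ⨆ q : ℚ, (x.2 * (q : ℝ) - prim j x.1 (q : ℝ)) := by
    funext x
    have hb : BddAbove (range fun q : ℚ => x.2 * (q : ℝ) - prim j x.1 (q : ℝ)) :=
      (hj.bddAbove x.1 x.2).mono (by rintro _ ⟨q, rfl⟩; exact ⟨q, rfl⟩)
    refine le_antisymm (ciSup_le fun u => ?_) (ciSup_le fun q => hj.le_conj _ _ _)
    refine Rat.denseRange_cast.induction_on (p := fun u : ℝ => x.2 * u - prim j x.1 u ≤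
      ⨆ q : ℚ, (x.2 * (q : ℝ) - prim j x.1 (q : ℝ))) u ?_ fun q => le_ciSup hb q
    exact isClosed_le ((continuous_const.mul continuous_id).sub (hj.continuous_prim_right x.1))
      continuous_const
  rw [h]
  refine Measurable.iSup fun q => Continuous.measurable ?_
  exact (continuous_snd.mul continuous_const).sub (hj.lip.continuous_prim.comp
    (by fun_prop : Continuous fun x : (ℝ × ℝ) × ℝ => (x.1, (q : ℝ))))

lemma integrable_conj (hj : DualIntegrand j μ α β) (v : HSpace) :
    Integrable (fun z => conj j z (v z)) cyl := by
  obtain ⟨D, C, -, -, h⟩ := hj.exists_conj_le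
  refine (((integrable_sq v).const_mul D).add (integrable_const C)).mono' ?_ ?_
  · exact (hj.measurable_conj.comp_aemeasurable
      (aemeasurable_id.prodMk (Lp.aestronglyMeasurable v).aemeasurable)).aestronglyMeasurable
  · refine Filter.Eventually.of_forall fun z => ?_
    rw [Real.norm_of_nonneg (hj.conj_nonneg _ _)]
    exact h z (v z)

end DualIntegrand

/-- `v ↦ ∬ J*(s,t,v)`. -/
noncomputable def conjInt (j : ℝ × ℝ → ℝ → ℝ) (v : HSpace) : ℝ := ∫ z, conj j z (v z) ∂cyl

namespace DualIntegrand

lemma convexOn_conjInt (hj : DualIntegrand j μ α β) : ConvexOn ℝ univ (conjInt j) := by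
  refine ⟨convex_univ, fun v _ w _ s t hs ht hst => ?_⟩
  rw [conjInt, conjInt, conjInt, smul_eq_mul, smul_eq_mul, ← integral_const_mul,
    ← integral_const_mul, ← integral_add ((hj.integrable_conj v).const_mul s)
      ((hj.integrable_conj w).const_mul t)]
  refine integral_mono_ae (hj.integrable_conj _)
    (((hj.integrable_conj v).const_mul s).add ((hj.integrable_conj w).const_mul t)) ?_
  filter_upwards [Lp.coeFn_add (s • v) (t • w), Lp.coeFn_smul s v, Lp.coeFn_smul t w]
    with z h1 h2 h3
  simp only [h1, Pi.add_apply, h2, h3, Pi.smul_apply, smul_eq_mul]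
  exact hj.conj_convex z _ _ hs ht hst

/-- A finite convex function on a normed space is continuous once it is bounded above near one
point; the quadratic upper bound on `J*` gives this near `0`. -/
lemma continuous_conjInt (hj : DualIntegrand j μ α β) : Continuous (conjInt j) := by
  rw [← continuousOn_univ]
  have htfae := (hj.convexOn_conjInt.continuousOn_tfae isOpen_univ univ_nonempty).out 3 1
  refine htfae.1 ⟨0, mem_univ _, ?_⟩
  obtain ⟨D, C, hD, hC, h⟩ := hj.exists_conj_le
  have hball : ∀ᶠ v : HSpace in nhds 0, ‖v‖ < 1 := by
    filter_upwards [Metric.ball_mem_nhds (0 : HSpace) one_pos] with v hv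
    simpa using hv
  refine ⟨D * 1 + ∫ _, C ∂cyl, Filter.eventually_map.2 (hball.mono fun v hv => ?_)⟩
  have h1 : conjInt j v ≤ D * ‖v‖ ^ 2 + ∫ _, C ∂cyl := by
    rw [conjInt, norm_sq_eq_integral, ← integral_const_mul,
      ← integral_add ((integrable_sq v).const_mul D) (integrable_const C)]
    exact integral_mono (hj.integrable_conj v)
      (((integrable_sq v).const_mul D).add (integrable_const C)) fun z => h z (v z)
  have h2 : ‖v‖ ^ 2 ≤ 1 := pow_le_one₀ (norm_nonneg _) hv.le
  linarith [mul_le_mul_of_nonneg_left h2 hD]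

lemma conjInt_mid (hj : DualIntegrand j μ α β) (v w : HSpace) :
    conjInt j ((1 / 2 : ℝ) • (v + w)) ≤
      (conjInt j v + conjInt j w) / 2 - μ / 8 * ‖v - w‖ ^ 2 := by
  have h0 : Integrable (fun z => (conj j z (v z) + conj j z (w z)) / 2) cyl :=
    ((hj.integrable_conj v).add (hj.integrable_conj w)).div_const 2
  have h1 := (integrable_sq (v - w)).const_mul (μ / 8)
  have e : (conjInt j v + conjInt j w) / 2 - μ / 8 * ‖v - w‖ ^ 2 =
      ∫ z, ((conj j z (v z) + conj j z (w z)) / 2 - μ / 8 * (v - w : HSpace) z ^ 2) ∂cyl := by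
    rw [integral_sub h0 h1, integral_const_mul, ← norm_sq_eq_integral, integral_div,
      integral_add (hj.integrable_conj v) (hj.integrable_conj w)]
    rfl
  rw [e]
  refine integral_mono_ae (hj.integrable_conj _) (h0.sub h1) ?_
  filter_upwards [coeFn_half_smul_add v w, Lp.coeFn_sub v w] with z h2 h3
  simp only [h2, h3, Pi.sub_apply]
  exact hj.conj_mid z _ _

lemma exists_le_conjInt (hj : DualIntegrand j μ α β) {ε : ℝ} (hε : 0 < ε) :
    ∃ C, ∀ v : HSpace, 1 / 2 * jumpForm (1 / (α + ε)) (1 / (β + ε)) v - C ≤ conjInt j v := by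
  obtain ⟨C, -, h⟩ := hj.exists_le_conj hε
  refine ⟨∫ _, C ∂cyl, fun v => ?_⟩
  have h1 := (integrable_jumpSq (1 / (α + ε)) (1 / (β + ε)) v).const_mul (1 / 2)
  rw [jumpForm_eq_integral, ← integral_const_mul, ← integral_sub h1 (integrable_const C)]
  exact integral_mono (h1.sub (integrable_const C)) (hj.integrable_conj v) fun z => h z (v z)

end DualIntegrand

/-! ### The dual functional -/

section Dual

variable {k : ℤ} {ε₁ ε₂ : ℝ} {x : ℝ × ℝ}

/-- The dual functional `½⟨Lv, v⟩ - ∬ J*(s,t,v)`. -/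
noncomputable def dualFun (h : Admissible k ε₁ ε₂) (j : ℝ × ℝ → ℝ → ℝ) (v : HSpace) : ℝ :=
  1 / 2 * inner ℝ (h.inGap.clm v) v - conjInt j v

/-- A strict inequality leaves room for the error `ε` in the asymptotics of `J`. -/
lemma exists_perturb {α A : ℝ} (hα : 0 < α) {κ : ℝ} (hA : A < 1 / α - κ) :
    ∃ δ > 0, ∀ ε, 0 < ε → ε ≤ δ → A + κ ≤ 1 / (α + ε) := by
  have hc : ContinuousAt (fun ε : ℝ => 1 / (α + ε)) 0 :=
    continuousAt_const.div (continuousAt_const.add continuousAt_id) (by simpa using hα.ne')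
  have h1 : ∀ᶠ ε in nhds (0 : ℝ), A + κ < 1 / (α + ε) := by
    refine hc.eventually (lt_mem_nhds ?_)
    simp only [add_zero]
    linarith
  obtain ⟨δ, hδ, h⟩ := Metric.eventually_nhds_iff.1 h1
  refine ⟨δ / 2, by positivity, fun ε h0 h2 => (h ?_).le⟩
  rw [Real.dist_eq, sub_zero, abs_of_pos h0]
  linarith

/-- The slack `1 - θ` is shared: passing from `θ` to `θ' = (1 + θ)/2` gives the coercivity, and the
rest, from `θ'` to `1`, absorbs the subquadratic perturbation of `J*`. -/
lemma dualFun_coercive (h : Admissible k ε₁ ε₂) (hx : x ∈ Qk k ε₁ ε₂)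
    (h0 : 0 < curveFun k ε₁ ε₂ x)
    (hj : DualIntegrand j (mu k ε₁ ε₂) (x.1 - pk k ε₁) (x.2 - pk k ε₁)) :
    ∃ δ C : ℝ, 0 < δ ∧ ∀ v, dualFun h j v ≤ C - δ * ‖v‖ ^ 2 := by
  obtain ⟨θ, hθ0, hθ1, hθ⟩ := h.exists_funF_le_jumpForm hx h0
  have hA := h.coordA_pos hx.1
  have hB := h.coordA_pos hx.2
  set A := coordA k ε₁ ε₂ x.1 with hAdef
  set B := coordA k ε₁ ε₂ x.2 with hBdef
  set θ' := (1 + θ) / 2 with hθ'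
  obtain ⟨e1, he1, h1⟩ := exists_perturb hj.alpha_pos (A := θ' * A) (κ := mu k ε₁ ε₂) (by
    change _ < A; nlinarith)
  obtain ⟨e2, he2, h2⟩ := exists_perturb hj.beta_pos (A := θ' * B) (κ := mu k ε₁ ε₂) (by
    change _ < B; nlinarith)
  have hε : 0 < min e1 e2 := lt_min he1 he2
  obtain ⟨C, hC⟩ := hj.exists_le_conjInt hε
  refine ⟨1 / 2 * ((θ' - θ) * min A B), C, ?_, fun v => ?_⟩
  · have : 0 < min A B := lt_min hA hB
    have : 0 < θ' - θ := by rw [hθ']; linarith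
    positivity
  have h3 := hC v
  have h4 := jumpForm_mono (h1 _ hε (min_le_left _ _)) (h2 _ hε (min_le_right _ _)) v
  have h5 : jumpForm (θ' * A + mu k ε₁ ε₂) (θ' * B + mu k ε₁ ε₂) v =
      θ' * jumpForm A B v + mu k ε₁ ε₂ * ‖v‖ ^ 2 := by
    rw [← jumpForm_self, jumpForm, jumpForm, jumpForm]; ring
  have h6 := hθ v
  rw [h.funF_eq] at h6
  have h7 := le_jumpForm A B v
  have h8 : 0 ≤ θ' - θ := by rw [hθ']; linarith
  have h9 := mul_le_mul_of_nonneg_left h7 h8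
  rw [dualFun]
  linarith

/-- The dual functional has an absolute maximum below the curve. -/
lemma exists_max_dualFun (h : Admissible k ε₁ ε₂) (hx : x ∈ Qk k ε₁ ε₂)
    (h0 : 0 < curveFun k ε₁ ε₂ x)
    (hj : DualIntegrand j (mu k ε₁ ε₂) (x.1 - pk k ε₁) (x.2 - pk k ε₁)) :
    ∃ v₀, ∀ v, dualFun h j v ≤ dualFun h j v₀ := by
  obtain ⟨δ, C, hδ, hcoer⟩ := dualFun_coercive h hx h0 hj
  have hcont : Continuous (dualFun h j) := by
    have := hj.continuous_conjInt
    unfold dualFun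
    fun_prop
  have hbdd : BddAbove (range (dualFun h j)) :=
    ⟨C, by rintro _ ⟨v, rfl⟩; nlinarith [hcoer v, sq_nonneg ‖v‖]⟩
  set M := ⨆ v, dualFun h j v with hM
  have hle : ∀ v, dualFun h j v ≤ M := le_ciSup hbdd
  obtain ⟨S, D, hD, hS⟩ := h.exists_funF_le
  -- The strong convexity of `J*` supplies exactly the `μ` in `F`: the concavity gain at the
  -- midpoint is at least `-F(v - w)/8`.
  have hmid : ∀ v w : HSpace, (dualFun h j v + dualFun h j w) / 2 + ε₂ / 16 * ‖v - w‖ ^ 2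
      - D / 8 * ∑ i ∈ S, inner ℝ (eigVec i) (v - w) ^ 2 ≤
        dualFun h j ((1 / 2 : ℝ) • (v + w)) := by
    intro v w
    have h1 := h.inGap.inner_clm_mid v w
    have h2 := hj.conjInt_mid v w
    have h3 := hS (v - w)
    rw [h.funF_eq] at h3
    rw [dualFun, dualFun, dualFun, h1]
    linarith
  have hseq : ∀ n : ℕ, ∃ v, M - 1 / ((n : ℝ) + 1) < dualFun h j v := fun n =>
    exists_lt_of_lt_ciSup (sub_lt_self M (by positivity))
  choose v hv using hseq
  have hlim : Filter.Tendsto (fun n => dualFun h j (v n)) Filter.atTop (nhds M) := by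
    refine tendsto_of_tendsto_of_tendsto_of_le_of_le ?_ tendsto_const_nhds (fun n => (hv n).le)
      fun n => hle _
    simpa using tendsto_one_div_add_atTop_nhds_zero_nat.const_sub M
  have hR : ∀ n, ‖v n‖ ≤ Real.sqrt ((C - M + 1) / δ) := fun n => by
    refine Real.le_sqrt_of_sq_le ?_
    rw [le_div_iff₀ hδ]
    have h1 := hcoer (v n)
    have h2 := hv n
    have h3 : 1 / ((n : ℝ) + 1) ≤ 1 := by
      rw [div_le_one (by positivity)]
      linarith [(Nat.cast_nonneg n : (0 : ℝ) ≤ n)]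
    linarith
  obtain ⟨v₀, hv₀, -⟩ := exists_tendsto_of_maximizing hcont
    (by linarith [h.2.2.1] : 0 < ε₂ / 16) (by linarith : 0 ≤ D / 8) eigVec S hle hmid v hR hlim
  exact ⟨v₀, fun w => hv₀ ▸ hle w⟩

/-- The Euler equation `v₀ = j(·, Lv₀)` at a maximum of the dual functional. -/
lemma dualFun_euler (h : Admissible k ε₁ ε₂) (hj : DualIntegrand j μ α β) {v₀ : HSpace}
    (hmax : ∀ v, dualFun h j v ≤ dualFun h j v₀) :
    (v₀ : ℝ × ℝ → ℝ) =ᵐ[cyl] fun z => j z (h.inGap.clm v₀ z) := by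
  set u₀ : HSpace := h.inGap.clm v₀ with hu₀
  set v₁ : HSpace := hj.lip.nem u₀ with hv₁
  -- One-sided variation towards `v₁ = j(·, u₀)`: convexity bounds `conjInt` along the segment, and
  -- division by `t` followed by `t → 0⁺` removes the quadratic term.
  have key : inner ℝ u₀ (v₁ - v₀) ≤ conjInt j v₁ - conjInt j v₀ := by
    have hlim : Filter.Tendsto (fun t : ℝ => inner ℝ u₀ (v₁ - v₀) +
        t * (1 / 2 * inner ℝ (h.inGap.clm (v₁ - v₀)) (v₁ - v₀))) (nhdsWithin 0 (Ioi 0))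
        (nhds (inner ℝ u₀ (v₁ - v₀))) := by
      have hc : Continuous fun t : ℝ => inner ℝ u₀ (v₁ - v₀) +
        t * (1 / 2 * inner ℝ (h.inGap.clm (v₁ - v₀)) (v₁ - v₀)) := by fun_prop
      simpa using (hc.tendsto 0).mono_left (nhdsWithin_le_nhds (s := Ioi 0))
    refine le_of_tendsto hlim ?_
    filter_upwards [Ioo_mem_nhdsGT (zero_lt_one' ℝ)] with t ht
    have h1 := hmax (v₀ + t • (v₁ - v₀))
    have h2 := hj.convexOn_conjInt.2 (mem_univ v₀) (mem_univ v₁) (sub_nonneg.2 ht.2.le) ht.1.le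
      (by ring : (1 - t) + t = 1)
    rw [show (1 - t) • v₀ + t • v₁ = v₀ + t • (v₁ - v₀) by module] at h2
    have h3 : inner ℝ (h.inGap.clm (v₁ - v₀)) v₀ = inner ℝ u₀ (v₁ - v₀) := by
      rw [h.inGap.clm_symm, real_inner_comm]
    have h4 : inner ℝ (h.inGap.clm (v₀ + t • (v₁ - v₀))) (v₀ + t • (v₁ - v₀)) =
        inner ℝ u₀ v₀ + 2 * t * inner ℝ u₀ (v₁ - v₀) +
          t ^ 2 * inner ℝ (h.inGap.clm (v₁ - v₀)) (v₁ - v₀) := by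
      rw [map_add, map_smul, inner_add_left, inner_add_right, inner_add_right,
        real_inner_smul_left, real_inner_smul_left, real_inner_smul_right, real_inner_smul_right,
        h3]
      ring
    rw [dualFun, dualFun, h4] at h1
    simp only [smul_eq_mul] at h2
    refine le_of_mul_le_mul_left ?_ ht.1
    nlinarith
  have hI1 := hj.integrable_conj v₀
  have hI2 := integrable_mul_lp u₀ v₀
  have hI3 := hj.lip.integrable_prim u₀
  have hv₁z := hj.lip.coeFn_nem u₀
  have hv₁int : conjInt j v₁ = inner ℝ u₀ v₁ - ∫ z, prim j z (u₀ z) ∂cyl := by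
    rw [conjInt, inner_eq_integral, ← integral_sub (integrable_mul_lp v₁ u₀) hI3]
    refine integral_congr_ae ?_
    filter_upwards [hv₁z] with z hz
    rw [hv₁, hz]
    exact hj.conj_apply z (u₀ z)
  -- The Fenchel–Young defect is nonnegative, while `key` and the explicit value of `J*` at `v₁`
  -- make its integral at most zero; so it vanishes almost everywhere.
  have hnn : ∀ z, 0 ≤ conj j z (v₀ z) - u₀ z * v₀ z + prim j z (u₀ z) := fun z => by
    have := hj.le_conj z (v₀ z) (u₀ z)
    linarith
  have hint : Integrable (fun z => conj j z (v₀ z) - u₀ z * v₀ z + prim j z (u₀ z)) cyl :=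
    (hI1.sub hI2).add hI3
  have hzero : ∫ z, (conj j z (v₀ z) - u₀ z * v₀ z + prim j z (u₀ z)) ∂cyl = 0 := by
    refine le_antisymm ?_ (integral_nonneg hnn)
    have h5 : Integrable (fun z => conj j z (v₀ z) - u₀ z * v₀ z) cyl := hI1.sub hI2
    rw [integral_add h5 hI3, integral_sub hI1 hI2]
    have e1 : ∫ z, u₀ z * v₀ z ∂cyl = inner ℝ u₀ v₀ := by
      rw [inner_eq_integral]
      simp_rw [mul_comm]
    rw [e1]
    rw [inner_sub_right, hv₁int] at key
    rw [conjInt] at key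
    linarith
  have hae := (integral_eq_zero_iff_of_nonneg hnn hint).1 hzero
  filter_upwards [hae] with z hz
  refine hj.eq_of_conj_eq ?_
  simp only [Pi.zero_apply] at hz
  linarith

end Dual

/-! ### Integration by parts on the cylinder -/

lemma integrable_of_continuous {h : ℝ × ℝ → ℝ} (hh : Continuous h) : Integrable h cyl :=
  (memLp_of_continuous hh).integrable one_le_two

lemma integral_fderiv_space {F : ℝ × ℝ → ℝ} (hF : ContDiff ℝ 1 F)
    (hb : ∀ t, F (Real.pi, t) = F (0, t)) : ∫ z, fderiv ℝ F z (1, 0) ∂cyl = 0 := by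
  have hc : Continuous fun z => fderiv ℝ F z (1, 0) :=
    (hF.continuous_fderiv one_ne_zero).clm_apply continuous_const
  have hint := integrable_of_continuous hc
  rw [cyl, Measure.volume_eq_prod, ← Measure.prod_restrict] at hint ⊢
  rw [integral_prod_symm _ hint]
  refine integral_eq_zero_of_ae (Filter.Eventually.of_forall fun t => ?_)
  simp only [Pi.zero_apply]
  have hct : Continuous fun s => fderiv ℝ F (s, t) (1, 0) :=
    hc.comp (by fun_prop : Continuous fun s : ℝ => (s, t))
  rw [integral_Icc_eq_integral_Ioc, ← intervalIntegral.integral_of_le Real.pi_pos.le,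
    intervalIntegral.integral_eq_sub_of_hasDerivAt (f := fun s => F (s, t))
      (fun s _ => ?_) (hct.intervalIntegrable _ _), hb, sub_self]
  exact (hF.differentiable one_ne_zero (s, t)).hasFDerivAt.comp_hasDerivAt s
    ((hasDerivAt_id s).prodMk (hasDerivAt_const s t))

lemma integral_fderiv_time {F : ℝ × ℝ → ℝ} (hF : ContDiff ℝ 1 F)
    (hb : ∀ s, F (s, 2 * Real.pi) = F (s, 0)) : ∫ z, fderiv ℝ F z (0, 1) ∂cyl = 0 := by
  have hc : Continuous fun z => fderiv ℝ F z (0, 1) :=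
    (hF.continuous_fderiv one_ne_zero).clm_apply continuous_const
  have hint := integrable_of_continuous hc
  rw [cyl, Measure.volume_eq_prod, ← Measure.prod_restrict] at hint ⊢
  rw [integral_prod _ hint]
  refine integral_eq_zero_of_ae (Filter.Eventually.of_forall fun s => ?_)
  simp only [Pi.zero_apply]
  have hct : Continuous fun t => fderiv ℝ F (s, t) (0, 1) :=
    hc.comp (by fun_prop : Continuous fun t : ℝ => (s, t))
  rw [integral_Icc_eq_integral_Ioc, ← intervalIntegral.integral_of_le Real.two_pi_pos.le,
    intervalIntegral.integral_eq_sub_of_hasDerivAt (f := fun t => F (s, t))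
      (fun t _ => ?_) (hct.intervalIntegrable _ _), hb, sub_self]
  exact (hF.differentiable one_ne_zero (s, t)).hasFDerivAt.comp_hasDerivAt t
    ((hasDerivAt_const t s).prodMk (hasDerivAt_id t))

lemma contDiff_trig (σ : Bool) : ContDiff ℝ (⊤ : ℕ∞) (trig σ) := by
  cases σ
  · exact Real.contDiff_cos
  · exact Real.contDiff_sin

lemma hasDerivAt_trig (σ : Bool) (x : ℝ) : HasDerivAt (trig σ) (-trigSign σ * trig (!σ) x) x := by
  cases σ
  · refine (Real.hasDerivAt_cos x).congr_deriv ?_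
    simp [trig, trigSign]
  · refine (Real.hasDerivAt_sin x).congr_deriv ?_
    simp [trig, trigSign]

lemma trig_periodic (τ : Bool) (n : ℕ) (t : ℝ) :
    trig τ (n * (t + 2 * Real.pi)) = trig τ (n * t) := by
  rw [mul_add]
  cases τ
  · exact Real.cos_add_nat_mul_two_pi _ _
  · exact Real.sin_add_nat_mul_two_pi _ _

lemma contDiff_waveFun (m n : ℕ) (σ τ : Bool) : ContDiff ℝ (⊤ : ℕ∞) (waveFun m n σ τ) := by
  have h1 := (contDiff_trig σ).comp ((contDiff_const (c := (m : ℝ))).mul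
    (contDiff_fst (𝕜 := ℝ) (E := ℝ) (F := ℝ)))
  have h2 := (contDiff_trig τ).comp ((contDiff_const (c := (n : ℝ))).mul
    (contDiff_snd (𝕜 := ℝ) (E := ℝ) (F := ℝ)))
  exact contDiff_const.mul (h1.mul h2)

lemma isTest_waveFun (m n : ℕ) (σ τ : Bool) : IsTest (waveFun m n σ τ) := by
  refine ⟨contDiff_waveFun m n σ τ, fun s t => ?_⟩
  simp only [waveFun, trig_periodic]

lemma fderiv_waveFun_space (m n : ℕ) (σ τ : Bool) (z : ℝ × ℝ) :
    fderiv ℝ (waveFun m n σ τ) z (1, 0) = -trigSign σ * m * waveFun m n (!σ) τ z := by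
  have hd := ((contDiff_waveFun m n σ τ).differentiable (by simp) z).hasFDerivAt
  have h1 := hd.comp_hasDerivAt z.1 ((hasDerivAt_id z.1).prodMk (hasDerivAt_const z.1 z.2))
  have h2 : HasDerivAt (fun s => waveFun m n σ τ (s, z.2))
      (Real.sqrt 2 / Real.pi * (-trigSign σ * trig (!σ) (m * z.1) * m * trig τ (n * z.2))) z.1 := by
    have := (hasDerivAt_trig σ (m * z.1)).comp z.1 ((hasDerivAt_id z.1).const_mul (m : ℝ))
    have h3 := (this.mul_const (trig τ (n * z.2))).const_mul (Real.sqrt 2 / Real.pi)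
    rw [mul_one] at h3
    exact h3
  rw [h1.unique h2, waveFun]
  ring

lemma fderiv_waveFun_time (m n : ℕ) (σ τ : Bool) (z : ℝ × ℝ) :
    fderiv ℝ (waveFun m n σ τ) z (0, 1) = -trigSign τ * n * waveFun m n σ (!τ) z := by
  have hd := ((contDiff_waveFun m n σ τ).differentiable (by simp) z).hasFDerivAt
  have h1 := hd.comp_hasDerivAt z.2 ((hasDerivAt_const z.2 z.1).prodMk (hasDerivAt_id z.2))
  have h2 : HasDerivAt (fun t => waveFun m n σ τ (z.1, t))
      (Real.sqrt 2 / Real.pi * (trig σ (m * z.1) * (-trigSign τ * trig (!τ) (n * z.2) * n))) z.2 := by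
    have := (hasDerivAt_trig τ (n * z.2)).comp z.2 ((hasDerivAt_id z.2).const_mul (n : ℝ))
    have h3 := (this.const_mul (trig σ (m * z.1))).const_mul (Real.sqrt 2 / Real.pi)
    rw [mul_one] at h3
    exact h3
  rw [h1.unique h2, waveFun]
  ring

lemma integral_wave_mul (m n : ℕ) (σ τ : Bool) (h : ℝ × ℝ → ℝ) :
    ∫ z, wave m n σ τ z * h z ∂cyl = ∫ z, waveFun m n σ τ z * h z ∂cyl := by
  refine integral_congr_ae ?_
  filter_upwards [(memLp_of_continuous (continuous_waveFun m n σ τ)).coeFn_toLp] with z hz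
  rw [wave, hz]

lemma fderiv_mul_apply {F g : ℝ × ℝ → ℝ} {z : ℝ × ℝ} (hF : DifferentiableAt ℝ F z)
    (hg : DifferentiableAt ℝ g z) (e : ℝ × ℝ) :
    fderiv ℝ (fun z => F z * g z) z e = F z * fderiv ℝ g z e + fderiv ℝ F z e * g z := by
  rw [fderiv_fun_mul hF hg]
  simp
  ring

/-- The boundary term vanishes because `sin(ms)` does at `0` and `π`, whatever the values of `g`
there. -/
lemma hasWeakDeriv_wave_space (m n : ℕ) (τ : Bool) :
    HasWeakDeriv (1, 0) (wave m n true τ) ((m : ℝ) • wave m n false τ) := by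
  intro g hg
  have hgd := hg.1.differentiable (by simp)
  have hwd := (contDiff_waveFun m n true τ).differentiable (by simp)
  have hw := continuous_waveFun m n true τ
  have hw' := continuous_waveFun m n false τ
  have h0 := integral_fderiv_space (F := fun z => waveFun m n true τ z * g z)
    (((contDiff_waveFun m n true τ).mul hg.1).of_le (by exact_mod_cast le_top)) fun t => by
      simp [waveFun, trig]
  have h1 : ∀ z, fderiv ℝ (fun z => waveFun m n true τ z * g z) z (1, 0) =
      waveFun m n true τ z * fderiv ℝ g z (1, 0) + m * (waveFun m n false τ z * g z) := fun z => by
    rw [fderiv_mul_apply (hwd z) (hgd z), fderiv_waveFun_space]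
    simp [trigSign]
    ring
  simp_rw [h1] at h0
  have i1 : Integrable (fun z => waveFun m n true τ z * fderiv ℝ g z (1, 0)) cyl :=
    integrable_of_continuous (hw.mul (hg.continuous_fderiv_apply _))
  have i2 : Integrable (fun z => waveFun m n false τ z * g z) cyl :=
    integrable_of_continuous (hw'.mul hg.1.continuous)
  rw [integral_add i1 (i2.const_mul _), integral_const_mul] at h0
  rw [integral_smul_mul, integral_wave_mul, integral_wave_mul]
  linarith

lemma hasWeakDeriv_wave_time (m n : ℕ) (τ : Bool) :
    HasWeakDeriv (0, 1) (wave m n true τ) ((n * -trigSign τ : ℝ) • wave m n true (!τ)) := by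
  intro g hg
  have hgd := hg.1.differentiable (by simp)
  have hwd := (contDiff_waveFun m n true τ).differentiable (by simp)
  have hw := continuous_waveFun m n true τ
  have hw' := continuous_waveFun m n true (!τ)
  have h0 := integral_fderiv_time (F := fun z => waveFun m n true τ z * g z)
    (((contDiff_waveFun m n true τ).mul hg.1).of_le (by exact_mod_cast le_top)) fun s => by
      have h1 := (isTest_waveFun m n true τ).2 s 0
      have h2 := hg.2 s 0
      rw [zero_add] at h1 h2
      simp only [h1, h2]
  have h1 : ∀ z, fderiv ℝ (fun z => waveFun m n true τ z * g z) z (0, 1) =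
      waveFun m n true τ z * fderiv ℝ g z (0, 1) +
        (n * -trigSign τ) * (waveFun m n true (!τ) z * g z) := fun z => by
    rw [fderiv_mul_apply (hwd z) (hgd z), fderiv_waveFun_time]
    ring
  simp_rw [h1] at h0
  have i1 : Integrable (fun z => waveFun m n true τ z * fderiv ℝ g z (0, 1)) cyl :=
    integrable_of_continuous (hw.mul (hg.continuous_fderiv_apply _))
  have i2 : Integrable (fun z => waveFun m n true (!τ) z * g z) cyl :=
    integrable_of_continuous (hw'.mul hg.1.continuous)
  rw [integral_add i1 (i2.const_mul _), integral_const_mul] at h0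
  rw [integral_smul_mul, integral_wave_mul, integral_wave_mul]
  linarith

lemma hasWeakDeriv_eigVec_space (i : Idx) :
    HasWeakDeriv (1, 0) (eigVec i) (((i.1.1 : ℕ) : ℝ) • sVec i) := by
  have h := (hasWeakDeriv_wave_space i.1.1 i.1.2 i.2).smul ‖rawVec i‖⁻¹
  rwa [smul_comm] at h

lemma hasWeakDeriv_eigVec_time (i : Idx) :
    HasWeakDeriv (0, 1) (eigVec i) ((i.1.2 : ℝ) • tVec i) := by
  have h := (hasWeakDeriv_wave_time i.1.1 i.1.2 i.2).smul ‖rawVec i‖⁻¹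
  rw [smul_smul] at h
  rw [tVec, smul_smul, mul_left_comm]
  exact h

lemma hasSum_of_eq {ι : Type*} {f g : ι → ℝ} {a : ℝ} (h : ∀ i, f i = g i) (hg : HasSum g a) :
    HasSum f a := by
  rwa [funext h]

/-- Each test identity pairs both sides with fixed `L²` functions, so it passes to convergent sums.
-/
lemma hasWeakDeriv_of_hasSum {ι : Type*} {e : ℝ × ℝ} {f g : ι → HSpace} {x y : HSpace}
    (hf : HasSum f x) (hg : HasSum g y) (h : ∀ i, HasWeakDeriv e (f i) (g i)) :
    HasWeakDeriv e x y := by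
  intro φ hφ
  rw [← inner_toLp_left (hφ.continuous_fderiv_apply e), ← inner_toLp_left hφ.1.continuous]
  have h1 := hf.mapL (innerSL ℝ ((memLp_of_continuous (hφ.continuous_fderiv_apply e)).toLp _ : HSpace))
  have h2 := (hg.mapL (innerSL ℝ ((memLp_of_continuous hφ.1.continuous).toLp _ : HSpace))).neg
  simp only [innerSL_apply_apply] at h1 h2
  refine h1.unique ?_
  refine hasSum_of_eq (fun i => ?_) h2
  rw [inner_toLp_left (hφ.continuous_fderiv_apply e), inner_toLp_left hφ.1.continuous]
  exact h i φ hφ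

/-- The functions `cos(ms) trig_τ(nt)` are admissible tests, as no condition is imposed on tests at
`s = 0, π`; this is where the zero trace of `h` enters. -/
lemma inner_sVec {h hs : HSpace} (hw : HasWeakDeriv (1, 0) h hs) (i : Idx) :
    inner ℝ (sVec i) hs = (i.1.1 : ℕ) * inner ℝ (eigVec i) h := by
  have h1 := hw _ (isTest_waveFun i.1.1 i.1.2 false i.2)
  simp_rw [fderiv_waveFun_space] at h1
  rw [← inner_wave_left] at h1
  have h2 : ∫ z, h z * (-trigSign false * ((i.1.1 : ℕ) : ℝ) * waveFun i.1.1 i.1.2 (!false) i.2 z) ∂cyl =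
      -(((i.1.1 : ℕ) : ℝ) * inner ℝ (rawVec i) h) := by
    rw [rawVec, inner_wave_left, ← integral_const_mul, ← integral_neg]
    refine integral_congr_ae (Filter.Eventually.of_forall fun z => ?_)
    simp [trigSign]
    ring
  rw [h2] at h1
  rw [sVec, eigVec, real_inner_smul_left, real_inner_smul_left, ← neg_injective h1]
  ring

lemma inner_tVec {h ht : HSpace} (hw : HasWeakDeriv (0, 1) h ht) (i : Idx) :
    inner ℝ (tVec i) ht = (i.1.2 : ℝ) * inner ℝ (eigVec i) h := by
  have h1 := hw _ (isTest_waveFun i.1.1 i.1.2 true (!i.2))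
  simp_rw [fderiv_waveFun_time] at h1
  rw [← inner_wave_left] at h1
  have hsq : trigSign i.2 * trigSign i.2 = 1 := by cases i.2 <;> simp [trigSign]
  have hneg : -trigSign (!i.2) = trigSign i.2 := by cases i.2 <;> simp [trigSign]
  have h2 : ∫ z, h z * (-trigSign (!i.2) * (i.1.2 : ℝ) * waveFun i.1.1 i.1.2 true (!!i.2) z) ∂cyl =
      trigSign i.2 * (i.1.2 : ℝ) * inner ℝ (rawVec i) h := by
    rw [rawVec, inner_wave_left, ← integral_const_mul, hneg]
    refine integral_congr_ae (Filter.Eventually.of_forall fun z => ?_)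
    simp only [Bool.not_not]
    ring
  rw [h2] at h1
  rw [tVec, eigVec, real_inner_smul_left, real_inner_smul_left]
  have h3 : inner ℝ (wave i.1.1 i.1.2 true (!i.2)) ht =
      -(trigSign i.2 * (i.1.2 : ℝ) * inner ℝ (rawVec i) h) := by linarith
  rw [h3]
  linear_combination ‖rawVec i‖⁻¹ * (i.1.2 : ℝ) * inner ℝ (rawVec i) h * hsq

/-! ### Regularity of `Lv` -/

lemma rawVec_false (m : ℕ+) (n : ℕ) : rawVec ((m, n), false) = phi m n := rfl

lemma rawVec_true (m : ℕ+) (n : ℕ) : rawVec ((m, n), true) = psi m n := rfl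

lemma eigVec_mem_RSpace {i : Idx} (hi : (i.1.1 : ℕ) ≠ i.1.2) : eigVec i ∈ RSpace := by
  refine RSpace.smul_mem _ (Submodule.le_topologicalClosure _ (Submodule.subset_span ?_))
  obtain ⟨⟨m, n⟩, τ⟩ := i
  refine ⟨m, n, m.pos, hi, ?_⟩
  cases τ
  · exact Or.inl (rawVec_false m n)
  · exact Or.inr (rawVec_true m n)

lemma eigVec_mem_NSpace {i : Idx} (hi : (i.1.1 : ℕ) = i.1.2) : eigVec i ∈ NSpace := by
  refine NSpace.smul_mem _ (Submodule.le_topologicalClosure _ (Submodule.subset_span ?_))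
  obtain ⟨⟨m, n⟩, τ⟩ := i
  simp only at hi
  subst hi
  refine ⟨m, m.pos, ?_⟩
  cases τ
  · exact Or.inl (rawVec_false m m)
  · exact Or.inr (rawVec_true m m)

lemma exists_smul_eigVec {w : HSpace} {m n : ℕ} (hm : 1 ≤ m) (hw : w = phi m n ∨ w = psi m n) :
    ∃ τ : Bool, ∃ r : ℝ, w = r • eigVec (((⟨m, hm⟩ : ℕ+), n), τ) := by
  have key : ∀ i : Idx, rawVec i = ‖rawVec i‖ • eigVec i := fun i => by
    rcases eq_or_ne (rawVec i) 0 with h | h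
    · rw [h, norm_zero, zero_smul]
    · rw [eigVec, smul_smul, mul_inv_cancel₀ (norm_ne_zero_iff.2 h), one_smul]
  rcases hw with rfl | rfl
  · exact ⟨false, _, key (((⟨m, hm⟩ : ℕ+), n), false)⟩
  · exact ⟨true, _, key (((⟨m, hm⟩ : ℕ+), n), true)⟩

/-- Indicator of the indices with `m ≠ n`. -/
def indR (i : Idx) : ℝ := if (i.1.1 : ℕ) ≠ i.1.2 then 1 else 0

/-- Indicator of the indices with `m = n`. -/
def indN (i : Idx) : ℝ := if (i.1.1 : ℕ) = i.1.2 then 1 else 0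

lemma abs_indR_le (i : Idx) : |indR i| ≤ 1 := by
  unfold indR; split_ifs <;> simp

lemma abs_indN_le (i : Idx) : |indN i| ≤ 1 := by
  unfold indN; split_ifs <;> simp

lemma hasSum_inner_of_mem_RSpace {h : HSpace} (hh : h ∈ RSpace) (w : HSpace) :
    HasSum (fun i => indR i * inner ℝ (eigVec i) h * inner ℝ (eigVec i) w) (inner ℝ h w) := by
  have h1 := subOrthonormal_eigVec.hasSum_inner_diagOp abs_indR_le h w
  rwa [subOrthonormal_eigVec.diagOp_eq_self_of_mem eigVec_eq_zero_or abs_indR_le zero_le_one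
    (fun w hw => ?_) hh] at h1
  obtain ⟨m, n, hm, hmn, hw⟩ := hw
  obtain ⟨τ, r, hr⟩ := exists_smul_eigVec hm hw
  exact ⟨_, by unfold indR; exact if_pos hmn, r, hr⟩

lemma hasSum_inner_of_mem_NSpace {h : HSpace} (hh : h ∈ NSpace) (w : HSpace) :
    HasSum (fun i => indN i * inner ℝ (eigVec i) h * inner ℝ (eigVec i) w) (inner ℝ h w) := by
  have h1 := subOrthonormal_eigVec.hasSum_inner_diagOp abs_indN_le h w
  rwa [subOrthonormal_eigVec.diagOp_eq_self_of_mem eigVec_eq_zero_or abs_indN_le zero_le_one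
    (fun w hw => ?_) hh] at h1
  obtain ⟨l, hl, hw⟩ := hw
  obtain ⟨τ, r, hr⟩ := exists_smul_eigVec hl hw
  exact ⟨_, by simp [indN], r, hr⟩

variable {k : ℤ} {d : ℝ}

/-- From `m + n ≤ |eig i| ≤ |eig i - d| + |d|`: multiplication by `m` or `n` keeps the coefficients
of `L` bounded off the diagonal. -/
lemma InGap.idx_mul_coef_le (hd : InGap k d) {i : Idx} (hi : (i.1.1 : ℕ) ≠ i.1.2) {r : ℝ}
    (hr : r ≤ ((i.1.1 : ℕ) : ℝ) + i.1.2) :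
    r * |coef d i| ≤ 1 + |d| / gapDist k d := by
  have h1 := hr.trans (idx_add_le_abs_eig hi)
  have h2 : |eig i| ≤ |eig i - d| + |d| := by
    have := abs_add_le (eig i - d) d
    rwa [sub_add_cancel] at this
  have h3 : 0 < |eig i - d| := abs_pos.2 (hd.eig_sub_ne i)
  have h4 : |d| / |eig i - d| ≤ |d| / gapDist k d :=
    div_le_div_of_nonneg_left (abs_nonneg _) hd.gapDist_pos (gapDist_le k d i)
  rw [coef, abs_div, abs_one, mul_one_div]
  calc r / |eig i - d| ≤ (|eig i - d| + |d|) / |eig i - d| :=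
        div_le_div_of_nonneg_right (h1.trans h2) h3.le
    _ = 1 + |d| / |eig i - d| := by rw [add_div, div_self h3.ne']
    _ ≤ _ := by linarith

/-- `Lv` splits into a part in the energy space and a part in the kernel of `□`, and the part in the
energy space solves the wave equation with right-hand side `v + d L v` weakly. -/
lemma InGap.exists_energy_splitting (hd : InGap k d) (v : HSpace) :
    ∃ w : H1Space × NSpace, hd.clm v = w.1.1.1 + w.2.1 ∧
      (∀ h : H1Space, inner ℝ w.1.1.2.1 h.1.2.1 - inner ℝ w.1.1.2.2 h.1.2.2 =
        inner ℝ (v + d • hd.clm v) h.1.1) ∧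
      ∀ η : NSpace, inner ℝ (v + d • hd.clm v) η.1 = 0 := by
  have hη := hd.gapDist_pos
  have hK : 0 ≤ 1 + |d| / gapDist k d := by positivity
  have hcR : ∀ i, |indR i * coef d i| ≤ 1 / gapDist k d := fun i => by
    rw [abs_mul]
    exact (mul_le_of_le_one_left (abs_nonneg _) (abs_indR_le i)).trans (hd.abs_coef_le i)
  have hcN : ∀ i, |indN i * coef d i| ≤ 1 / gapDist k d := fun i => by
    rw [abs_mul]
    exact (mul_le_of_le_one_left (abs_nonneg _) (abs_indN_le i)).trans (hd.abs_coef_le i)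
  have hidx : ∀ (r : Idx → ℝ), (∀ i, 0 ≤ r i ∧ r i ≤ ((i.1.1 : ℕ) : ℝ) + i.1.2) →
      ∀ i, |r i * (indR i * coef d i)| ≤ 1 + |d| / gapDist k d := fun r hr i => by
    by_cases hi : (i.1.1 : ℕ) ≠ i.1.2
    · rw [indR, if_pos hi, one_mul, abs_mul, abs_of_nonneg (hr i).1]
      exact hd.idx_mul_coef_le hi (hr i).2
    · rw [indR, if_neg hi, zero_mul, mul_zero, abs_zero]
      exact hK
  have hs := hidx (fun i => ((i.1.1 : ℕ) : ℝ)) fun i => ⟨by positivity, by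
    linarith [(Nat.cast_nonneg i.1.2 : (0 : ℝ) ≤ i.1.2)]⟩
  have ht := hidx (fun i => (i.1.2 : ℝ)) fun i => ⟨by positivity, by
    linarith [(Nat.cast_nonneg (i.1.1 : ℕ) : (0 : ℝ) ≤ ((i.1.1 : ℕ) : ℝ))]⟩
  have hX := subOrthonormal_eigVec.hasSum_diagOp hcR v
  have hY := subOrthonormal_eigVec.hasSum_diagOp hcN v
  have hXs := (subOrthonormal_sVec.summable
    (subOrthonormal_eigVec.summable_mul_inner_sq hs v)).hasSum
  have hXt := (subOrthonormal_tVec.summable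
    (subOrthonormal_eigVec.summable_mul_inner_sq ht v)).hasSum
  set X := diagOp eigVec (fun i => indR i * coef d i) v
  set Y := diagOp eigVec (fun i => indN i * coef d i) v
  set Xs : HSpace := ∑' i, ((i.1.1 : ℕ) * (indR i * coef d i) * inner ℝ (eigVec i) v) • sVec i
  set Xt : HSpace := ∑' i, ((i.1.2 : ℝ) * (indR i * coef d i) * inner ℝ (eigVec i) v) • tVec i
  have hXmem : X ∈ RSpace := by
    refine (Submodule.isClosed_topologicalClosure _).mem_of_tendsto hX
      (Filter.Eventually.of_forall fun s => RSpace.sum_mem fun i _ => ?_)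
    by_cases hi : (i.1.1 : ℕ) ≠ i.1.2
    · exact RSpace.smul_mem _ (eigVec_mem_RSpace hi)
    · simp [indR, hi]
  have hYmem : Y ∈ NSpace := by
    refine (Submodule.isClosed_topologicalClosure _).mem_of_tendsto hY
      (Filter.Eventually.of_forall fun s => NSpace.sum_mem fun i _ => ?_)
    by_cases hi : (i.1.1 : ℕ) = i.1.2
    · exact NSpace.smul_mem _ (eigVec_mem_NSpace hi)
    · simp [indN, hi]
  have hXY : hd.clm v = X + Y := by
    refine (hd.hasSum_clm v).unique ?_
    convert hX.add hY using 2 with i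
    rw [← add_smul, indR, indN]
    by_cases hi : (i.1.1 : ℕ) = i.1.2 <;> simp [hi]
  have hXsw : HasWeakDeriv (1, 0) X Xs := by
    refine hasWeakDeriv_of_hasSum hX hXs fun i => ?_
    have := (hasWeakDeriv_eigVec_space i).smul (indR i * coef d i * inner ℝ (eigVec i) v)
    rw [smul_smul] at this
    convert this using 2
    ring
  have hXtw : HasWeakDeriv (0, 1) X Xt := by
    refine hasWeakDeriv_of_hasSum hX hXt fun i => ?_
    have := (hasWeakDeriv_eigVec_time i).smul (indR i * coef d i * inner ℝ (eigVec i) v)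
    rw [smul_smul] at this
    convert this using 2
    ring
  -- Formally `v + dLv = □Lv`. Its coefficients carry the factor `eig i`, which is `m² - n²` in the
  -- pairing with `𝓗¹` and `0` in the pairing with `𝓝`.
  have hw : ∀ i, inner ℝ (eigVec i) (v + d • hd.clm v) =
      eig i * coef d i * inner ℝ (eigVec i) v := fun i => by
    rw [inner_add_right, real_inner_smul_right, hd.inner_eigVec_clm, coef]
    have := hd.eig_sub_ne i
    field_simp
    ring
  refine ⟨(⟨(X, Xs, Xt), hXmem, hXsw, hXtw⟩, ⟨Y, hYmem⟩), hXY, fun h => ?_, fun η => ?_⟩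
  · obtain ⟨⟨h, hs, ht⟩, hhmem, hhs, hht⟩ := h
    change inner ℝ Xs hs - inner ℝ Xt ht = inner ℝ (v + d • hd.clm v) h
    have h1 := hXs.mapL (innerSL ℝ hs)
    have h2 := hXt.mapL (innerSL ℝ ht)
    simp only [innerSL_apply_apply, real_inner_smul_right] at h1 h2
    rw [real_inner_comm, real_inner_comm ht, real_inner_comm h]
    refine (h1.sub h2).unique ?_
    refine hasSum_of_eq (fun i => ?_) (hasSum_inner_of_mem_RSpace hhmem (v + d • hd.clm v))
    rw [hw, real_inner_comm (sVec i), real_inner_comm (tVec i), inner_sVec hhs, inner_tVec hht, eig]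
    ring
  · have h1 := hasSum_inner_of_mem_NSpace η.2 (v + d • hd.clm v)
    rw [real_inner_comm]
    refine h1.unique ?_
    refine hasSum_of_eq (fun i => ?_) hasSum_zero
    rw [hw, indN, eig]
    by_cases hi : (i.1.1 : ℕ) = i.1.2 <;> simp [hi]

/-! ### The nonlinearity -/

/-- `p` composed with the projection onto the fundamental domain. -/
noncomputable def clampP (p : ℝ → ℝ → ℝ → ℝ) (z : ℝ × ℝ) (u : ℝ) : ℝ :=
  p (projIcc 0 Real.pi Real.pi_pos.le z.1) (projIcc 0 (2 * Real.pi) Real.two_pi_pos.le z.2) u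

lemma clampP_eq (p : ℝ → ℝ → ℝ → ℝ) {z : ℝ × ℝ}
    (hz : z ∈ Icc (0 : ℝ) Real.pi ×ˢ Icc (0 : ℝ) (2 * Real.pi)) :
    clampP p z = p z.1 z.2 := by
  funext u
  rw [clampP, projIcc_of_mem _ hz.1, projIcc_of_mem _ hz.2]

lemma ae_cyl_mem : ∀ᵐ z ∂cyl, z ∈ Icc (0 : ℝ) Real.pi ×ˢ Icc (0 : ℝ) (2 * Real.pi) :=
  ae_restrict_mem (measurableSet_Icc.prod measurableSet_Icc)

variable {k : ℤ} {a b d : ℝ} {p : ℝ → ℝ → ℝ → ℝ} {ε₁ ε₂ : ℝ}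

lemma continuous_clampP
    (hp : ContinuousOn (fun x : ℝ × ℝ × ℝ => p x.1 x.2.1 x.2.2) (Icc (0 : ℝ) Real.pi ×ˢ univ)) :
    Continuous fun x : (ℝ × ℝ) × ℝ => clampP p x.1 x.2 := by
  have h : Continuous fun x : (ℝ × ℝ) × ℝ =>
      (((projIcc 0 Real.pi Real.pi_pos.le x.1.1 : ℝ)),
        ((projIcc 0 (2 * Real.pi) Real.two_pi_pos.le x.1.2 : ℝ)), x.2) :=
    (continuous_subtype_val.comp (continuous_projIcc.comp (by fun_prop))).prodMk
      ((continuous_subtype_val.comp (continuous_projIcc.comp (by fun_prop))).prodMk continuous_snd)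
  exact hp.comp_continuous h fun x => ⟨Subtype.prop _, mem_univ _⟩

lemma exists_clampP_le
    (hp : ContinuousOn (fun x : ℝ × ℝ × ℝ => p x.1 x.2.1 x.2.2) (Icc (0 : ℝ) Real.pi ×ˢ univ))
    (hsmall : SmallAtInfinity p) {ε : ℝ} (hε : 0 < ε) :
    ∃ C, 0 ≤ C ∧ ∀ z u, |clampP p z u| ≤ ε * |u| + C := by
  obtain ⟨M, hM, h⟩ := hsmall ε hε
  have hK : IsCompact ((Icc (0 : ℝ) Real.pi) ×ˢ ((Icc (0 : ℝ) (2 * Real.pi)) ×ˢ (Icc (-M) M))) :=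
    isCompact_Icc.prod (isCompact_Icc.prod isCompact_Icc)
  obtain ⟨C, hC⟩ := hK.exists_bound_of_continuousOn
    (hp.mono (prod_mono le_rfl (subset_univ _)))
  refine ⟨|C|, abs_nonneg _, fun z u => ?_⟩
  have h0 : 0 ≤ ε * |u| := by positivity
  by_cases hu : |u| ≤ M
  · have := hC (_, _, u) ⟨(projIcc 0 Real.pi Real.pi_pos.le z.1).2,
      (projIcc 0 (2 * Real.pi) Real.two_pi_pos.le z.2).2, abs_le.1 hu⟩
    have h2 : |clampP p z u| ≤ C := this
    linarith [le_abs_self C]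
  · have hu0 : 0 < |u| := hM.trans (not_le.1 hu)
    have h1 := h _ (projIcc 0 Real.pi Real.pi_pos.le z.1).2
      (projIcc 0 (2 * Real.pi) Real.two_pi_pos.le z.2) u (not_le.1 hu)
    rw [abs_div, div_lt_iff₀ hu0] at h1
    have h2 : |clampP p z u| < ε * |u| := h1
    linarith [abs_nonneg C]

/-- The right-hand side minus `d u`, on the fundamental domain. -/
noncomputable def shiftRhs (a b : ℝ) (p : ℝ → ℝ → ℝ → ℝ) (d : ℝ) (z : ℝ × ℝ) (u : ℝ) : ℝ :=
  jump (a - d) (b - d) u + clampP p z u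

lemma jump_sub (a b d u : ℝ) : jump (a - d) (b - d) u = jump a b u - d * u := by
  rcases le_total 0 u with h | h
  · rw [jump_of_nonneg _ _ h, jump_of_nonneg _ _ h]; ring
  · rw [jump_of_nonpos _ _ h, jump_of_nonpos _ _ h]; ring

lemma shiftRhs_eq (a b : ℝ) (p : ℝ → ℝ → ℝ → ℝ) (d : ℝ) (z : ℝ × ℝ) (u : ℝ) :
    shiftRhs a b p d z u = rhs a b p (projIcc 0 Real.pi Real.pi_pos.le z.1)
      (projIcc 0 (2 * Real.pi) Real.two_pi_pos.le z.2) u - d * u := by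
  rw [shiftRhs, jump_sub, jump, rhs, clampP]
  ring

lemma continuous_shiftRhs
    (hp : ContinuousOn (fun x : ℝ × ℝ × ℝ => p x.1 x.2.1 x.2.2) (Icc (0 : ℝ) Real.pi ×ˢ univ)) :
    Continuous fun x : (ℝ × ℝ) × ℝ => shiftRhs a b p d x.1 x.2 :=
  ((continuous_jump _ _).comp continuous_snd).add (continuous_clampP hp)

lemma prim_shiftRhs
    (hp : ContinuousOn (fun x : ℝ × ℝ × ℝ => p x.1 x.2.1 x.2.2) (Icc (0 : ℝ) Real.pi ×ˢ univ))
    (z : ℝ × ℝ) (u : ℝ) : prim (shiftRhs a b p d) z u =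
      1 / 2 * jumpSq (a - d) (b - d) u + prim (clampP p) z u := by
  have hc : Continuous (clampP p z) :=
    (continuous_clampP hp).comp (by fun_prop : Continuous fun u : ℝ => (z, u))
  rw [← integral_jump, prim, prim, ← intervalIntegral.integral_add
    ((continuous_jump _ _).intervalIntegrable _ _) (hc.intervalIntegrable _ _)]
  rfl

lemma exists_prim_clampP_le
    (hp : ContinuousOn (fun x : ℝ × ℝ × ℝ => p x.1 x.2.1 x.2.2) (Icc (0 : ℝ) Real.pi ×ˢ univ))
    (hsmall : SmallAtInfinity p) {ε : ℝ} (hε : 0 < ε) :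
    ∃ C, 0 ≤ C ∧ ∀ z u, |prim (clampP p) z u| ≤ ε * u ^ 2 + C := by
  obtain ⟨C, hC, h⟩ := exists_clampP_le hp hsmall (half_pos hε)
  refine ⟨C ^ 2 / (2 * ε), by positivity, fun z u => ?_⟩
  have h1 : ‖∫ τ in (0 : ℝ)..u, clampP p z τ‖ ≤ (ε / 2 * |u| + C) * |u - 0| := by
    refine intervalIntegral.norm_integral_le_of_norm_le_const fun τ hτ => (h z τ).trans ?_
    have h2 : |τ| ≤ |u| := by
      have := abs_sub_left_of_mem_uIcc (uIoc_subset_uIcc hτ)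
      simpa using this
    nlinarith
  rw [sub_zero] at h1
  refine h1.trans ?_
  -- Half of `ε` comes from the growth of `p`; the other half absorbs the linear term `C|u|` by
  -- Young's inequality.
  have h3 : 0 ≤ (ε * |u| - C) ^ 2 / (2 * ε) := by positivity
  have h4 : (ε * |u| - C) ^ 2 / (2 * ε) = ε / 2 * |u| ^ 2 - C * |u| + C ^ 2 / (2 * ε) := by
    field_simp
    ring
  rw [← sq_abs u]
  nlinarith

lemma Suitable.dualIntegrand
    (hp : ContinuousOn (fun x : ℝ × ℝ × ℝ => p x.1 x.2.1 x.2.2) (Icc (0 : ℝ) Real.pi ×ˢ univ))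
    (hsmall : SmallAtInfinity p) (hs : Suitable k a b p ε₁ ε₂) :
    DualIntegrand (shiftRhs a b p (pk k ε₁)) (mu k ε₁ ε₂) (a - pk k ε₁) (b - pk k ε₁) where
  cont := continuous_shiftRhs hp
  mono z u w huw := by
    rw [shiftRhs_eq, shiftRhs_eq]
    exact (hs.2.2 _ (Subtype.prop _) _).1.monotone huw
  anti z u w huw := by
    have h := (hs.2.2 _ (projIcc 0 Real.pi Real.pi_pos.le z.1).2
      (projIcc 0 (2 * Real.pi) Real.two_pi_pos.le z.2)).2.antitone huw
    simp only [shiftRhs_eq, qk] at h ⊢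
    have e : ∀ x : ℝ, x / mu k ε₁ ε₂ = 1 / mu k ε₁ ε₂ * x := fun x => by ring
    rw [e u, e w]
    linarith
  mu_pos := hs.1.mu_pos
  alpha_pos := sub_pos.2 hs.2.1.1.1
  beta_pos := sub_pos.2 hs.2.1.2.1
  asymp ε hε := by
    obtain ⟨C, hC, h⟩ := exists_prim_clampP_le hp hsmall hε
    refine ⟨C, hC, fun z u => ?_⟩
    rw [prim_shiftRhs hp, add_sub_cancel_left]
    exact h z u

lemma conj_shiftRhs_eq
    (hp : ContinuousOn (fun x : ℝ × ℝ × ℝ => p x.1 x.2.1 x.2.2) (Icc (0 : ℝ) Real.pi ×ˢ univ))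
    {z : ℝ × ℝ} (hz : z ∈ Icc (0 : ℝ) Real.pi ×ˢ Icc (0 : ℝ) (2 * Real.pi)) (v : ℝ) :
    funJstar d a b p z.1 z.2 v = conj (shiftRhs a b p d) z v := by
  rw [funJstar, conj]
  congr 1
  funext u
  rw [prim_shiftRhs hp, prim, clampP_eq p hz, funJ, primP, jumpSq]
  ring

/-- The `μ`-terms inside `F` and under the integral cancel; both integrands are integrable, so the
integral may be split. -/
lemma Suitable.dualI_eq
    (hp : ContinuousOn (fun x : ℝ × ℝ × ℝ => p x.1 x.2.1 x.2.2) (Icc (0 : ℝ) Real.pi ×ˢ univ))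
    (hsmall : SmallAtInfinity p) (hs : Suitable k a b p ε₁ ε₂) (v : HSpace) :
    dualI k ε₁ ε₂ a b p v = dualFun hs.1 (shiftRhs a b p (pk k ε₁)) v := by
  have h : ∫ z, (funJstar (pk k ε₁) a b p z.1 z.2 (v z) - mu k ε₁ ε₂ / 2 * (v z) ^ 2) ∂cyl =
      conjInt (shiftRhs a b p (pk k ε₁)) v - mu k ε₁ ε₂ / 2 * ‖v‖ ^ 2 := by
    rw [conjInt, norm_sq_eq_integral, ← integral_const_mul,
      ← integral_sub ((hs.dualIntegrand hp hsmall).integrable_conj v)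
        ((integrable_sq v).const_mul _)]
    refine integral_congr_ae ?_
    filter_upwards [ae_cyl_mem] with z hz
    rw [conj_shiftRhs_eq hp hz]
  rw [dualI, h, hs.1.funF_eq, dualFun]
  ring

/-- Without the shift monotonicity may fail, but adding `p_k u` back costs only `|p_k|` in the
Lipschitz constant. This makes the energy differentiable. -/
lemma Suitable.lipIntegrand
    (hp : ContinuousOn (fun x : ℝ × ℝ × ℝ => p x.1 x.2.1 x.2.2) (Icc (0 : ℝ) Real.pi ×ˢ univ))
    (hsmall : SmallAtInfinity p) (hs : Suitable k a b p ε₁ ε₂) :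
    LipIntegrand (shiftRhs a b p 0) (1 / mu k ε₁ ε₂ + |pk k ε₁|) where
  cont := continuous_shiftRhs hp
  lip z u w := by
    have h := (hs.dualIntegrand hp hsmall).lip.lip z u w
    have e : shiftRhs a b p 0 z u - shiftRhs a b p 0 z w =
        (shiftRhs a b p (pk k ε₁) z u - shiftRhs a b p (pk k ε₁) z w) + pk k ε₁ * (u - w) := by
      simp only [shiftRhs_eq]; ring
    rw [e, add_mul, ← abs_mul]
    exact (abs_add_le _ _).trans (by linarith)

/-! ### Critical points of the energy -/

/-- `(x, y) ↦ x + y`. -/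
noncomputable def sumCLM : (H1Space × NSpace) →L[ℝ] HSpace :=
  (ContinuousLinearMap.fst ℝ HSpace (HSpace × HSpace)).comp
    (H1Space.subtypeL.comp (ContinuousLinearMap.fst ℝ H1Space NSpace)) +
  NSpace.subtypeL.comp (ContinuousLinearMap.snd ℝ H1Space NSpace)

/-- `(x, y) ↦ x_s`. -/
noncomputable def spaceCLM : (H1Space × NSpace) →L[ℝ] HSpace :=
  ((ContinuousLinearMap.fst ℝ HSpace HSpace).comp
    (ContinuousLinearMap.snd ℝ HSpace (HSpace × HSpace))).comp
    (H1Space.subtypeL.comp (ContinuousLinearMap.fst ℝ H1Space NSpace))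

/-- `(x, y) ↦ x_t`. -/
noncomputable def timeCLM : (H1Space × NSpace) →L[ℝ] HSpace :=
  ((ContinuousLinearMap.snd ℝ HSpace HSpace).comp
    (ContinuousLinearMap.snd ℝ HSpace (HSpace × HSpace))).comp
    (H1Space.subtypeL.comp (ContinuousLinearMap.fst ℝ H1Space NSpace))

lemma sumCLM_apply (w : H1Space × NSpace) : sumCLM w = w.1.1.1 + w.2.1 := rfl

lemma spaceCLM_apply (w : H1Space × NSpace) : spaceCLM w = w.1.1.2.1 := rfl

lemma timeCLM_apply (w : H1Space × NSpace) : timeCLM w = w.1.1.2.2 := rfl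

/-- The terms in `a` and `b` are part of the primitive of the unshifted right-hand side, leaving
only the two derivative norms outside the integral. -/
lemma energy_eq
    (hp : ContinuousOn (fun x : ℝ × ℝ × ℝ => p x.1 x.2.1 x.2.2) (Icc (0 : ℝ) Real.pi ×ˢ univ))
    {K : ℝ} (hf : LipIntegrand (shiftRhs a b p 0) K) (w : H1Space × NSpace) :
    energy a b p w = (1 / 2 : ℝ) * (‖spaceCLM w‖ ^ 2 - ‖timeCLM w‖ ^ 2) -
      ∫ z, prim (shiftRhs a b p 0) z (sumCLM w z) ∂cyl := by
  have hae : (fun z => primP p z.1 z.2 (sumCLM w z)) =ᵐ[cyl] fun z =>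
      prim (shiftRhs a b p 0) z (sumCLM w z) - 1 / 2 * jumpSq a b (sumCLM w z) := by
    filter_upwards [ae_cyl_mem] with z hz
    rw [prim_shiftRhs hp, sub_zero, sub_zero, add_sub_cancel_left, prim, clampP_eq p hz, primP]
  have h := integral_congr_ae hae
  rw [integral_sub (hf.integrable_prim _) ((integrable_jumpSq _ _ _).const_mul _),
    integral_const_mul, ← jumpForm_eq_integral, jumpForm] at h
  simp only [energy]
  rw [← sumCLM_apply, ← spaceCLM_apply, ← timeCLM_apply, h]
  ring

/-- The critical point equation of the energy. -/
lemma isWeakSolution_of_equation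
    (hp : ContinuousOn (fun x : ℝ × ℝ × ℝ => p x.1 x.2.1 x.2.2) (Icc (0 : ℝ) Real.pi ×ˢ univ))
    {K : ℝ} (hf : LipIntegrand (shiftRhs a b p 0) K) {u : HSpace} (w : H1Space × NSpace)
    (hu : u = w.1.1.1 + w.2.1)
    (h1 : ∀ h : H1Space, inner ℝ w.1.1.2.1 h.1.2.1 - inner ℝ w.1.1.2.2 h.1.2.2 =
        inner ℝ (hf.nem u) h.1.1)
    (h2 : ∀ η : NSpace, inner ℝ (hf.nem u) η.1 = 0) : IsWeakSolution a b p u := by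
  refine ⟨w, hu, ?_⟩
  have hE : energy a b p = fun w => (1 / 2 : ℝ) * (‖spaceCLM w‖ ^ 2 - ‖timeCLM w‖ ^ 2) -
      ∫ z, prim (shiftRhs a b p 0) z (sumCLM w z) ∂cyl := funext (energy_eq hp hf)
  rw [hE]
  have hs := (spaceCLM.hasFDerivAt (x := w)).norm_sq
  have ht := (timeCLM.hasFDerivAt (x := w)).norm_sq
  have hN := (hf.hasFDerivAt (sumCLM w)).comp w sumCLM.hasFDerivAt
  refine (((hs.sub ht).const_mul (1 / 2)).sub hN).congr_fderiv ?_
  refine ContinuousLinearMap.ext fun y => ?_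
  have e1 := h1 y.1
  have e2 := h2 y.2
  have e3 : inner ℝ (hf.nem u) (sumCLM y) = inner ℝ (hf.nem u) y.1.1.1 := by
    rw [sumCLM_apply, inner_add_right, e2, add_zero]
  rw [hu, ← sumCLM_apply] at e1 e3
  rw [← spaceCLM_apply, ← timeCLM_apply, ← spaceCLM_apply, ← timeCLM_apply] at e1
  simp only [sub_apply, smul_apply, ContinuousLinearMap.comp_apply, innerSL_apply_apply,
    zero_apply, smul_eq_mul, nsmul_eq_mul, e3]
  push_cast
  linarith

/-- The Euler equation reads `v₀ = rhs(u₀) - p_k u₀` with `u₀ = Lv₀`. Hence `v₀ + p_k u₀`, which the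
splitting identifies weakly with `□u₀`, equals `rhs(u₀)`. -/
lemma Suitable.isWeakSolution
    (hp : ContinuousOn (fun x : ℝ × ℝ × ℝ => p x.1 x.2.1 x.2.2) (Icc (0 : ℝ) Real.pi ×ˢ univ))
    (hsmall : SmallAtInfinity p) (hs : Suitable k a b p ε₁ ε₂) {v₀ : HSpace}
    (hmax : ∀ v, dualI k ε₁ ε₂ a b p v ≤ dualI k ε₁ ε₂ a b p v₀) :
    IsWeakSolution a b p (opL (pk k ε₁) v₀) := by
  simp only [hs.dualI_eq hp hsmall] at hmax
  have heuler := dualFun_euler hs.1 (hs.dualIntegrand hp hsmall) hmax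
  have hf := hs.lipIntegrand hp hsmall
  obtain ⟨w, hw, h1, h2⟩ := hs.1.inGap.exists_energy_splitting v₀
  have hnem : hf.nem (hs.1.inGap.clm v₀) = v₀ + pk k ε₁ • hs.1.inGap.clm v₀ := by
    refine Lp.ext ?_
    filter_upwards [hf.coeFn_nem (hs.1.inGap.clm v₀), heuler,
      Lp.coeFn_add v₀ (pk k ε₁ • hs.1.inGap.clm v₀),
      Lp.coeFn_smul (pk k ε₁) (hs.1.inGap.clm v₀)] with z e1 e2 e3 e4
    rw [e1, e3, Pi.add_apply, e4, Pi.smul_apply, e2, shiftRhs_eq, shiftRhs_eq, smul_eq_mul]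
    ring
  rw [← hs.1.inGap.clm_apply]
  exact isWeakSolution_of_equation hp hf w hw (fun h => by rw [hnem]; exact h1 h)
    fun η => by rw [hnem]; exact h2 η

/-! ### Suitable parameters -/

lemma strictAnti_jump {α β : ℝ} (hα : α < 0) (hβ : β < 0) : StrictAnti (jump α β) := by
  intro x y hxy
  rcases le_total 0 x with hx | hx
  · rw [jump_of_nonneg _ _ hx, jump_of_nonneg _ _ (hx.trans hxy.le)]
    nlinarith
  · rcases le_total 0 y with hy | hy
    · rw [jump_of_nonpos _ _ hx, jump_of_nonneg _ _ hy]
      rcases hx.lt_or_eq with hx' | rfl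
      · nlinarith
      · nlinarith
    · rw [jump_of_nonpos _ _ hx, jump_of_nonpos _ _ hy]
      nlinarith

/-- As `ε₂ → 0⁺`, the bound `q_k` tends to `+∞` when `p_k > 0`, and to `p_k + 1/(-1/p_k) = 0` when
`p_k < 0`. So `q_k` can be pushed above any `T` of the admitted kind. -/
lemma exists_mu_bound (hl : 0 ≤ lam (k - 1) ∨ lam k < 0) (hd : InGap k d) {T : ℝ}
    (hT : lam k < 0 → T < 0) : ∃ ε₂ > 0, ε₂ < 1 / (lam k - d) - max 0 (-1 / d) ∧
      T < d + 1 / (max 0 (-1 / d) + ε₂) := by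
  have hgap : 0 < lam k - d := sub_pos.2 hd.2
  have h1 : ∀ᶠ ε in nhdsWithin (0 : ℝ) (Ioi 0), T < d + 1 / (max 0 (-1 / d) + ε) := by
    rcases hl with hl | hl
    · have hd0 : 0 < d := hl.trans_lt hd.1
      have hm : max 0 (-1 / d) = 0 := max_eq_left (div_nonpos_of_nonpos_of_nonneg (by norm_num) hd0.le)
      have ht : Filter.Tendsto (fun ε : ℝ => d + 1 / (max 0 (-1 / d) + ε))
          (nhdsWithin (0 : ℝ) (Ioi 0)) Filter.atTop := by
        simp only [hm, zero_add, one_div]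
        exact Filter.tendsto_atTop_add_const_left _ _ tendsto_inv_nhdsGT_zero
      exact ht.eventually (Filter.eventually_gt_atTop T)
    · have hd0 : d < 0 := hd.2.trans hl
      have hpos : 0 < -1 / d := div_pos_of_neg_of_neg (by norm_num) hd0
      have hm : max 0 (-1 / d) = -1 / d := max_eq_right hpos.le
      have hc : ContinuousAt (fun ε : ℝ => d + 1 / (max 0 (-1 / d) + ε)) 0 := by
        refine continuousAt_const.add (continuousAt_const.div
          (continuousAt_const.add continuousAt_id) ?_)
        rw [hm]
        simpa using hpos.ne'
      have h0 : d + 1 / (max 0 (-1 / d) + 0) = 0 := by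
        rw [hm, add_zero]
        field_simp
        ring
      refine (hc.eventually (lt_mem_nhds ?_)).filter_mono nhdsWithin_le_nhds
      simp only [h0]
      exact hT hl
  have h2 : 0 < 1 / (lam k - d) - max 0 (-1 / d) := by
    rw [sub_pos]
    refine max_lt (by positivity) ?_
    rcases hl with hl | hl
    · have hd0 : 0 < d := hl.trans_lt hd.1
      exact (div_neg_of_neg_of_pos (by norm_num) hd0).trans (by positivity)
    · have hd0 : d < 0 := hd.2.trans hl
      -- For `λ_k < 0` one has `0 < λ_k - d < -d`, so the interval of admissible `ε₂` is nonempty.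
      rw [neg_div, ← one_div_neg_eq_neg_one_div]
      exact one_div_lt_one_div_of_lt hgap (by linarith)
  obtain ⟨ε, hε1, hε2⟩ := (h1.and (Ioo_mem_nhdsGT h2)).exists
  exact ⟨ε, hε2.1, hε2.2, hε1⟩

/-- First `ε₁` is taken so small that `p_k` stays below `a`, `b`, `λ_k` and `λ_{k-1} + ε₀`; the
surplus slope turns (H1) into strict monotonicity. Then `ε₂` is chosen to bring `q_k` above a
threshold `T`. -/
lemma exists_suitable (hk : lam k ≠ 0) (hgap : lam (k - 1) < lam k) (hH1 : H1 k a b p)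
    (hH2 : H2 k p) (hH3 : H3 k a b p) (hQ : (a, b) ∈ Qcheck k) :
    ∃ ε₁ ε₂ : ℝ, Suitable k a b p ε₁ ε₂ := by
  obtain ⟨ha, hb, hneg⟩ := hQ
  simp only at ha hb hneg
  obtain ⟨ε₀, hε₀, hmono⟩ := hH1
  obtain ⟨ε₁, hε₁, hlt⟩ : ∃ ε₁ : ℝ, 0 < ε₁ ∧ ε₁ < min (min ε₀ (lam k - lam (k - 1)))
      (min (a - lam (k - 1)) (b - lam (k - 1))) := by
    refine exists_between (lt_min (lt_min hε₀ ?_) (lt_min ?_ ?_)) <;> linarith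
  obtain ⟨⟨h1, h2⟩, h3, h4⟩ : (ε₁ < ε₀ ∧ ε₁ < lam k - lam (k - 1)) ∧
      ε₁ < a - lam (k - 1) ∧ ε₁ < b - lam (k - 1) := by
    simpa only [lt_min_iff] using hlt
  have hd : InGap k (pk k ε₁) := ⟨by rw [pk]; linarith, by rw [pk]; linarith⟩
  have hl : 0 ≤ lam (k - 1) ∨ lam k < 0 :=
    (nonneg_lam_or_lam_nonpos k).imp_right fun h => lt_of_le_of_ne h hk
  -- Any slope above `T` makes the shifted right-hand side strictly decreasing. For `λ_k < 0` (H3)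
  -- gives `T = max{a, b, -ε} < 0`; for `λ_k > 0` (H2) gives `T = max{a, b} + c` with `c = 1/ε`.
  obtain ⟨T, hT, haT, hbT, hanti⟩ : ∃ T : ℝ, (lam k < 0 → T < 0) ∧ a ≤ T ∧ b ≤ T ∧
      ∀ q, T < q → ∀ s ∈ Icc (0 : ℝ) Real.pi, ∀ t : ℝ, StrictAnti fun u => rhs a b p s t u - q * u := by
    rcases hk.lt_or_gt with hneg' | hpos
    · obtain ⟨ε, hε, hε'⟩ := hH3 hneg'
      obtain ⟨ha0, hb0⟩ := hneg hneg'
      refine ⟨max (max a b) (-ε), fun _ => max_lt (max_lt ha0 hb0) (by linarith),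
        (le_max_left _ _).trans (le_max_left _ _), (le_max_right _ _).trans (le_max_left _ _),
        fun q hq s hs t x y hxy => ?_⟩
      have hq' : -ε < q := (le_max_right _ _).trans_lt hq
      have := hε' s hs t hxy.le
      simp only at this ⊢
      nlinarith
    · obtain ⟨c, hc, hc'⟩ : ∃ c > 0, ∀ s ∈ Icc (0 : ℝ) Real.pi, ∀ t : ℝ,
          Antitone fun u => p s t u - c * u := by
        obtain ⟨ε, hε, hε'⟩ := hH2 hpos
        exact ⟨1 / ε, one_div_pos.2 hε, hε'⟩
      refine ⟨max a b + c, fun h => absurd h hpos.not_gt,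
        (le_max_left _ _).trans (by linarith), (le_max_right _ _).trans (by linarith),
        fun q hq s hs t x y hxy => ?_⟩
      have h5 := hc' s hs t hxy.le
      have h6 := strictAnti_jump (α := a - (q - c)) (β := b - (q - c))
        (by linarith [le_max_left a b]) (by linarith [le_max_right a b]) hxy
      rw [jump_sub, jump_sub, jump, jump] at h6
      simp only [rhs] at h5 ⊢
      linarith
  obtain ⟨ε₂, hε₂, hlt₂, hq⟩ := exists_mu_bound hl hd hT
  have hq' : T < qk k ε₁ ε₂ := hq
  refine ⟨ε₁, ε₂, ⟨hε₁, h2, hε₂, ?_⟩, ⟨⟨?_, haT.trans_lt hq'⟩, ⟨?_, hbT.trans_lt hq'⟩⟩,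
    fun s hs t => ⟨fun x y hxy => ?_, hanti _ hq' s hs t⟩⟩
  · rw [sub_sub]
    exact hlt₂
  · change pk k ε₁ < a
    rw [pk]; linarith
  · change pk k ε₁ < b
    rw [pk]; linarith
  · have := hmono s hs t hxy.le
    simp only at this ⊢
    rw [pk]
    nlinarith

end FucikWave

/-! ### The main theorem -/

theorem mainTheorem3 (k : ℤ) (hk : FucikWave.lam k ≠ 0) (a b : ℝ) (p : ℝ → ℝ → ℝ → ℝ)
    (hp_cont : ContinuousOn (fun x : ℝ × ℝ × ℝ => p x.1 x.2.1 x.2.2)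
      (Set.Icc (0 : ℝ) Real.pi ×ˢ Set.univ))
    (hp_per : ∀ s ∈ Set.Icc (0 : ℝ) Real.pi, ∀ t u : ℝ, p s (t + 2 * Real.pi) u = p s t u)
    (hp_small : FucikWave.SmallAtInfinity p)
    (hH1 : FucikWave.H1 k a b p) (hH2 : FucikWave.H2 k p) (hH3 : FucikWave.H3 k a b p)
    (hQ : (a, b) ∈ FucikWave.Qcheck k) (hC : FucikWave.BelowCk k (a, b)) :
    (∃ u : FucikWave.HSpace, FucikWave.IsWeakSolution a b p u) ∧
    (∃ ε₁ ε₂ : ℝ, FucikWave.Suitable k a b p ε₁ ε₂) ∧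
    ∀ ε₁ ε₂ : ℝ, FucikWave.Suitable k a b p ε₁ ε₂ →
      (∃ v₀ : FucikWave.HSpace, ∀ v : FucikWave.HSpace,
        FucikWave.dualI k ε₁ ε₂ a b p v ≤ FucikWave.dualI k ε₁ ε₂ a b p v₀) ∧
      ∀ v₀ : FucikWave.HSpace,
        (∀ v : FucikWave.HSpace,
          FucikWave.dualI k ε₁ ε₂ a b p v ≤ FucikWave.dualI k ε₁ ε₂ a b p v₀) →
        FucikWave.IsWeakSolution a b p (FucikWave.opL (FucikWave.pk k ε₁) v₀) := by
  obtain ⟨δ₁, δ₂, hδ, hδQ, hδpos⟩ := hC.exists_curveFun_pos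
  have hsuit : ∃ ε₁ ε₂ : ℝ, FucikWave.Suitable k a b p ε₁ ε₂ :=
    FucikWave.exists_suitable hk (by linarith [hδ.1, hδ.2.1]) hH1 hH2 hH3 hQ
  have hdual : ∀ ε₁ ε₂ : ℝ, FucikWave.Suitable k a b p ε₁ ε₂ →
      ∃ v₀ : FucikWave.HSpace, ∀ v : FucikWave.HSpace,
        FucikWave.dualI k ε₁ ε₂ a b p v ≤ FucikWave.dualI k ε₁ ε₂ a b p v₀ := by
    intro ε₁ ε₂ hs
    -- The parameters witnessing that `(a, b)` is below the curve need not be suitable, so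
    -- positivity is carried over to the given square.
    obtain ⟨v₀, hv₀⟩ := FucikWave.exists_max_dualFun hs.1 hs.2.1
      (hδ.curveFun_pos_change hs.1 hδQ hs.2.1 hδpos) (hs.dualIntegrand hp_cont hp_small)
    refine ⟨v₀, fun v => ?_⟩
    rw [hs.dualI_eq hp_cont hp_small, hs.dualI_eq hp_cont hp_small]
    exact hv₀ v
  refine ⟨?_, hsuit, fun ε₁ ε₂ hs => ⟨hdual ε₁ ε₂ hs, fun v₀ hmax =>
    hs.isWeakSolution hp_cont hp_small hmax⟩⟩
  obtain ⟨ε₁, ε₂, hs⟩ := hsuit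
  obtain ⟨v₀, hv₀⟩ := hdual ε₁ ε₂ hs
  exact ⟨_, hs.isWeakSolution hp_cont hp_small hv₀⟩
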